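/- Let $m\ge 2$, $d\ge 1$ be integers and $s>\frac{(m-1)d}{2}+\frac12$. Let $\sigma$ be a finite positive Borel measure on $\mathbb{R}^{md}$, supported in the closed unit ball centred at the origin, whose Fourier transform $\widehat{\mathrm d\sigma}(\xi)=\int e^{-2\pi i y\cdot\xi}\,\mathrm d\sigma(y)$ satisfies $|\widehat{\mathrm d\sigma}(\xi)|\le A(1+|\xi|)^{-s}$ for all $\xi\in\mathbb{R}^{md}$, for some constant $A$. Writing $y=(y_1,\dots,y_m)$ with $y_i\in\mathbb{R}^d$, put $$\mathrm M_\sigma(f_1,\dots,f_m)(x)=\sup_{t>0}\Big|\int\prod_{i=1}^m f_i(x-ty_i)\,\mathrm d\sigma(y)\Big|,\qquad x\in\mathbb{R}^d.$$ Then there is a constant $C<\infty$, independent of $f_1,\dots,f_m$, such that for all $f_1,\dots,f_m\in L^2(\mathbb{R}^d)$ (complex-valued; in particular for all Schwartz functions) the integrals defining $\mathrm M_\sigma(f_1,\dots,f_m)(x)$ converge absolutely for almost every $x$ and every $t>0$, and $$\|\mathrm M_\sigma(f_1,\dots,f_m)\|_{L^{2/m}(\mathbb{R}^d)}\le C\prod_{i=1}^m\|f_i\|_{L^2(\mathbb{R}^d)}.$$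 -/

import Mathlib

open MeasureTheory
open scoped ENNReal NNReal RealInnerProductSpace

/-- The Euclidean space `ℝ^{md}`, whose points are written `y = (y₁, …, y_m)` with `y_i ∈ ℝ^d`;
its norm is `|y| = (|y₁|² + ⋯ + |y_m|²)^{1/2}`. -/
abbrev ProdSpace (m d : ℕ) : Type := PiLp 2 (fun _ : Fin m => EuclideanSpace ℝ (Fin d))

/-- The Fourier transform `∫ e^{-2πi y·ξ} dσ(y)` of a measure on `ℝ^{md}`. -/
noncomputable def fourierMeasure {m d : ℕ} (σ : Measure (ProdSpace m d)) (ξ : ProdSpace m d) : ℂ :=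
  ∫ y, Complex.exp (-(2 * Real.pi * ⟪y, ξ⟫ : ℝ) * Complex.I) ∂σ

/-- The decay condition `|σ^(ξ)| ≲ (1 + |ξ|)^{-s}`. -/
def HasFourierDecay {m d : ℕ} (σ : Measure (ProdSpace m d)) (s : ℝ) : Prop :=
  ∃ A : ℝ, ∀ ξ : ProdSpace m d, ‖fourierMeasure σ ξ‖ ≤ A * (1 + ‖ξ‖) ^ (-s)

/-- The multilinear average `A_σ(F)(x, t) = ∫ ∏ᵢ fᵢ(x - t yᵢ) dσ(y)`. -/
noncomputable def multAverage {m d : ℕ} (σ : Measure (ProdSpace m d))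
    (f : Fin m → EuclideanSpace ℝ (Fin d) → ℂ) (x : EuclideanSpace ℝ (Fin d)) (t : ℝ) : ℂ :=
  ∫ y, ∏ i, f i (x - t • y i) ∂σ

/-- The multilinear maximal average `M_σ(F)(x) = sup_{t > 0} |A_σ(F)(x, t)|`, a supremum
in `[0, ∞]`. -/
noncomputable def multMaximal {m d : ℕ} (σ : Measure (ProdSpace m d))
    (f : Fin m → EuclideanSpace ℝ (Fin d) → ℂ) (x : EuclideanSpace ℝ (Fin d)) : ℝ≥0∞ :=
  ⨆ (t : ℝ) (_ : 0 < t), ‖multAverage σ f x t‖ₑ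

/-!
Fix the scale `t ∈ [1, 2]`. On the diagonal `x₁ = ⋯ = x_m` the average is the restriction of an
inverse Fourier transform in `md` variables with symbol `σ^(tξ) ∏ᵢ fᵢ^(ξᵢ)`. On a frequency shell
`|ξ| ~ 2^j` this restriction costs `2^{j(m-1)d/2}` in `L²` by Cauchy–Schwarz along the fibres of
`ξ ↦ ∑ᵢ ξᵢ`, and the supremum over `t` costs `2^{j/2}` by a one-dimensional Sobolev inequality; as
`s > (m-1)d/2 + 1/2`, the decay of `σ^` pays for both and leaves a gain `2^{-jδ}`. Hence the maximal
function over `t ∈ [1, 2]` maps products of Sobolev spaces of slightly negative order to `L²`.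

At each dyadic scale, split every `fᵢ` into an average at that scale and a high-frequency remainder.
If no factor is a remainder, a product of Hardy–Littlewood maximal functions dominates. Otherwise
localize to balls at that scale: low-frequency factors are bounded pointwise there by
Hardy–Littlewood maximal functions, which are divided out, while the remainders are measured in the
negative Sobolev norm, whose squares are summable over all dyadic scales by Plancherel. Hölder's
inequality puts the divided-out maximal functions back.

For general `fᵢ ∈ L²`, absolute convergence at almost every `x` and all `t` does not follow by
density, as `σ` may be singular. Instead the `|fᵢ|` have lower semicontinuous majorants, which are
dominated by limits inferior of test functions, and Fatou's lemma applies.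
-/

section FourierL2

open FourierTransform

variable {V : Type*} [NormedAddCommGroup V] [InnerProductSpace ℝ V] [FiniteDimensional ℝ V]
  [MeasurableSpace V] [BorelSpace V]

theorem continuous_fourier {f : V → ℂ} (hf : Integrable f) : Continuous (𝓕 f) :=
  VectorFourier.fourierIntegral_continuous Real.continuous_fourierChar
    (L := innerₗ V) continuous_inner hf

-- The two transforms agree as tempered distributions, hence when tested against smooth bumps.
theorem fourier_toLp_ae_eq {f : V → ℂ} (hf : Integrable f) (hf₂ : MemLp f 2) :
    (𝓕 (hf₂.toLp f) : Lp ℂ 2 (volume : Measure V)) =ᵐ[volume] 𝓕 f := by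
  refine ae_eq_of_integral_contDiff_smul_eq
    ((Lp.memLp (𝓕 (hf₂.toLp f))).locallyIntegrable (by norm_num))
    ((continuous_fourier hf).locallyIntegrable (μ := volume)) fun g g_smooth g_cpt => ?_
  have hg_cpt : HasCompactSupport (Complex.ofRealCLM ∘ g) := g_cpt.comp_left rfl
  set G := hg_cpt.toSchwartzMap (Complex.ofRealCLM.contDiff.comp g_smooth)
  have distributional := congrArg (fun T => T G) (Lp.fourier_toTemperedDistribution_eq (hf₂.toLp f))
  simp only [TemperedDistribution.fourier_apply, Lp.toTemperedDistribution_apply] at distributional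
  have fubini := VectorFourier.integral_fourierIntegral_smul_eq_flip (L := innerₗ V)
    Real.continuous_fourierChar continuous_inner (G.integrable (μ := volume)) hf
  rw [flip_innerₗ] at fubini
  calc ∫ x, g x • (𝓕 (hf₂.toLp f) : Lp ℂ 2 (volume : Measure V)) x
      = ∫ x, G x • (𝓕 (hf₂.toLp f) : Lp ℂ 2 (volume : Measure V)) x := rfl
    _ = ∫ x, 𝓕 G x • hf₂.toLp f x := distributional.symm
    _ = ∫ x, 𝓕 G x • f x :=
        integral_congr_ae (hf₂.coeFn_toLp.mono fun x hx => congrArg (𝓕 G x • ·) hx)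
    _ = ∫ x, g x • 𝓕 f x := fubini

theorem eLpNorm_two_sq {X : Type*} [MeasurableSpace X] {μ : Measure X} (f : X → ℂ) :
    eLpNorm f 2 μ ^ 2 = ∫⁻ x, ‖f x‖ₑ ^ 2 ∂μ := by
  simpa using eLpNorm_nnreal_pow_eq_lintegral (f := f) (μ := μ) (p := 2) (by simp)

theorem lintegral_enorm_fourier_sq {f : V → ℂ} (hf : Integrable f) (hf₂ : MemLp f 2) :
    ∫⁻ ξ, ‖𝓕 f ξ‖ₑ ^ 2 = ∫⁻ x, ‖f x‖ₑ ^ 2 :=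
  calc ∫⁻ ξ, ‖𝓕 f ξ‖ₑ ^ 2
      = ∫⁻ ξ, ‖(𝓕 (hf₂.toLp f) : Lp ℂ 2 (volume : Measure V)) ξ‖ₑ ^ 2 :=
        lintegral_congr_ae ((fourier_toLp_ae_eq hf hf₂).symm.fun_comp (‖·‖ₑ ^ 2))
    _ = ‖hf₂.toLp f‖ₑ ^ 2 := by
        rw [← eLpNorm_two_sq, ← Lp.enorm_def, ← ofReal_norm, Lp.norm_fourier_eq, ofReal_norm]
    _ = ∫⁻ x, ‖f x‖ₑ ^ 2 := by rw [Lp.enorm_toLp, eLpNorm_two_sq]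

end FourierL2

section HardyLittlewood

open Metric

variable {V : Type*} [NormedAddCommGroup V] [InnerProductSpace ℝ V] [FiniteDimensional ℝ V]
  [MeasurableSpace V] [BorelSpace V]

/-- The centred Hardy–Littlewood maximal function of a nonnegative function. -/
noncomputable def hlMaximal (f : V → ℝ≥0∞) (x : V) : ℝ≥0∞ :=
  ⨆ (r : ℝ) (_ : 0 < r), (volume (ball x r))⁻¹ * ∫⁻ y in ball x r, f y

theorem average_le_hlMaximal (f : V → ℝ≥0∞) (x : V) {r : ℝ} (hr : 0 < r) :
    (volume (ball x r))⁻¹ * ∫⁻ y in ball x r, f y ≤ hlMaximal f x :=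
  le_iSup₂ (f := fun (r : ℝ) (_ : 0 < r) => (volume (ball x r))⁻¹ * ∫⁻ y in ball x r, f y) r hr

theorem lintegral_ball_le_hlMaximal (f : V → ℝ≥0∞) (x : V) {r : ℝ} (hr : 0 < r) :
    ∫⁻ y in ball x r, f y ≤ volume (ball x r) * hlMaximal f x := by
  rw [← ENNReal.inv_mul_le_iff (measure_ball_pos _ _ hr).ne' measure_ball_lt_top.ne]
  exact average_le_hlMaximal f x hr

theorem hlMaximal_mono {f g : V → ℝ≥0∞} (h : f ≤ g) (x : V) : hlMaximal f x ≤ hlMaximal g x := by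
  unfold hlMaximal
  gcongr
  exact h _

theorem hlMaximal_add_le {f g : V → ℝ≥0∞} (hf : Measurable f) (x : V) :
    hlMaximal (f + g) x ≤ hlMaximal f x + hlMaximal g x := by
  refine iSup₂_le fun r hr => ?_
  simp only [Pi.add_apply]
  rw [lintegral_add_left hf, mul_add]
  exact add_le_add (average_le_hlMaximal f x hr) (average_le_hlMaximal g x hr)

theorem hlMaximal_le_of_le_const {f : V → ℝ≥0∞} {c : ℝ≥0∞} (hf : ∀ x, f x ≤ c) (x : V) :
    hlMaximal f x ≤ c := by
  refine iSup₂_le fun r hr => ?_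
  rw [ENNReal.inv_mul_le_iff (measure_ball_pos _ _ hr).ne' measure_ball_lt_top.ne]
  calc ∫⁻ y in ball x r, f y ≤ ∫⁻ _ in ball x r, c := lintegral_mono hf
    _ = volume (ball x r) * c := by rw [setLIntegral_const, mul_comm]

theorem lowerSemicontinuous_lintegral_ball (f : V → ℝ≥0∞) (r : ℝ) :
    LowerSemicontinuous fun x : V => ∫⁻ y in ball x r, f y := by
  intro x c hc
  have ball_eq : ball x r = ⋃ n : ℕ, ball x (r - 1 / ((n : ℝ) + 1)) := by
    ext y
    simp only [Set.mem_iUnion, mem_ball]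
    refine ⟨fun hy => ?_, fun ⟨n, hn⟩ => hn.trans (sub_lt_self r Nat.one_div_pos_of_nat)⟩
    obtain ⟨n, hn⟩ := exists_nat_one_div_lt (sub_pos.2 hy)
    exact ⟨n, lt_sub_comm.1 hn⟩
  have mono : Monotone fun n : ℕ => ball x (r - 1 / ((n : ℝ) + 1)) := fun a b hab =>
    ball_subset_ball (sub_le_sub_left (Nat.one_div_le_one_div hab) r)
  dsimp only at hc
  rw [ball_eq, setLIntegral_iUnion_of_directed f mono.directed_le, gt_iff_lt, lt_iSup_iff] at hc
  obtain ⟨n, hn⟩ := hc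
  filter_upwards [ball_mem_nhds x (Nat.one_div_pos_of_nat (n := n) (α := ℝ))] with z hz
  refine hn.trans_le (lintegral_mono_set (ball_subset_ball' ?_))
  rw [mem_ball, dist_comm] at hz
  linarith

theorem lowerSemicontinuous_hlMaximal (f : V → ℝ≥0∞) : LowerSemicontinuous (hlMaximal f) := by
  refine lowerSemicontinuous_biSup fun r hr => ?_
  simp only [Measure.addHaar_ball_center volume _ r]
  exact (ENNReal.continuous_const_mul
    (ENNReal.inv_ne_top.2 (measure_ball_pos _ _ hr).ne')).comp_lowerSemicontinuous
    (lowerSemicontinuous_lintegral_ball f r) fun _ _ h => mul_le_mul_right h _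

theorem measurable_hlMaximal (f : V → ℝ≥0∞) : Measurable (hlMaximal f) :=
  (lowerSemicontinuous_hlMaximal f).measurable

theorem volume_le_of_forall_exists_ball {f : V → ℝ≥0∞} {c : ℝ≥0∞} (hc : c ≠ 0) (hc' : c ≠ ∞)
    {s : Set V} {R : ℝ}
    (hs : ∀ x ∈ s, ∃ r, 0 < r ∧ r ≤ R ∧ c * volume (ball x r) ≤ ∫⁻ y in ball x r, f y) :
    volume s ≤ 4 ^ Module.finrank ℝ V * (c⁻¹ * ∫⁻ y, f y) := by
  choose! r hr hR hcr using hs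
  obtain ⟨u, hus, hdisj, hcov⟩ := Vitali.exists_disjoint_subfamily_covering_enlargement_ball
    s (fun x : V => x) r R hR 4 (by norm_num)
  have hcount : u.Countable := hdisj.countable_of_isOpen (fun _ _ => isOpen_ball)
    (fun x hx => nonempty_ball.2 (hr x (hus hx)))
  calc volume s ≤ volume (⋃ x ∈ u, ball x (4 * r x)) := measure_mono fun x hx => by
        obtain ⟨b, hb, hxb⟩ := hcov x hx
        exact Set.mem_iUnion₂.2 ⟨b, hb, hxb (mem_ball_self (hr x hx))⟩
    _ ≤ ∑' x : u, volume (ball (x : V) (4 * r x)) := measure_biUnion_le _ hcount _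
    _ = 4 ^ Module.finrank ℝ V * ∑' x : u, volume (ball (x : V) (r x)) := by
        rw [← ENNReal.tsum_mul_left]
        refine tsum_congr fun x => ?_
        rw [Measure.addHaar_ball_mul_of_pos _ _ (by norm_num : (0 : ℝ) < 4),
          ← Measure.addHaar_ball_center volume (x : V), ENNReal.ofReal_pow (by norm_num),
          ENNReal.ofReal_ofNat]
    _ ≤ 4 ^ Module.finrank ℝ V * ∑' x : u, c⁻¹ * ∫⁻ y in ball (x : V) (r x), f y := by
        gcongr with x
        rw [← ENNReal.div_eq_inv_mul, ENNReal.le_div_iff_mul_le (Or.inl hc) (Or.inl hc'), mul_comm]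
        exact hcr x (hus x.2)
    _ = 4 ^ Module.finrank ℝ V * (c⁻¹ * ∫⁻ y in ⋃ x ∈ u, ball (x : V) (r x), f y) := by
        rw [ENNReal.tsum_mul_left, lintegral_biUnion hcount (fun _ _ => measurableSet_ball) hdisj]
    _ ≤ 4 ^ Module.finrank ℝ V * (c⁻¹ * ∫⁻ y, f y) := by
        gcongr
        exact Measure.restrict_le_self

theorem volume_lt_hlMaximal_le (f : V → ℝ≥0∞) {c : ℝ≥0∞} (hc : c ≠ 0) (hc' : c ≠ ∞) :
    volume {x | c < hlMaximal f x} ≤ 4 ^ Module.finrank ℝ V * (c⁻¹ * ∫⁻ y, f y) := by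
  let s (n : ℕ) : Set V :=
    {x | ∃ r : ℝ, 0 < r ∧ r ≤ n ∧ c * volume (ball x r) ≤ ∫⁻ y in ball x r, f y}
  have hmono : Monotone s := fun a b hab x ⟨r, hr, hra, h⟩ =>
    ⟨r, hr, hra.trans (Nat.cast_le.2 hab), h⟩
  have hsub : {x | c < hlMaximal f x} ⊆ ⋃ n, s n := by
    intro x hx
    simp only [hlMaximal, Set.mem_ofPred_eq, lt_iSup_iff] at hx
    obtain ⟨r, hr, h⟩ := hx
    obtain ⟨n, hn⟩ := exists_nat_ge r
    rw [← ENNReal.div_eq_inv_mul, ENNReal.lt_div_iff_mul_lt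
      (Or.inl (measure_ball_pos _ _ hr).ne') (Or.inl measure_ball_lt_top.ne)] at h
    exact Set.mem_iUnion.2 ⟨n, r, hr, hn, h.le⟩
  refine (measure_mono hsub).trans ?_
  rw [hmono.measure_iUnion]
  exact iSup_le fun n => volume_le_of_forall_exists_ball hc hc' fun x hx => hx

-- Only the part of `f` above the height `c` can push the maximal function above `2c`.
theorem volume_lt_hlMaximal_mul_le {f : V → ℝ≥0∞} (hf : Measurable f) {c : ℝ≥0∞} (hc : c ≠ 0)
    (hc' : c ≠ ∞) :
    volume {x | 2 * c < hlMaximal f x} * c ≤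
      4 ^ Module.finrank ℝ V * ∫⁻ y in {y | c < f y}, f y := by
  have hmeas : MeasurableSet {y | c < f y} := measurableSet_lt measurable_const hf
  let g : V → ℝ≥0∞ := {y | c < f y}.indicator f
  have f_le : f ≤ g + fun _ => c := by
    intro y
    by_cases hy : c < f y
    · simp [g, hy]
    · exact (not_lt.1 hy).trans le_add_self
  have hsub : {x | 2 * c < hlMaximal f x} ⊆ {x | c < hlMaximal g x} := fun x hx => by
    have h := (Set.mem_ofPred.1 hx).trans_le <| (hlMaximal_mono f_le x).trans <|
      (hlMaximal_add_le (hf.indicator hmeas) x).trans <|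
      add_le_add_right (hlMaximal_le_of_le_const (fun _ => le_rfl) x) _
    rw [two_mul] at h
    exact lt_of_add_lt_add_right h
  calc volume {x | 2 * c < hlMaximal f x} * c
      ≤ (4 ^ Module.finrank ℝ V * (c⁻¹ * ∫⁻ y, g y)) * c := by
        gcongr
        exact (measure_mono hsub).trans (volume_lt_hlMaximal_le g hc hc')
    _ = 4 ^ Module.finrank ℝ V * (∫⁻ y, g y) * (c⁻¹ * c) := by ring
    _ = 4 ^ Module.finrank ℝ V * ∫⁻ y in {y | c < f y}, f y := by
        rw [ENNReal.inv_mul_cancel hc hc', mul_one, lintegral_indicator hmeas]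

theorem volume_lt_toReal_hlMaximal_mul_le {f : V → ℝ≥0∞} (hf : Measurable f)
    (hf_top : ∀ x, f x ≠ ∞) (hM_top : ∀ x, hlMaximal f x ≠ ∞) {t : ℝ} (ht : 0 < t) :
    volume {x | t < (hlMaximal f x).toReal} * ENNReal.ofReal t ≤
      2 * 4 ^ Module.finrank ℝ V * volume.withDensity f {y | t < 2 * (f y).toReal} := by
  have two_mul_half : 2 * ENNReal.ofReal (t / 2) = ENNReal.ofReal t := by
    rw [← ENNReal.ofReal_ofNat, ← ENNReal.ofReal_mul zero_le_two]
    congr 1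
    ring
  have h := volume_lt_hlMaximal_mul_le hf (ENNReal.ofReal_pos.2 (half_pos ht)).ne'
    ENNReal.ofReal_ne_top
  simp only [two_mul_half, ENNReal.ofReal_lt_iff_lt_toReal ht.le (hM_top _),
    ENNReal.ofReal_lt_iff_lt_toReal (half_pos ht).le (hf_top _),
    div_lt_iff₀' (two_pos (α := ℝ))] at h
  rw [withDensity_apply _ (measurableSet_lt measurable_const (by fun_prop)), mul_assoc,
    ← two_mul_half, mul_left_comm]
  gcongr 2 * ?_

theorem lintegral_hlMaximal_sq_le {f : V → ℝ≥0∞} (hf : Measurable f) {K : ℝ≥0∞} (hK : K ≠ ∞)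
    (hfK : ∀ x, f x ≤ K) :
    ∫⁻ x, hlMaximal f x ^ 2 ≤ 8 * 4 ^ Module.finrank ℝ V * ∫⁻ x, f x ^ 2 := by
  set C : ℝ≥0∞ := 4 ^ Module.finrank ℝ V
  have hf_top x : f x ≠ ∞ := ne_top_of_le_ne_top hK (hfK x)
  have hM_top x : hlMaximal f x ≠ ∞ := ne_top_of_le_ne_top hK (hlMaximal_le_of_le_const hfK x)
  calc ∫⁻ x, hlMaximal f x ^ 2
      = ∫⁻ x, ENNReal.ofReal ((hlMaximal f x).toReal ^ (2 : ℝ)) := by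
        simp_rw [Real.rpow_two, ENNReal.ofReal_pow ENNReal.toReal_nonneg,
          ENNReal.ofReal_toReal (hM_top _)]
    _ = 2 * ∫⁻ t in Set.Ioi (0 : ℝ), volume {x | t < (hlMaximal f x).toReal} *
          ENNReal.ofReal (t ^ ((2 : ℝ) - 1)) := by
        rw [lintegral_rpow_eq_lintegral_meas_lt_mul volume
          (.of_forall fun _ => ENNReal.toReal_nonneg)
          (measurable_hlMaximal f).ennreal_toReal.aemeasurable two_pos, ENNReal.ofReal_ofNat]
    _ ≤ 2 * ∫⁻ t in Set.Ioi (0 : ℝ),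
          2 * C * volume.withDensity f {y | t < 2 * (f y).toReal} := by
        gcongr 2 * ?_
        refine setLIntegral_mono' measurableSet_Ioi fun t ht => ?_
        simpa [show (2 : ℝ) - 1 = 1 by norm_num] using
          volume_lt_toReal_hlMaximal_mul_le hf hf_top hM_top ht
    _ = 4 * C * ∫⁻ y, ENNReal.ofReal (2 * (f y).toReal) ∂volume.withDensity f := by
        rw [lintegral_const_mul' _ _ (by finiteness), ← lintegral_eq_lintegral_meas_lt _
          (.of_forall fun _ => by positivity) (by fun_prop)]
        ring
    _ = 4 * C * ∫⁻ y, 2 * f y ^ 2 := by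
        rw [lintegral_withDensity_eq_lintegral_mul _ hf (by fun_prop)]
        simp_rw [Pi.mul_apply, ENNReal.ofReal_mul zero_le_two, ENNReal.ofReal_ofNat,
          ENNReal.ofReal_toReal (hf_top _)]
        congr! 3
        ring
    _ = 8 * C * ∫⁻ x, f x ^ 2 := by
        rw [lintegral_const_mul _ (by fun_prop)]
        ring

end HardyLittlewood

section FourierDecay

open FourierTransform Real VectorFourier

/-- Polynomial decay `|F(ξ)| ≲ (1 + |ξ|)^{-s}`; `HasFourierDecay σ s` is this property of the
Fourier transform of `σ`. -/
def HasDecay {W E : Type*} [Norm W] [Norm E] (F : W → E) (s : ℝ) : Prop :=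
  ∃ A : ℝ, ∀ ξ : W, ‖F ξ‖ ≤ A * (1 + ‖ξ‖) ^ (-s)

theorem one_add_norm_rpow_neg_le_mul {W : Type*} [NormedAddCommGroup W] {s : ℝ} (hs : 0 ≤ s)
    (ξ η : W) :
    (1 + ‖ξ + η‖) ^ (-s) ≤ (1 + ‖ξ‖) ^ (-s) * (1 + ‖η‖) ^ s := by
  have peetre : 1 + ‖ξ‖ ≤ (1 + ‖ξ + η‖) * (1 + ‖η‖) := by
    nlinarith [norm_nonneg (ξ + η), norm_nonneg η, norm_le_add_norm_add ξ η]
  rw [rpow_neg (by positivity), rpow_neg (by positivity), inv_mul_eq_div, inv_eq_one_div,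
    div_le_div_iff₀ (by positivity) (by positivity), one_mul, mul_comm,
    ← mul_rpow (by positivity) (by positivity)]
  exact rpow_le_rpow (by positivity) peetre hs

theorem HasDecay.comp_of_norm_le {W W' E : Type*} [NormedAddCommGroup W] [NormedAddCommGroup W']
    [NormedAddCommGroup E] {F : W → E} {s : ℝ} (hF : HasDecay F s) (hs : 0 ≤ s) {L : W' → W}
    (hL : ∀ ξ, ‖ξ‖ ≤ ‖L ξ‖) : HasDecay (F ∘ L) s := by
  obtain ⟨A, hA⟩ := hF
  have hA₀ : 0 ≤ A := by simpa using (norm_nonneg _).trans (hA 0)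
  refine ⟨A, fun ξ => (hA (L ξ)).trans ?_⟩
  gcongr A * ?_
  exact rpow_le_rpow_of_nonpos (by positivity) (by gcongr; exact hL ξ) (neg_nonpos.2 hs)

theorem HasDecay.exists_common_constant {W E E' : Type*} [NormedAddCommGroup W] [Norm E] [Norm E']
    {F : W → E} {F' : W → E'} {s : ℝ} (hF : HasDecay F s) (hF' : HasDecay F' s) :
    ∃ A : ℝ, (∀ ξ, ‖F ξ‖ ≤ A * (1 + ‖ξ‖) ^ (-s)) ∧ ∀ ξ, ‖F' ξ‖ ≤ A * (1 + ‖ξ‖) ^ (-s) := by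
  obtain ⟨A, hA⟩ := hF
  obtain ⟨A', hA'⟩ := hF'
  exact ⟨max A A', fun ξ => (hA ξ).trans (by gcongr; exact le_max_left A A'),
    fun ξ => (hA' ξ).trans (by gcongr; exact le_max_right A A')⟩

theorem exists_schwartz_eq_one_of_norm_le (V : Type*) [NormedAddCommGroup V]
    [InnerProductSpace ℝ V] [FiniteDimensional ℝ V] (R : ℝ) :
    ∃ φ : SchwartzMap V ℂ, ∀ y, ‖y‖ ≤ R → φ y = 1 := by
  let φ : ContDiffBump (0 : V) := ⟨max R 1, max R 1 + 1, by positivity, lt_add_one _⟩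
  have hcpt : HasCompactSupport (Complex.ofRealCLM ∘ φ) := φ.hasCompactSupport.comp_left rfl
  refine ⟨hcpt.toSchwartzMap (Complex.ofRealCLM.contDiff.comp φ.contDiff), fun y hy => ?_⟩
  have hy : y ∈ Metric.closedBall (0 : V) φ.rIn := by simp [φ, hy]
  simp [φ.one_of_mem_closedBall hy]

variable {V E : Type*} [NormedAddCommGroup V] [InnerProductSpace ℝ V] [MeasurableSpace V]
  [BorelSpace V] [NormedAddCommGroup E]

/-- The Fourier transform `ξ ↦ ∫ e^{-2πi y·ξ} f(y) dμ(y)` of the (vector) measure `f μ`. -/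
noncomputable abbrev fourierDensity [NormedSpace ℂ E] (μ : Measure V) (f : V → E) : V → E :=
  fourierIntegral 𝐞 μ (innerₗ V) f

variable [FiniteDimensional ℝ V]

theorem integrable_one_add_norm_rpow_mul_schwartz [NormedSpace ℝ E] (f : SchwartzMap V E) (s : ℝ) :
    Integrable fun x => (1 + ‖x‖) ^ s * ‖f x‖ := by
  obtain ⟨N, hN⟩ := exists_nat_ge s
  have hcont : Continuous fun x : V => (1 + ‖x‖) ^ s :=
    (continuous_const.add continuous_norm).rpow_const fun x =>
      .inl (by positivity : 0 < 1 + ‖x‖).ne'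
  refine ((f.integrable.norm.add (f.integrable_pow_mul volume N)).const_mul (2 ^ (N - 1))).mono'
    (hcont.mul f.continuous.norm).aestronglyMeasurable (.of_forall fun x => ?_)
  rw [norm_of_nonneg (by positivity)]
  calc (1 + ‖x‖) ^ s * ‖f x‖ ≤ (1 + ‖x‖) ^ N * ‖f x‖ := by
        gcongr
        exact (rpow_le_rpow_of_exponent_le (by simp) hN).trans_eq (rpow_natCast _ _)
    _ ≤ (2 ^ (N - 1) * (1 ^ N + ‖x‖ ^ N)) * ‖f x‖ := by
        gcongr
        exact add_pow_le zero_le_one (norm_nonneg x) N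
    _ = 2 ^ (N - 1) * (‖f x‖ + ‖x‖ ^ N * ‖f x‖) := by ring

variable [NormedSpace ℂ E] [CompleteSpace E] {μ : Measure V} [IsFiniteMeasure μ]

theorem fourierDensity_schwartz_eq_integral (χ : SchwartzMap V E) (ξ : V) :
    fourierDensity μ χ ξ =
      ∫ η, fourierDensity μ (fun _ => (1 : ℂ)) (ξ + η) • (𝓕⁻ χ : SchwartzMap V E) η := by
  have inversion : 𝓕 ((𝓕⁻ χ : SchwartzMap V E) : V → E) = χ := by
    rw [← SchwartzMap.fourier_coe, FourierTransform.fourier_fourierInv_eq]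
  have fubini := integral_fourierIntegral_smul_eq_flip (μ := μ) (ν := volume) (L := innerₗ V)
    (f := fun y => (𝐞 (-⟪y, ξ⟫) : ℂ)) continuous_fourierChar continuous_inner
    (.of_bound (C := 1) (Continuous.aestronglyMeasurable (by fun_prop))
      (.of_forall fun y => (Circle.norm_coe _).le))
    (𝓕⁻ χ : SchwartzMap V E).integrable
  rw [flip_innerₗ] at fubini
  calc fourierDensity μ χ ξ
      = ∫ y, (𝐞 (-⟪y, ξ⟫) : ℂ) • 𝓕 ((𝓕⁻ χ : SchwartzMap V E) : V → E) y ∂μ := by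
        rw [inversion]
        rfl
    _ = _ := fubini.symm
    _ = _ := by
        congr! 3 with η
        refine integral_congr_ae (.of_forall fun y => ?_)
        simp [inner_add_right, AddChar.map_add_eq_mul, Circle.smul_def, mul_comm]

theorem HasDecay.fourierDensity_schwartz {s : ℝ} (hs : 0 ≤ s)
    (hμ : HasDecay (fourierDensity μ fun _ => (1 : ℂ)) s) (χ : SchwartzMap V E) :
    HasDecay (fourierDensity μ χ) s := by
  obtain ⟨A, hA⟩ := hμ
  set ψ : SchwartzMap V E := 𝓕⁻ χ
  refine ⟨A * ∫ η, (1 + ‖η‖) ^ s * ‖ψ η‖, fun ξ => ?_⟩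
  rw [fourierDensity_schwartz_eq_integral]
  calc _ ≤ ∫ η, (A * (1 + ‖ξ‖) ^ (-s)) * ((1 + ‖η‖) ^ s * ‖ψ η‖) := by
        refine norm_integral_le_of_norm_le
          ((integrable_one_add_norm_rpow_mul_schwartz ψ s).const_mul _) (.of_forall fun η => ?_)
        rw [norm_smul, ← mul_assoc, mul_assoc A]
        gcongr
        refine (hA _).trans ?_
        gcongr
        · simpa using (norm_nonneg _).trans (hA 0)
        · exact one_add_norm_rpow_neg_le_mul hs ξ η
    _ = _ := by
        rw [integral_const_mul]
        ring

theorem hasFDerivAt_fourierDensity_one {R : ℝ} (hR : ∀ᵐ y ∂μ, ‖y‖ ≤ R) (ξ : V) :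
    HasFDerivAt (fourierDensity μ fun _ => (1 : ℂ))
      (fourierDensity μ (fourierSMulRight (innerSL ℝ) fun _ => (1 : ℂ)) ξ) ξ :=
  hasFDerivAt_fourierIntegral (innerSL ℝ) (integrable_const 1)
    (.of_bound (C := R) (Continuous.aestronglyMeasurable (by fun_prop)) (by simpa using hR)) ξ

-- On the support of `μ` the factor `y` produced by differentiating `e^{-2πi y·ξ}` is a Schwartz
-- function.
theorem HasDecay.fderiv_fourierDensity_one {s : ℝ} (hs : 0 ≤ s)
    (hμ : HasDecay (fourierDensity μ fun _ => (1 : ℂ)) s) {R : ℝ} (hR : ∀ᵐ y ∂μ, ‖y‖ ≤ R) :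
    HasDecay (fderiv ℝ (fourierDensity μ fun _ => (1 : ℂ))) s := by
  obtain ⟨φ, hφ⟩ := exists_schwartz_eq_one_of_norm_le V R
  have hχ := hμ.fourierDensity_schwartz hs
    (-(2 * π * Complex.I) • SchwartzMap.smulRightCLM ℂ ℂ (innerSL ℝ) φ)
  suffices h : fderiv ℝ (fourierDensity μ fun _ => (1 : ℂ)) = fourierDensity μ _ from h ▸ hχ
  ext1 ξ
  rw [(hasFDerivAt_fourierDensity_one hR ξ).fderiv]
  refine integral_congr_ae ?_
  filter_upwards [hR] with y hy
  ext w
  simp [hφ y hy, Circle.smul_def, fourierSMulRight_apply]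

theorem contDiff_fourierDensity_one {R : ℝ} (hR : ∀ᵐ y ∂μ, ‖y‖ ≤ R) :
    ContDiff ℝ 1 (fourierDensity μ fun _ => (1 : ℂ)) := by
  refine contDiff_fourierIntegral (innerSL ℝ) (N := 1) fun n _ =>
    .of_bound (C := R ^ n) (Continuous.aestronglyMeasurable (by fun_prop)) ?_
  filter_upwards [hR] with y hy
  simpa using pow_le_pow_left₀ (norm_nonneg y) hy n

end FourierDecay

section SobolevTrace

open FourierTransform Set

theorem lintegral_mul_sq_le {X : Type*} [MeasurableSpace X] (μ : Measure X) {f g : X → ℝ≥0∞}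
    (hf : AEMeasurable f μ) (hg : AEMeasurable g μ) :
    (∫⁻ x, f x * g x ∂μ) ^ 2 ≤ (∫⁻ x, f x ^ 2 ∂μ) * ∫⁻ x, g x ^ 2 ∂μ := by
  have hölder := pow_le_pow_left₀ zero_le
    (ENNReal.lintegral_mul_le_Lp_mul_Lq μ Real.HolderConjugate.two_two hf hg) 2
  simpa [mul_pow, ← ENNReal.rpow_mul_natCast] using hölder

theorem sq_biSup_le {ι : Type*} {s : Set ι} {f : ι → ℝ≥0∞} {c : ℝ≥0∞}
    (h : ∀ i ∈ s, f i ^ 2 ≤ c) : (⨆ i ∈ s, f i) ^ 2 ≤ c := by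
  have sqrt_bound : ⨆ i ∈ s, f i ≤ c ^ (2⁻¹ : ℝ) :=
    iSup₂_le fun i hi => (ENNReal.le_rpow_inv_iff two_pos).2 (by simpa using h i hi)
  simpa using (ENNReal.le_rpow_inv_iff two_pos).1 sqrt_bound

theorem sq_norm_le_add_integral {E : Type*} [NormedAddCommGroup E] [InnerProductSpace ℝ E]
    {u u' : ℝ → E} (hu : ∀ t, HasDerivAt u (u' t) t) (hu' : Continuous u') {l a b : ℝ} (hl : 0 < l)
    {t τ : ℝ} (ht : t ∈ Icc a b) (hτ : τ ∈ Icc a b) :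
    ‖u t‖ ^ 2 ≤ ‖u τ‖ ^ 2 + ∫ r in Icc a b, (l * ‖u r‖ ^ 2 + l⁻¹ * ‖u' r‖ ^ 2) := by
  have hu_cont : Continuous u := continuous_iff_continuousAt.2 fun t => (hu t).continuousAt
  have ftc : ∫ r in τ..t, 2 * ⟪u r, u' r⟫ = ‖u t‖ ^ 2 - ‖u τ‖ ^ 2 :=
    intervalIntegral.integral_eq_sub_of_hasDerivAt (fun r _ => (hu r).norm_sq)
      (Continuous.intervalIntegrable (by fun_prop) τ t)
  have young (r : ℝ) : ‖2 * ⟪u r, u' r⟫‖ ≤ l * ‖u r‖ ^ 2 + l⁻¹ * ‖u' r‖ ^ 2 := by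
    rw [norm_mul, Real.norm_ofNat]
    have square : l⁻¹ * (l * ‖u r‖ - ‖u' r‖) ^ 2
        = l * ‖u r‖ ^ 2 + l⁻¹ * ‖u' r‖ ^ 2 - 2 * (‖u r‖ * ‖u' r‖) := by
      field_simp
      ring
    have : 0 ≤ l⁻¹ * (l * ‖u r‖ - ‖u' r‖) ^ 2 := by positivity
    linarith [norm_inner_le_norm (𝕜 := ℝ) (u r) (u' r)]
  have increment : ‖∫ r in τ..t, 2 * ⟪u r, u' r⟫‖
      ≤ ∫ r in Icc a b, (l * ‖u r‖ ^ 2 + l⁻¹ * ‖u' r‖ ^ 2) := by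
    refine intervalIntegral.norm_integral_le_integral_norm_uIoc.trans
      ((setIntegral_mono ?_ ?_ young).trans (setIntegral_mono_set
        (Continuous.integrableOn_Icc (by fun_prop)) (.of_forall fun r => by positivity)
        (uIoc_subset_uIcc.trans (uIcc_subset_Icc hτ ht)).eventuallyLE)) <;>
    exact Continuous.integrableOn_uIoc (by fun_prop)
  rw [ftc] at increment
  linarith [(Real.le_norm_self _).trans increment]

theorem enorm_sq_le_lintegral_of_hasDerivAt {E : Type*} [NormedAddCommGroup E]
    [InnerProductSpace ℝ E] {u u' : ℝ → E} (hu : ∀ t, HasDerivAt u (u' t) t)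
    (hu' : Continuous u') {l : ℝ} (hl : 0 < l) {t : ℝ} (ht : t ∈ Icc (1 : ℝ) 2) :
    ‖u t‖ₑ ^ 2 ≤ (1 + ENNReal.ofReal l) * (∫⁻ τ in Icc (1 : ℝ) 2, ‖u τ‖ₑ ^ 2) +
      ENNReal.ofReal l⁻¹ * ∫⁻ τ in Icc (1 : ℝ) 2, ‖u' τ‖ₑ ^ 2 := by
  have hu_cont : Continuous u := continuous_iff_continuousAt.2 fun t => (hu t).continuousAt
  have ofReal_sq (v : E) : ENNReal.ofReal (‖v‖ ^ 2) = ‖v‖ₑ ^ 2 := by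
    rw [ENNReal.ofReal_pow (norm_nonneg v), ofReal_norm]
  have energy : ENNReal.ofReal (∫ r in Icc (1 : ℝ) 2, (l * ‖u r‖ ^ 2 + l⁻¹ * ‖u' r‖ ^ 2)) =
      ENNReal.ofReal l * (∫⁻ τ in Icc (1 : ℝ) 2, ‖u τ‖ₑ ^ 2) +
        ENNReal.ofReal l⁻¹ * ∫⁻ τ in Icc (1 : ℝ) 2, ‖u' τ‖ₑ ^ 2 := by
    rw [ofReal_integral_eq_lintegral_ofReal (Continuous.integrableOn_Icc (by fun_prop))
      (.of_forall fun r => by positivity), ← lintegral_const_mul' _ _ ENNReal.ofReal_ne_top,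
      ← lintegral_const_mul' _ _ ENNReal.ofReal_ne_top,
      ← lintegral_add_left ((hu_cont.enorm.measurable.pow_const 2).const_mul _)]
    refine lintegral_congr fun r => ?_
    rw [ENNReal.ofReal_add (by positivity) (by positivity), ENNReal.ofReal_mul hl.le,
      ENNReal.ofReal_mul (by positivity), ofReal_sq, ofReal_sq]
  calc ‖u t‖ₑ ^ 2 = ∫⁻ _ in Icc (1 : ℝ) 2, ‖u t‖ₑ ^ 2 := by
        simp [Real.volume_Icc, show (2 : ℝ) - 1 = 1 by norm_num]
    _ ≤ ∫⁻ τ in Icc (1 : ℝ) 2, (‖u τ‖ₑ ^ 2 +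
        ENNReal.ofReal (∫ r in Icc (1 : ℝ) 2, (l * ‖u r‖ ^ 2 + l⁻¹ * ‖u' r‖ ^ 2))) := by
      refine setLIntegral_mono' measurableSet_Icc fun τ hτ => ?_
      rw [← ofReal_sq, ← ofReal_sq, ← ENNReal.ofReal_add (by positivity)
        (integral_nonneg fun r => by positivity)]
      exact ENNReal.ofReal_le_ofReal (sq_norm_le_add_integral hu hu' hl ht hτ)
    _ = _ := by
      rw [lintegral_add_right _ measurable_const, energy, lintegral_const]
      simp only [Measure.restrict_apply, MeasurableSet.univ, univ_inter, Real.volume_Icc]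
      norm_num
      ring

variable {V : Type*} [NormedAddCommGroup V] [InnerProductSpace ℝ V]

/-- The restriction to the diagonal `{(x, …, x)}` of the inverse Fourier transform of `H`. -/
noncomputable def diagFourierInv [MeasurableSpace V] [FiniteDimensional ℝ V] [BorelSpace V] {m : ℕ}
    (H : (Fin m → V) → ℂ) (x : V) : ℂ :=
  ∫ ξ, 𝐞 ⟪∑ i, ξ i, x⟫ • H ξ

/-- Coordinates on `V^{n+1}` whose last entry is the sum of all components. -/
def consSub {V : Type*} [AddCommGroup V] {n : ℕ} (p : (Fin n → V) × V) : Fin (n + 1) → V :=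
  Fin.cons (p.2 - ∑ i, p.1 i) p.1

theorem sum_consSub {V : Type*} [AddCommGroup V] {n : ℕ} (p : (Fin n → V) × V) :
    ∑ i, consSub p i = p.2 := by
  simp [consSub, Fin.sum_univ_succ]

variable [FiniteDimensional ℝ V] [MeasurableSpace V] [BorelSpace V]

theorem measurePreserving_consSub (n : ℕ) :
    MeasurePreserving (consSub : (Fin n → V) × V → Fin (n + 1) → V) := by
  have shear : MeasurePreserving (fun p : (Fin n → V) × V => (p.1, p.2 - ∑ i, p.1 i)) :=
    (MeasurePreserving.id (volume : Measure (Fin n → V))).skew_product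
      (g := fun a b => b - ∑ i, a i) (by simp only [Function.uncurry_def]; fun_prop)
      (.of_forall fun a => (measurePreserving_sub_right volume (∑ i, a i)).map_eq)
  convert! (volume_preserving_piFinSuccAbove (fun _ : Fin (n + 1) => V) 0).symm.comp
    (Measure.measurePreserving_swap.comp shear) using 1
  ext p : 1
  simp [consSub, MeasurableEquiv.piFinSuccAbove, Fin.insertNthEquiv]

theorem diagFourierInv_eq_fourier {n : ℕ} {H : (Fin (n + 1) → V) → ℂ} (hH : Integrable H) (x : V) :
    diagFourierInv H x = 𝓕 (fun η => ∫ ξ : Fin n → V, H (consSub (ξ, η))) (-x) := by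
  have hΦ := measurePreserving_consSub (V := V) n
  have hint : Integrable (fun p : (Fin n → V) × V => 𝐞 ⟪p.2, x⟫ • H (consSub p)) :=
    (hΦ.integrable_comp_of_integrable hH).mono ((Continuous.aestronglyMeasurable
      (by fun_prop)).smul (hΦ.integrable_comp_of_integrable hH).aestronglyMeasurable)
      (.of_forall fun p => by simp [Circle.norm_smul])
  calc diagFourierInv H x
      = ∫ p : (Fin n → V) × V, 𝐞 ⟪p.2, x⟫ • H (consSub p) := by
        rw [diagFourierInv, ← hΦ.map_eq, integral_map hΦ.measurable.aemeasurable]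
        · simp only [sum_consSub]
        · rw [hΦ.map_eq]
          exact (Continuous.aestronglyMeasurable (by fun_prop)).smul hH.aestronglyMeasurable
    _ = _ := by
        rw [Measure.volume_eq_prod, integral_prod_symm _ hint, Real.fourier_eq]
        congr! 2 with η
        rw [inner_neg_right, neg_neg]
        exact integral_smul (𝐞 ⟪η, x⟫ : ℂ) _

-- Cauchy–Schwarz on each fibre, whose frequencies lie in a ball of `V^n`.
theorem enorm_integral_consSub_sq_le {n : ℕ} {H : (Fin (n + 1) → V) → ℂ} (hH : Measurable H)
    {R : ℝ} (hR : ∀ ξ, H ξ ≠ 0 → ‖ξ‖ ≤ R) (η : V) :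
    ‖∫ ξ : Fin n → V, H (consSub (ξ, η))‖ₑ ^ 2 ≤
      volume (Metric.closedBall (0 : Fin n → V) R) *
        ∫⁻ ξ : Fin n → V, ‖H (consSub (ξ, η))‖ₑ ^ 2 := by
  set B := Metric.closedBall (0 : Fin n → V) R
  have hB : MeasurableSet B := Metric.isClosed_closedBall.measurableSet
  have norm_le_norm_consSub (ξ : Fin n → V) : ‖ξ‖ ≤ ‖consSub (ξ, η)‖ := by
    refine (pi_norm_le_iff_of_nonneg (norm_nonneg _)).2 fun i => ?_
    simpa [consSub] using norm_le_pi_norm (consSub (ξ, η)) i.succ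
  have vanish (ξ : Fin n → V) :
      B.indicator 1 ξ * ‖H (consSub (ξ, η))‖ₑ = ‖H (consSub (ξ, η))‖ₑ := by
    by_cases hξ : ξ ∈ B
    · simp [hξ]
    · rw [mem_closedBall_zero_iff, not_le] at hξ
      have : H (consSub (ξ, η)) = 0 :=
        by_contra fun h => (hξ.trans_le (norm_le_norm_consSub ξ)).not_ge (hR _ h)
      simp [this]
  have hHm : Measurable fun ξ : Fin n → V => ‖H (consSub (ξ, η))‖ₑ :=
    (hH.comp ((measurePreserving_consSub n).measurable.comp (by fun_prop))).enorm
  calc ‖∫ ξ : Fin n → V, H (consSub (ξ, η))‖ₑ ^ 2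
      ≤ (∫⁻ ξ : Fin n → V, B.indicator 1 ξ * ‖H (consSub (ξ, η))‖ₑ) ^ 2 := by
        simp_rw [vanish]
        gcongr
        exact enorm_integral_le_lintegral_enorm _
    _ ≤ (∫⁻ ξ, B.indicator 1 ξ ^ 2) * ∫⁻ ξ : Fin n → V, ‖H (consSub (ξ, η))‖ₑ ^ 2 :=
        lintegral_mul_sq_le _ (measurable_one.indicator hB).aemeasurable hHm.aemeasurable
    _ = _ := by
        congr 1
        rw [← lintegral_indicator_one hB]
        refine lintegral_congr fun ξ => ?_
        by_cases hξ : ξ ∈ B <;> simp [hξ]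

theorem lintegral_enorm_diagFourierInv_sq_le {n : ℕ} {H : (Fin (n + 1) → V) → ℂ}
    (hHm : Measurable H) (hH : Integrable H) {R : ℝ} (hR₀ : 0 < R) (hR : ∀ ξ, H ξ ≠ 0 → ‖ξ‖ ≤ R) :
    ∫⁻ x, ‖diagFourierInv H x‖ₑ ^ 2 ≤
      volume (Metric.closedBall (0 : Fin n → V) R) * ∫⁻ ξ, ‖H ξ‖ₑ ^ 2 := by
  by_cases htop : ∫⁻ ξ, ‖H ξ‖ₑ ^ 2 = ∞
  · simp [htop, ENNReal.mul_top (Metric.measure_closedBall_pos volume _ hR₀).ne']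
  have hΦ := measurePreserving_consSub (V := V) n
  have hB : volume (Metric.closedBall (0 : Fin n → V) R) ≠ ∞ := measure_closedBall_lt_top.ne
  set h : V → ℂ := fun η => ∫ ξ : Fin n → V, H (consSub (ξ, η))
  have h_int : Integrable h :=
    (show Integrable _ (volume.prod volume) from
      hΦ.integrable_comp_of_integrable hH).integral_prod_right
  have h_sq : ∫⁻ η, ‖h η‖ₑ ^ 2 ≤ volume (Metric.closedBall (0 : Fin n → V) R) *
      ∫⁻ ξ, ‖H ξ‖ₑ ^ 2 := by
    refine (lintegral_mono (enorm_integral_consSub_sq_le hHm hR)).trans_eq ?_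
    rw [lintegral_const_mul' _ _ hB, ← hΦ.lintegral_comp (hHm.enorm.pow_const 2),
      Measure.volume_eq_prod, lintegral_prod_symm]
    exact ((hHm.comp hΦ.measurable).enorm.pow_const 2).aemeasurable
  have h_mem : MemLp h 2 := by
    refine ⟨h_int.aestronglyMeasurable, ?_⟩
    rw [eLpNorm_lt_top_iff_lintegral_rpow_enorm_lt_top (by norm_num) (by norm_num)]
    simpa using h_sq.trans_lt (ENNReal.mul_lt_top hB.lt_top (lt_top_iff_ne_top.2 htop))
  calc _ = ∫⁻ x, ‖𝓕 h (-x)‖ₑ ^ 2 := by simp_rw [diagFourierInv_eq_fourier hH, h]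
    _ = ∫⁻ x, ‖𝓕 h x‖ₑ ^ 2 := lintegral_neg_eq_self (fun x => ‖𝓕 h x‖ₑ ^ 2)
    _ = ∫⁻ η, ‖h η‖ₑ ^ 2 := lintegral_enorm_fourier_sq h_int h_mem
    _ ≤ _ := h_sq

end SobolevTrace

section SingleScale

open FourierTransform Set Module

variable {V : Type*} [NormedAddCommGroup V] [InnerProductSpace ℝ V] [FiniteDimensional ℝ V]
  [MeasurableSpace V] [BorelSpace V]

theorem continuous_diagFourierInv {n : ℕ} {H : (Fin (n + 1) → V) → ℂ} (hH : Integrable H) :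
    Continuous (diagFourierInv H) := by
  simp_rw [funext (diagFourierInv_eq_fourier hH)]
  have h_int : Integrable _ (volume.prod volume) :=
    (measurePreserving_consSub (V := V) n).integrable_comp_of_integrable hH
  exact (continuous_fourier h_int.integral_prod_right).comp continuous_neg

theorem integrable_mul_of_bounded_on_support {W : Type*} [NormedAddCommGroup W] [MeasurableSpace W]
    [OpensMeasurableSpace W] {μ : Measure W} {G c : W → ℂ}
    (hG : Integrable G μ) (hc : Continuous c) {K : ℝ} (hK : ∀ ξ, G ξ ≠ 0 → ‖c ξ‖ ≤ K) :
    Integrable (fun ξ => G ξ * c ξ) μ := by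
  refine (hG.norm.mul_const K).mono' (hG.aestronglyMeasurable.mul hc.aestronglyMeasurable)
    (.of_forall fun ξ => ?_)
  rw [norm_mul]
  rcases eq_or_ne (G ξ) 0 with hξ | hξ
  · simp [hξ]
  · gcongr
    exact hK ξ hξ

section Dilation

variable {W : Type*} [NormedAddCommGroup W] [NormedSpace ℝ W] {F : W → ℂ}

theorem hasDerivAt_smul_comp (hF : ContDiff ℝ 1 F) (ξ : W) (t : ℝ) :
    HasDerivAt (fun t : ℝ => F (t • ξ)) (fderiv ℝ F (t • ξ) ξ) t := by
  simpa [Function.comp_def] using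
    (hF.differentiable one_ne_zero (t • ξ)).hasFDerivAt.comp_hasDerivAt t
      ((hasDerivAt_id t).smul_const ξ)

theorem continuous_fderiv_smul_apply (hF : ContDiff ℝ 1 F) :
    Continuous fun p : ℝ × W => fderiv ℝ F (p.1 • p.2) p.2 := by
  have := hF.continuous_fderiv one_ne_zero
  fun_prop

end Dilation

section BandLimited

variable {n : ℕ} {G : (Fin (n + 1) → V) → ℂ} {R : ℝ}

theorem measurable_diagFourierInv_mul (hGm : Measurable G) {c : ℝ → (Fin (n + 1) → V) → ℂ}
    (hc : Measurable (Function.uncurry c)) :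
    Measurable fun p : V × ℝ => diagFourierInv (fun ξ => G ξ * c p.2 ξ) p.1 := by
  refine (StronglyMeasurable.integral_prod_right (Measurable.stronglyMeasurable ?_)).measurable
  have : Measurable fun q : (V × ℝ) × (Fin (n + 1) → V) => c q.1.2 q.2 :=
    hc.comp (measurable_fst.snd.prodMk measurable_snd)
  exact (Continuous.measurable (by fun_prop)).smul ((hGm.comp measurable_snd).mul this)

theorem lintegral_lintegral_enorm_diagFourierInv_sq_le (hGm : Measurable G) (hG : Integrable G)
    (hR₀ : 0 < R) (hR : ∀ ξ, G ξ ≠ 0 → ‖ξ‖ ≤ R) {c : ℝ → (Fin (n + 1) → V) → ℂ}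
    (hc : Continuous (Function.uncurry c)) {K : ℝ}
    (hK : ∀ t ∈ Icc (1 : ℝ) 2, ∀ ξ, G ξ ≠ 0 → ‖c t ξ‖ ≤ K) :
    ∫⁻ x, ∫⁻ t in Icc (1 : ℝ) 2, ‖diagFourierInv (fun ξ => G ξ * c t ξ) x‖ₑ ^ 2 ≤
      volume (Metric.closedBall (0 : Fin n → V) R) *
        (ENNReal.ofReal K ^ 2 * ∫⁻ ξ, ‖G ξ‖ₑ ^ 2) := by
  rw [lintegral_lintegral_swap
    ((measurable_diagFourierInv_mul hGm hc.measurable).enorm.pow_const 2).aemeasurable]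
  calc _ ≤ ∫⁻ _ in Icc (1 : ℝ) 2, volume (Metric.closedBall (0 : Fin n → V) R) *
        (ENNReal.ofReal K ^ 2 * ∫⁻ ξ, ‖G ξ‖ₑ ^ 2) := by
        refine setLIntegral_mono' measurableSet_Icc fun t ht => ?_
        have hct : Continuous (c t) := hc.comp (by fun_prop : Continuous fun ξ => (t, ξ))
        refine (lintegral_enorm_diagFourierInv_sq_le (hGm.mul hct.measurable)
          (integrable_mul_of_bounded_on_support hG hct (hK t ht)) hR₀
          fun ξ hξ => hR ξ (left_ne_zero_of_mul hξ)).trans ?_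
        gcongr
        rw [← lintegral_const_mul' _ _ (by finiteness)]
        refine lintegral_mono fun ξ => ?_
        rw [Pi.mul_apply, enorm_mul, mul_pow, mul_comm]
        rcases eq_or_ne (G ξ) 0 with hξ | hξ
        · simp [hξ]
        · gcongr
          exact ofReal_norm (c t ξ) ▸ ENNReal.ofReal_le_ofReal (hK t ht ξ hξ)
    _ = _ := by simp [Real.volume_Icc, show (2 : ℝ) - 1 = 1 by norm_num]

variable {F : (Fin (n + 1) → V) → ℂ} {M : ℝ}

theorem hasDerivAt_diagFourierInv_smul (hG : Integrable G) (hR : ∀ ξ, G ξ ≠ 0 → ‖ξ‖ ≤ R)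
    (hF : ContDiff ℝ 1 F) (hM : ∀ ξ, ‖F ξ‖ ≤ M) (hM' : ∀ ξ, ‖fderiv ℝ F ξ‖ ≤ M) (x : V) (t : ℝ) :
    HasDerivAt (fun t : ℝ => diagFourierInv (fun ξ => G ξ * F (t • ξ)) x)
      (diagFourierInv (fun ξ => G ξ * fderiv ℝ F (t • ξ) ξ) x) t := by
  have phase_meas : AEStronglyMeasurable (fun ξ : Fin (n + 1) → V => 𝐞 ⟪∑ i, ξ i, x⟫) :=
    Continuous.aestronglyMeasurable (by fun_prop)
  have hF_cont (t : ℝ) : Continuous fun ξ : Fin (n + 1) → V => F (t • ξ) := by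
    have := hF.continuous
    fun_prop
  have hint (t : ℝ) : Integrable fun ξ => 𝐞 ⟪∑ i, ξ i, x⟫ • (G ξ * F (t • ξ)) := by
    have h := integrable_mul_of_bounded_on_support hG (hF_cont t) (K := M) fun ξ _ => hM _
    exact h.mono (phase_meas.smul h.aestronglyMeasurable)
      (.of_forall fun ξ => by rw [Circle.norm_smul])
  refine (hasDerivAt_integral_of_dominated_loc_of_deriv_le (bound := fun ξ => ‖G ξ‖ * (M * R))
    (F' := fun t ξ => 𝐞 ⟪∑ i, ξ i, x⟫ • (G ξ * fderiv ℝ F (t • ξ) ξ))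
    Filter.univ_mem (.of_forall fun t => (hint t).aestronglyMeasurable) (hint t)
    (phase_meas.smul (hG.aestronglyMeasurable.mul ?_)) ?_ (hG.norm.mul_const _) ?_).2
  · exact ((continuous_fderiv_smul_apply hF).comp
      (by fun_prop : Continuous fun ξ => (t, ξ))).aestronglyMeasurable
  · refine .of_forall fun ξ t _ => ?_
    rw [Circle.norm_smul, norm_mul]
    rcases eq_or_ne (G ξ) 0 with hξ | hξ
    · simp [hξ]
    · gcongr
      exact ContinuousLinearMap.le_of_opNorm_le_of_le _ (hM' _) (hR ξ hξ)
  · exact .of_forall fun ξ t _ => ((hasDerivAt_smul_comp hF ξ t).const_mul (G ξ)).const_smul _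

theorem continuous_diagFourierInv_fderiv_smul (hG : Integrable G) (hR : ∀ ξ, G ξ ≠ 0 → ‖ξ‖ ≤ R)
    (hF : ContDiff ℝ 1 F) (hM' : ∀ ξ, ‖fderiv ℝ F ξ‖ ≤ M) (x : V) :
    Continuous fun t : ℝ => diagFourierInv (fun ξ => G ξ * fderiv ℝ F (t • ξ) ξ) x := by
  refine continuous_of_dominated (bound := fun ξ => ‖G ξ‖ * (M * R)) (fun t => ?_) (fun t => ?_)
    (hG.norm.mul_const _) (.of_forall fun ξ => ?_)
  · exact (Continuous.aestronglyMeasurable (by fun_prop)).smul (hG.aestronglyMeasurable.mul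
      ((continuous_fderiv_smul_apply hF).comp
        (by fun_prop : Continuous fun ξ => (t, ξ))).aestronglyMeasurable)
  · refine .of_forall fun ξ => ?_
    rw [Circle.norm_smul, norm_mul]
    rcases eq_or_ne (G ξ) 0 with hξ | hξ
    · simp [hξ]
    · gcongr
      exact ContinuousLinearMap.le_of_opNorm_le_of_le _ (hM' _) (hR ξ hξ)
  · exact ((continuous_const.mul ((continuous_fderiv_smul_apply hF).comp
      (by fun_prop : Continuous fun t => (t, ξ)))).const_smul _)

theorem lintegral_biSup_enorm_diagFourierInv_sq_le (hGm : Measurable G) (hG : Integrable G)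
    (hR₁ : 1 ≤ R) (hR : ∀ ξ, G ξ ≠ 0 → ‖ξ‖ ≤ R) (hF : ContDiff ℝ 1 F) (hM : ∀ ξ, ‖F ξ‖ ≤ M)
    (hM' : ∀ ξ, ‖fderiv ℝ F ξ‖ ≤ M) {K : ℝ}
    (hK : ∀ t ∈ Icc (1 : ℝ) 2, ∀ ξ, G ξ ≠ 0 → ‖F (t • ξ)‖ ≤ K)
    (hK' : ∀ t ∈ Icc (1 : ℝ) 2, ∀ ξ, G ξ ≠ 0 → ‖fderiv ℝ F (t • ξ)‖ ≤ K) :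
    ∫⁻ x, (⨆ t ∈ Icc (1 : ℝ) 2, ‖diagFourierInv (fun ξ => G ξ * F (t • ξ)) x‖ₑ) ^ 2 ≤
      3 * ENNReal.ofReal R * volume (Metric.closedBall (0 : Fin n → V) R) *
        (ENNReal.ofReal K ^ 2 * ∫⁻ ξ, ‖G ξ‖ₑ ^ 2) := by
  have hR₀ : 0 < R := one_pos.trans_le hR₁
  set u : ℝ → V → ℂ := fun t => diagFourierInv (fun ξ => G ξ * F (t • ξ))
  set u' : ℝ → V → ℂ := fun t => diagFourierInv (fun ξ => G ξ * fderiv ℝ F (t • ξ) ξ)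
  set Q := volume (Metric.closedBall (0 : Fin n → V) R) *
    (ENNReal.ofReal K ^ 2 * ∫⁻ ξ, ‖G ξ‖ₑ ^ 2) with hQ
  have energy : ∫⁻ x, ∫⁻ t in Icc (1 : ℝ) 2, ‖u t x‖ₑ ^ 2 ≤ Q :=
    lintegral_lintegral_enorm_diagFourierInv_sq_le hGm hG hR₀ hR (c := fun t ξ => F (t • ξ))
      (hF.continuous.comp (by fun_prop)) hK
  have energy' : ∫⁻ x, ∫⁻ t in Icc (1 : ℝ) 2, ‖u' t x‖ₑ ^ 2 ≤ ENNReal.ofReal R ^ 2 * Q := by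
    refine (lintegral_lintegral_enorm_diagFourierInv_sq_le hGm hG hR₀ hR
      (c := fun t ξ => fderiv ℝ F (t • ξ) ξ) (continuous_fderiv_smul_apply hF)
      (K := K * R) fun t ht ξ hξ => ?_).trans_eq ?_
    · exact ContinuousLinearMap.le_of_opNorm_le_of_le _ (hK' t ht ξ hξ) (hR ξ hξ)
    · rw [ENNReal.ofReal_mul' hR₀.le, hQ]
      ring
  have sobolev (x : V) : (⨆ t ∈ Icc (1 : ℝ) 2, ‖u t x‖ₑ) ^ 2 ≤
      (1 + ENNReal.ofReal R) * (∫⁻ t in Icc (1 : ℝ) 2, ‖u t x‖ₑ ^ 2) +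
        ENNReal.ofReal R⁻¹ * ∫⁻ t in Icc (1 : ℝ) 2, ‖u' t x‖ₑ ^ 2 :=
    sq_biSup_le fun t ht => enorm_sq_le_lintegral_of_hasDerivAt
      (hasDerivAt_diagFourierInv_smul hG hR hF hM hM' x)
      (continuous_diagFourierInv_fderiv_smul hG hR hF hM' x) hR₀ ht
  calc _ ≤ (1 + ENNReal.ofReal R) * Q + ENNReal.ofReal R⁻¹ * (ENNReal.ofReal R ^ 2 * Q) := by
        refine (lintegral_mono sobolev).trans ?_
        rw [lintegral_add_left (Measurable.const_mul (Measurable.lintegral_prod_right'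
            ((measurable_diagFourierInv_mul hGm (c := fun t ξ => F (t • ξ))
              (hF.continuous.comp (by fun_prop)).measurable).enorm.pow_const 2)) _),
          lintegral_const_mul' _ _ (by simp), lintegral_const_mul' _ _ (by simp)]
        gcongr
    _ = (1 + ENNReal.ofReal R + ENNReal.ofReal R) * Q := by
        rw [ENNReal.ofReal_inv_of_pos hR₀, sq, mul_assoc, ENNReal.inv_mul_cancel_left
          (by simpa using hR₀) ENNReal.ofReal_ne_top, ← add_mul]
    _ ≤ (ENNReal.ofReal R + ENNReal.ofReal R + ENNReal.ofReal R) * Q := by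
        gcongr
        simpa using hR₁
    _ = _ := by
        rw [hQ]
        ring

end BandLimited

end SingleScale

section DyadicSum

open FourierTransform Set Module

/-- The dyadic frequency shell `2^j ≤ 1 + |ξ| < 2^{j+1}`. -/
def freqShell (W : Type*) [Norm W] (j : ℕ) : Set W :=
  {ξ | (2 : ℝ) ^ j ≤ 1 + ‖ξ‖ ∧ 1 + ‖ξ‖ < (2 : ℝ) ^ (j + 1)}

section Shell

variable {W : Type*} [NormedAddCommGroup W]

theorem measurableSet_freqShell [MeasurableSpace W] [OpensMeasurableSpace W] (j : ℕ) :
    MeasurableSet (freqShell W j) :=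
  (measurableSet_le measurable_const (by fun_prop : Measurable fun ξ : W => 1 + ‖ξ‖)).inter
    (measurableSet_lt (by fun_prop : Measurable fun ξ : W => 1 + ‖ξ‖) measurable_const)

theorem iUnion_freqShell : ⋃ j, freqShell W j = univ :=
  eq_univ_of_forall fun ξ => mem_iUnion.2 <|
    exists_nat_pow_near (le_add_of_nonneg_right (norm_nonneg ξ)) one_lt_two

theorem pairwise_disjoint_freqShell : Pairwise (Function.onFun Disjoint (freqShell W)) := by
  refine (Std.Symm.pairwise_on (r := Disjoint) _).2 fun i j hij =>
    Set.disjoint_left.2 fun ξ hi hj => ?_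
  exact (hi.2.trans_le ((pow_le_pow_right₀ one_le_two hij).trans hj.1)).false

theorem integral_eq_tsum_freqShell [MeasurableSpace W] [OpensMeasurableSpace W] {μ : Measure W}
    {E : Type*} [NormedAddCommGroup E] [NormedSpace ℝ E] {f : W → E} (hf : Integrable f μ) :
    ∫ ξ, f ξ ∂μ = ∑' j, ∫ ξ, (freqShell W j).indicator f ξ ∂μ := by
  simp_rw [integral_indicator (measurableSet_freqShell _)]
  rw [← setIntegral_univ, ← iUnion_freqShell]
  exact integral_iUnion measurableSet_freqShell pairwise_disjoint_freqShell hf.integrableOn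

variable {E : Type*} [NormedAddCommGroup E] {F : W → E} {A s : ℝ}

theorem norm_le_of_decay (hs : 0 ≤ s) (hA : ∀ ξ, ‖F ξ‖ ≤ A * (1 + ‖ξ‖) ^ (-s)) (ξ : W) :
    ‖F ξ‖ ≤ A := by
  have hA₀ : 0 ≤ A := by simpa using (norm_nonneg _).trans (hA 0)
  exact (hA ξ).trans (mul_le_of_le_one_right hA₀
    (Real.rpow_le_one_of_one_le_of_nonpos (by simp) (neg_nonpos.2 hs)))

theorem norm_smul_le_of_mem_freqShell [NormedSpace ℝ W] (hs : 0 ≤ s)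
    (hA : ∀ ξ, ‖F ξ‖ ≤ A * (1 + ‖ξ‖) ^ (-s)) {j : ℕ} {ξ : W} (hξ : ξ ∈ freqShell W j) {t : ℝ}
    (ht : 1 ≤ t) : ‖F (t • ξ)‖ ≤ A * ((2 : ℝ) ^ j) ^ (-s) := by
  have hA₀ : 0 ≤ A := by simpa using (norm_nonneg _).trans (hA 0)
  refine (hA _).trans (mul_le_mul_of_nonneg_left ?_ hA₀)
  refine Real.rpow_le_rpow_of_nonpos (by positivity) (hξ.1.trans ?_) (neg_nonpos.2 hs)
  rw [norm_smul, Real.norm_of_nonneg (by linarith)]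
  gcongr
  exact le_mul_of_one_le_left (norm_nonneg ξ) ht

end Shell

theorem tsum_mul_sq_le {ι : Type*} (a b : ι → ℝ≥0∞) :
    (∑' j, a j * b j) ^ 2 ≤ (∑' j, a j ^ 2) * ∑' j, b j ^ 2 := by
  let _ : MeasurableSpace ι := ⊤
  simpa only [lintegral_count] using lintegral_mul_sq_le Measure.count (f := a) (g := b)
    measurable_from_top.aemeasurable measurable_from_top.aemeasurable

theorem shell_constant_eq {q : ℝ} (hq : 0 < q) {A : ℝ} (hA : 0 ≤ A) {N : ℕ} {s δ : ℝ}
    (h : N + 1 - 2 * s = -2 * δ) :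
    3 * ENNReal.ofReal (2 * q) * ENNReal.ofReal (2 * q) ^ N * ENNReal.ofReal (A * q ^ (-s)) ^ 2 =
      ENNReal.ofReal (6 * 2 ^ N * A ^ 2) * ENNReal.ofReal (q ^ (-δ)) ^ 2 := by
  have powers : q * q ^ N * (q ^ (-s)) ^ 2 = (q ^ (-δ)) ^ 2 := by
    rw [← Real.rpow_natCast, ← Real.rpow_mul_natCast hq.le, ← Real.rpow_mul_natCast hq.le,
      ← Real.rpow_one_add' hq.le (by positivity), ← Real.rpow_add hq]
    congr 1
    push_cast
    linarith
  rw [← ENNReal.ofReal_ofNat 3, ← ENNReal.ofReal_mul (by positivity),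
    ← ENNReal.ofReal_pow (by positivity), ← ENNReal.ofReal_mul (by positivity),
    ← ENNReal.ofReal_pow (by positivity), ← ENNReal.ofReal_mul (by positivity),
    ← ENNReal.ofReal_pow (by positivity), ← ENNReal.ofReal_mul (by positivity), ← powers]
  congr 1
  ring

variable {V : Type*} [NormedAddCommGroup V] [InnerProductSpace ℝ V] [FiniteDimensional ℝ V]
  [MeasurableSpace V] [BorelSpace V]

variable {n : ℕ} {F : (Fin (n + 1) → V) → ℂ} {A s δ : ℝ}

theorem lintegral_biSup_shell_le (hs : 0 ≤ s) (hsδ : (n * finrank ℝ V : ℕ) + 1 - 2 * s = -2 * δ)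
    (hF : ContDiff ℝ 1 F) (hA : ∀ ξ, ‖F ξ‖ ≤ A * (1 + ‖ξ‖) ^ (-s))
    (hA' : ∀ ξ, ‖fderiv ℝ F ξ‖ ≤ A * (1 + ‖ξ‖) ^ (-s)) {G : (Fin (n + 1) → V) → ℂ}
    (hGm : Measurable G) (hG : Integrable G) (j : ℕ) :
    ∫⁻ x, (⨆ t ∈ Icc (1 : ℝ) 2,
        ‖diagFourierInv ((freqShell _ j).indicator fun ξ => G ξ * F (t • ξ)) x‖ₑ) ^ 2 ≤
      ENNReal.ofReal (6 * 2 ^ (n * finrank ℝ V) * A ^ 2) *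
        volume (Metric.ball (0 : Fin n → V) 1) *
          (ENNReal.ofReal (((2 : ℝ) ^ j) ^ (-δ)) ^ 2 * ∫⁻ ξ in freqShell _ j, ‖G ξ‖ₑ ^ 2) := by
  have hA₀ : 0 ≤ A := by simpa using (norm_nonneg _).trans (hA 0)
  set S := freqShell (Fin (n + 1) → V) j
  have hq : 1 ≤ (2 : ℝ) ^ j := one_le_pow₀ one_le_two
  have band := lintegral_biSup_enorm_diagFourierInv_sq_le (R := 2 * 2 ^ j) (M := A)
    (hGm.indicator (measurableSet_freqShell j)) (hG.indicator (measurableSet_freqShell j))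
    (by linarith) (fun ξ hξ => ?_) hF (norm_le_of_decay hs hA)
    (norm_le_of_decay (F := fderiv ℝ F) hs hA')
    (fun t ht ξ hξ => norm_smul_le_of_mem_freqShell hs hA (mem_of_indicator_ne_zero hξ) ht.1)
    (fun t ht ξ hξ => norm_smul_le_of_mem_freqShell (F := fderiv ℝ F) hs hA'
      (mem_of_indicator_ne_zero hξ) ht.1)
  · have sup_eq (t : ℝ) : (S.indicator fun ξ => G ξ * F (t • ξ)) =
        fun ξ => S.indicator G ξ * F (t • ξ) := funext fun ξ => indicator_mul_left _ _ _
    have mass : ∫⁻ ξ, ‖S.indicator G ξ‖ₑ ^ 2 = ∫⁻ ξ in S, ‖G ξ‖ₑ ^ 2 := by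
      rw [← lintegral_indicator (s := S) (measurableSet_freqShell j)]
      exact lintegral_congr fun ξ => by by_cases hξ : ξ ∈ S <;> simp [hξ]
    have volume_ball : volume (Metric.closedBall (0 : Fin n → V) (2 * 2 ^ j)) =
        ENNReal.ofReal (2 * 2 ^ j) ^ (n * finrank ℝ V) *
          volume (Metric.ball (0 : Fin n → V) 1) := by
      rw [Measure.addHaar_closedBall _ _ (by positivity), ENNReal.ofReal_pow (by positivity)]
      simp [finrank_pi_fintype]
    simp_rw [sup_eq]
    refine band.trans_eq ?_
    rw [mass, volume_ball]
    set q : ℝ := 2 ^ j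
    calc _ = 3 * ENNReal.ofReal (2 * q) * ENNReal.ofReal (2 * q) ^ (n * finrank ℝ V) *
          ENNReal.ofReal (A * q ^ (-s)) ^ 2 *
            (volume (Metric.ball (0 : Fin n → V) 1) * ∫⁻ ξ in S, ‖G ξ‖ₑ ^ 2) := by ring
      _ = _ := by rw [shell_constant_eq (by positivity) hA₀ hsδ]; ring
  · linarith [(mem_of_indicator_ne_zero hξ).2, pow_succ' (2 : ℝ) j]

theorem tsum_sq_le_tsum_mul_tsum_inv_mul_sq {ι : Type*} {w : ι → ℝ≥0∞} (hw : ∀ j, w j ≠ 0)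
    (hw' : ∀ j, w j ≠ ∞) (a : ι → ℝ≥0∞) :
    (∑' j, a j) ^ 2 ≤ (∑' j, w j) * ∑' j, (w j)⁻¹ * a j ^ 2 := by
  have root_ne (j : ι) : w j ^ (1 / 2 : ℝ) ≠ 0 := by simp [hw, hw']
  have root_sq (j : ι) : (w j ^ (1 / 2 : ℝ)) ^ 2 = w j := by
    rw [← ENNReal.rpow_mul_natCast]; norm_num
  have split (j : ι) : a j = w j ^ (1 / 2 : ℝ) * ((w j ^ (1 / 2 : ℝ))⁻¹ * a j) := by
    rw [ENNReal.mul_inv_cancel_left (root_ne j) (by simp [hw'])]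
  simpa only [← split, mul_pow, ← ENNReal.inv_pow, root_sq] using
    tsum_mul_sq_le (fun j => w j ^ (1 / 2 : ℝ)) fun j => (w j ^ (1 / 2 : ℝ))⁻¹ * a j

theorem tsum_ofReal_two_pow_rpow_neg_ne_top {δ : ℝ} (hδ : 0 < δ) :
    ∑' j : ℕ, ENNReal.ofReal (((2 : ℝ) ^ j) ^ (-δ)) ≠ ∞ := by
  have geometric (j : ℕ) : ((2 : ℝ) ^ j) ^ (-δ) = ((2 : ℝ) ^ (-δ)) ^ j := by
    rw [← Real.rpow_natCast_mul (by norm_num), mul_comm, Real.rpow_mul_natCast (by norm_num)]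
  simp_rw [geometric]
  exact (summable_geometric_of_lt_one (by positivity)
    (Real.rpow_lt_one_of_one_lt_of_neg one_lt_two (neg_lt_zero.2 hδ))).tsum_ofReal_ne_top

theorem tsum_mul_setLIntegral_freqShell_le {W : Type*} [NormedAddCommGroup W] [MeasurableSpace W]
    [OpensMeasurableSpace W] (μ : Measure W) {δ : ℝ} (hδ : 0 ≤ δ) (f : W → ℝ≥0∞) :
    ∑' j, ENNReal.ofReal (((2 : ℝ) ^ j) ^ (-δ)) * ∫⁻ ξ in freqShell W j, f ξ ∂μ ≤
      ENNReal.ofReal (2 ^ δ) * ∫⁻ ξ, f ξ * ENNReal.ofReal ((1 + ‖ξ‖) ^ (-δ)) ∂μ := by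
  have weight {j : ℕ} {ξ : W} (hξ : ξ ∈ freqShell W j) :
      ((2 : ℝ) ^ j) ^ (-δ) ≤ 2 ^ δ * (1 + ‖ξ‖) ^ (-δ) := by
    have h : (2 : ℝ) ^ δ * (2 * 2 ^ j) ^ (-δ) = (2 ^ j) ^ (-δ) := by
      rw [Real.mul_rpow (by norm_num) (by positivity), ← mul_assoc,
        ← Real.rpow_add (by norm_num), add_neg_cancel, Real.rpow_zero, one_mul]
    rw [← h]
    refine mul_le_mul_of_nonneg_left ?_ (by positivity)
    exact Real.rpow_le_rpow_of_nonpos (by positivity) (hξ.2.le.trans_eq (pow_succ' _ _))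
      (neg_nonpos.2 hδ)
  rw [← lintegral_const_mul' _ _ ENNReal.ofReal_ne_top, ← setLIntegral_univ, ← iUnion_freqShell,
    lintegral_iUnion measurableSet_freqShell pairwise_disjoint_freqShell]
  refine ENNReal.tsum_le_tsum fun j => ?_
  rw [← lintegral_const_mul' _ _ ENNReal.ofReal_ne_top]
  refine setLIntegral_mono' (measurableSet_freqShell j) fun ξ hξ => ?_
  calc _ ≤ ENNReal.ofReal (2 ^ δ * (1 + ‖ξ‖) ^ (-δ)) * f ξ := by gcongr; exact weight hξ
    _ = _ := by rw [ENNReal.ofReal_mul (by positivity)]; ring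

theorem enorm_diagFourierInv_le_tsum {H : (Fin (n + 1) → V) → ℂ} (hH : Integrable H) (x : V) :
    ‖diagFourierInv H x‖ₑ ≤ ∑' j, ‖diagFourierInv ((freqShell _ j).indicator H) x‖ₑ := by
  have hχ : Continuous fun ξ : Fin (n + 1) → V => 𝐞 ⟪∑ i, ξ i, x⟫ :=
    Real.continuous_fourierChar.comp (by fun_prop)
  have integrable : Integrable fun ξ => 𝐞 ⟪∑ i, ξ i, x⟫ • H ξ :=
    hH.mono (hχ.aestronglyMeasurable.smul hH.aestronglyMeasurable)
      (.of_forall fun ξ => (Circle.norm_smul _ _).le)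
  rw [diagFourierInv, integral_eq_tsum_freqShell integrable]
  refine enorm_tsum_le_tsum_enorm.trans_eq (tsum_congr fun j => ?_)
  simp only [diagFourierInv, indicator_smul]

theorem exists_lintegral_biSup_enorm_diagFourierInv_le (hs : 0 ≤ s) (hδ : 0 < δ)
    (hsδ : (n * finrank ℝ V : ℕ) + 1 - 2 * s = -2 * δ) (hF : ContDiff ℝ 1 F) (hFs : HasDecay F s)
    (hFs' : HasDecay (fderiv ℝ F) s) :
    ∃ C : ℝ≥0, ∀ G : (Fin (n + 1) → V) → ℂ, Measurable G → Integrable G →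
      ∫⁻ x, (⨆ t ∈ Icc (1 : ℝ) 2, ‖diagFourierInv (fun ξ => G ξ * F (t • ξ)) x‖ₑ) ^ 2 ≤
        C * ∫⁻ ξ, ‖G ξ‖ₑ ^ 2 * ENNReal.ofReal ((1 + ‖ξ‖) ^ (-δ)) := by
  obtain ⟨A, hA, hA'⟩ := hFs.exists_common_constant hFs'
  set w : ℕ → ℝ≥0∞ := fun j => ENNReal.ofReal (((2 : ℝ) ^ j) ^ (-δ))
  have hw (j : ℕ) : w j ≠ 0 := (ENNReal.ofReal_pos.2 (by positivity)).ne'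
  set K := ENNReal.ofReal (6 * 2 ^ (n * finrank ℝ V) * A ^ 2) *
    volume (Metric.ball (0 : Fin n → V) 1)
  have hC : (∑' j, w j) * (K * ENNReal.ofReal (2 ^ δ)) ≠ ∞ :=
    ENNReal.mul_ne_top (tsum_ofReal_two_pow_rpow_neg_ne_top hδ) (by finiteness)
  refine ⟨((∑' j, w j) * (K * ENNReal.ofReal (2 ^ δ))).toNNReal, fun G hGm hG => ?_⟩
  rw [ENNReal.coe_toNNReal hC]
  have integrable (t : ℝ) : Integrable fun ξ => G ξ * F (t • ξ) :=
    hG.mul_bdd (c := A) (hF.continuous.comp (continuous_const_smul t)).aestronglyMeasurable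
      (.of_forall fun ξ => norm_le_of_decay hs hA _)
  set u : ℕ → V → ℝ≥0∞ := fun j x => ⨆ t ∈ Icc (1 : ℝ) 2,
    ‖diagFourierInv ((freqShell _ j).indicator fun ξ => G ξ * F (t • ξ)) x‖ₑ
  have hu (j : ℕ) : Measurable (u j) :=
    (lowerSemicontinuous_biSup fun t _ => (continuous_diagFourierInv
      ((integrable t).indicator (measurableSet_freqShell j))).enorm.lowerSemicontinuous).measurable
  calc _ ≤ ∫⁻ x, (∑' j, u j x) ^ 2 := by
        refine lintegral_mono fun x => ?_
        gcongr
        refine iSup₂_le fun t ht => (enorm_diagFourierInv_le_tsum (integrable t) x).trans ?_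
        exact ENNReal.tsum_le_tsum fun j => le_iSup₂_of_le t ht le_rfl
    _ ≤ ∫⁻ x, (∑' j, w j) * ∑' j, (w j)⁻¹ * u j x ^ 2 :=
        lintegral_mono fun x => tsum_sq_le_tsum_mul_tsum_inv_mul_sq hw (by finiteness) _
    _ = (∑' j, w j) * ∑' j, (w j)⁻¹ * ∫⁻ x, u j x ^ 2 := by
        rw [lintegral_const_mul'' _ (by fun_prop), lintegral_tsum fun j => by fun_prop]
        simp_rw [lintegral_const_mul'' _ ((hu _).pow_const 2).aemeasurable]
    _ ≤ (∑' j, w j) * ∑' j, K * (w j * ∫⁻ ξ in freqShell _ j, ‖G ξ‖ₑ ^ 2) := by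
        refine mul_le_mul' le_rfl (ENNReal.tsum_le_tsum fun j => ?_)
        rw [ENNReal.inv_mul_le_iff (hw j) (by finiteness)]
        exact (lintegral_biSup_shell_le hs hsδ hF hA hA' hGm hG j).trans_eq (by ring)
    _ ≤ _ := by
        rw [ENNReal.tsum_mul_left]
        exact (mul_le_mul' le_rfl (mul_le_mul' le_rfl
          (tsum_mul_setLIntegral_freqShell_le volume hδ.le _))).trans_eq (by ring)

end DyadicSum

section NegSobolev

open FourierTransform VectorFourier Module

variable {V : Type*} [NormedAddCommGroup V] [InnerProductSpace ℝ V] [FiniteDimensional ℝ V]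
  [MeasurableSpace V] [BorelSpace V]

/-- The squared norm of `g` in the inhomogeneous Sobolev space `H^{-ε/2}`, with the weight
`(1 + |ξ|)^{-ε}` in place of the equivalent `(1 + |ξ|²)^{-ε/2}`. -/
noncomputable def negSobolevSq (ε : ℝ) (g : V → ℂ) : ℝ≥0∞ :=
  ∫⁻ ξ, ‖𝓕 g ξ‖ₑ ^ 2 * ENNReal.ofReal ((1 + ‖ξ‖) ^ (-ε))

theorem integrable_fourier_schwartz (g : SchwartzMap V ℂ) : Integrable (𝓕 (g : V → ℂ)) := by
  rw [← SchwartzMap.fourier_coe]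
  exact (𝓕 g).integrable

theorem continuous_fourier_schwartz (g : SchwartzMap V ℂ) : Continuous (𝓕 (g : V → ℂ)) := by
  rw [← SchwartzMap.fourier_coe]
  exact (𝓕 g).continuous

theorem fourierInv_fourier_schwartz (g : SchwartzMap V ℂ) (x : V) :
    ∫ ξ, 𝐞 ⟪ξ, x⟫ • 𝓕 (g : V → ℂ) ξ = g x := by
  rw [← Real.fourierInv_eq, ← SchwartzMap.fourier_coe, ← SchwartzMap.fourierInv_coe,
    FourierTransform.fourierInv_fourier_eq]

theorem negSobolevSq_schwartz_le {ε : ℝ} (hε : 0 ≤ ε) (g : SchwartzMap V ℂ) :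
    negSobolevSq ε g ≤ ∫⁻ x, ‖g x‖ₑ ^ 2 := by
  rw [← lintegral_enorm_fourier_sq g.integrable (g.memLp 2)]
  exact lintegral_mono fun ξ => mul_le_of_le_one_right' <| ENNReal.ofReal_le_one.2 <|
    Real.rpow_le_one_of_one_le_of_nonpos (by simp) (neg_nonpos.2 hε)

theorem fourier_translate_mul (χ h : SchwartzMap V ℂ) (z ξ : V) :
    𝓕 (fun x => χ (x - z) * h x) ξ =
      𝓕 (fun η => 𝓕 (χ : V → ℂ) η * 𝓕 (h : V → ℂ) (ξ - η)) z := by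
  have translate (x : V) : fourierIntegral 𝐞 volume (-innerₗ V).flip
      (fun η => 𝐞 (-⟪η, z⟫) • 𝓕 (χ : V → ℂ) η) x = χ (x - z) := by
    rw [← fourierInv_fourier_schwartz χ]
    refine integral_congr_ae (.of_forall fun η => ?_)
    have phase : -(-⟪x, η⟫) + -⟪η, z⟫ = ⟪η, x - z⟫ := by
      rw [inner_sub_right, real_inner_comm]
      ring
    simp [← phase, AddChar.map_add_eq_mul, mul_smul]
  have modulate (η : V) : fourierIntegral 𝐞 volume (-innerₗ V) (fun x => 𝐞 (-⟪x, ξ⟫) • h x) η =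
      𝓕 (h : V → ℂ) (ξ - η) := by
    rw [Real.fourier_eq]
    refine integral_congr_ae (.of_forall fun x => ?_)
    have phase : -(-⟪x, η⟫) + -⟪x, ξ⟫ = -⟪x, ξ - η⟫ := by
      rw [inner_sub_right]
      ring
    simp [← phase, AddChar.map_add_eq_mul, mul_smul]
  have fubini := integral_fourierIntegral_smul_eq_flip (μ := volume) (ν := volume)
    (L := -innerₗ V) Real.continuous_fourierChar continuous_inner.neg
    (f := fun x => 𝐞 (-⟪x, ξ⟫) • h x) (g := fun η => 𝐞 (-⟪η, z⟫) • 𝓕 (χ : V → ℂ) η)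
    ((Real.fourierIntegral_convergent_iff ξ).2 h.integrable)
    ((Real.fourierIntegral_convergent_iff z).2 (integrable_fourier_schwartz χ))
  simp_rw [translate, modulate] at fubini
  rw [Real.fourier_eq, Real.fourier_eq]
  refine Eq.trans ?_ (fubini.symm.trans ?_) <;>
  refine integral_congr_ae (.of_forall fun x => ?_) <;>
  simp [Circle.smul_def, mul_assoc, mul_comm, mul_left_comm]

theorem lintegral_enorm_fourier_translate_mul_sq (χ h : SchwartzMap V ℂ) (ξ : V) :
    ∫⁻ z, ‖𝓕 (fun x => χ (x - z) * h x) ξ‖ₑ ^ 2 =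
      ∫⁻ η, ‖𝓕 (χ : V → ℂ) η‖ₑ ^ 2 * ‖𝓕 (h : V → ℂ) (ξ - η)‖ₑ ^ 2 := by
  simp_rw [fourier_translate_mul χ h _ ξ, ← SchwartzMap.fourier_coe]
  have bounded : MemLp (fun η => (𝓕 h : SchwartzMap V ℂ) (ξ - η)) ∞ := by
    obtain ⟨K, -, hK⟩ := (𝓕 h : SchwartzMap V ℂ).decay 0 0
    exact memLp_top_of_bound (Continuous.aestronglyMeasurable (by fun_prop)) K
      (.of_forall fun η => by simpa using hK (ξ - η))
  refine (lintegral_enorm_fourier_sq (memLp_one_iff_integrable.1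
    (bounded.mul ((𝓕 χ : SchwartzMap V ℂ).memLp 1)))
    (bounded.mul ((𝓕 χ : SchwartzMap V ℂ).memLp 2))).trans ?_
  simp_rw [Pi.mul_apply, enorm_mul, mul_pow]

theorem lintegral_enorm_schwartz_sq_mul_rpow_ne_top (ψ : SchwartzMap V ℂ) (ε : ℝ) :
    ∫⁻ η, ‖ψ η‖ₑ ^ 2 * ENNReal.ofReal ((1 + ‖η‖) ^ ε) ≠ ∞ := by
  obtain ⟨K, -, hK⟩ := ψ.decay 0 0
  have integrable : Integrable fun η => (1 + ‖η‖) ^ ε * ‖ψ η‖ * ‖ψ η‖ :=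
    (integrable_one_add_norm_rpow_mul_schwartz ψ ε).mul_bdd (c := K)
      ψ.continuous.norm.aestronglyMeasurable (.of_forall fun η => by simpa using hK η)
  refine (lintegral_congr fun η => ?_).trans_ne integrable.lintegral_lt_top.ne
  rw [ENNReal.ofReal_mul (by positivity), ENNReal.ofReal_mul (by positivity), ofReal_norm]
  ring

theorem measurable_fourier_translate_mul {χ h : V → ℂ} (hχ : Continuous χ) (hh : Continuous h) :
    Measurable fun p : V × V => 𝓕 (fun x => χ (x - p.1) * h x) p.2 := by
  simp_rw [Real.fourier_eq]
  refine (StronglyMeasurable.integral_prod_right' (ν := volume)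
    (f := fun q : (V × V) × V => 𝐞 (-⟪q.2, q.1.2⟫) • (χ (q.2 - q.1.1) * h q.2))
    (Continuous.stronglyMeasurable ?_)).measurable
  have := Real.continuous_fourierChar
  fun_prop

theorem measurable_negSobolevSq_translate_mul (ε : ℝ) {χ h : V → ℂ} (hχ : Continuous χ)
    (hh : Continuous h) : Measurable fun z => negSobolevSq ε (fun x => χ (x - z) * h x) := by
  have joint := measurable_fourier_translate_mul hχ hh
  exact Measurable.lintegral_prod_right' (ν := volume)
    (f := fun p : V × V => ‖𝓕 (fun x => χ (x - p.1) * h x) p.2‖ₑ ^ 2 *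
      ENNReal.ofReal ((1 + ‖p.2‖) ^ (-ε))) (by fun_prop)

theorem exists_lintegral_negSobolevSq_translate_mul_le {ε : ℝ} (hε : 0 ≤ ε)
    (χ : SchwartzMap V ℂ) : ∃ C : ℝ≥0, ∀ h : SchwartzMap V ℂ,
      ∫⁻ z, negSobolevSq ε (fun x => χ (x - z) * h x) ≤ C * negSobolevSq ε h := by
  have hC := lintegral_enorm_schwartz_sq_mul_rpow_ne_top (𝓕 χ) ε
  refine ⟨(∫⁻ η, ‖(𝓕 χ : SchwartzMap V ℂ) η‖ₑ ^ 2 * ENNReal.ofReal ((1 + ‖η‖) ^ ε)).toNNReal,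
    fun h => ?_⟩
  rw [ENNReal.coe_toNNReal hC, SchwartzMap.fourier_coe]
  have hχ := continuous_fourier_schwartz χ
  have hh := continuous_fourier_schwartz h
  have joint := measurable_fourier_translate_mul χ.continuous h.continuous
  calc ∫⁻ z, negSobolevSq ε (fun x => χ (x - z) * h x)
      = ∫⁻ ξ, (∫⁻ z, ‖𝓕 (fun x => χ (x - z) * h x) ξ‖ₑ ^ 2) *
          ENNReal.ofReal ((1 + ‖ξ‖) ^ (-ε)) := by
        simp only [negSobolevSq]
        rw [lintegral_lintegral_swap (by fun_prop)]
        simp_rw [lintegral_mul_const' _ _ ENNReal.ofReal_ne_top]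
    _ = ∫⁻ η, ∫⁻ ξ, ‖𝓕 (χ : V → ℂ) η‖ₑ ^ 2 * (‖𝓕 (h : V → ℂ) (ξ - η)‖ₑ ^ 2 *
          ENNReal.ofReal ((1 + ‖ξ‖) ^ (-ε))) := by
        simp_rw [lintegral_enorm_fourier_translate_mul_sq,
          ← lintegral_mul_const' _ _ ENNReal.ofReal_ne_top, mul_assoc]
        exact lintegral_lintegral_swap (by fun_prop)
    _ = ∫⁻ η, ‖𝓕 (χ : V → ℂ) η‖ₑ ^ 2 * ∫⁻ ζ, ‖𝓕 (h : V → ℂ) ζ‖ₑ ^ 2 *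
          ENNReal.ofReal ((1 + ‖ζ + η‖) ^ (-ε)) := by
        refine lintegral_congr fun η => ?_
        rw [lintegral_const_mul' _ _ (by finiteness), ← lintegral_add_right_eq_self _ η]
        simp_rw [add_sub_cancel_right]
    _ ≤ ∫⁻ η, ‖𝓕 (χ : V → ℂ) η‖ₑ ^ 2 * (ENNReal.ofReal ((1 + ‖η‖) ^ ε) * negSobolevSq ε h) := by
        refine lintegral_mono fun η => mul_le_mul' le_rfl ?_
        rw [negSobolevSq, ← lintegral_const_mul' _ _ ENNReal.ofReal_ne_top]
        refine lintegral_mono fun ζ => ?_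
        rw [mul_left_comm, ← ENNReal.ofReal_mul (by positivity), mul_comm ((1 + ‖η‖) ^ ε)]
        gcongr
        exact one_add_norm_rpow_neg_le_mul hε ζ η
    _ = _ := by
        simp_rw [← mul_assoc]
        exact lintegral_mul_const _ (by fun_prop)

end NegSobolev

section MultilinearSingleScale

open FourierTransform VectorFourier Module Set

theorem enorm_prod {ι : Type*} (s : Finset ι) (z : ι → ℂ) : ‖∏ i ∈ s, z i‖ₑ = ∏ i ∈ s, ‖z i‖ₑ := by
  simp only [enorm_eq_nnnorm, nnnorm_prod, ENNReal.ofNNReal_finsetProd]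

theorem lintegral_fin_prod_eq_prod {X : Type*} [MeasureSpace X]
    [SigmaFinite (volume : Measure X)] {n : ℕ} {f : Fin n → X → ℝ≥0∞}
    (hf : ∀ i, Measurable (f i)) :
    ∫⁻ x : Fin n → X, ∏ i, f i (x i) = ∏ i, ∫⁻ x, f i x := by
  induction n with
  | zero => simp [volume_pi]
  | succ n ih =>
    have split := (volume_preserving_piFinSuccAbove (fun _ : Fin (n + 1) => X) 0).symm
    have tail : Measurable fun x : Fin n → X => ∏ i, f i.succ (x i) :=
      Finset.measurable_prod _ fun i _ => (hf _).comp (measurable_pi_apply i)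
    rw [← split.lintegral_comp (by fun_prop), Fin.prod_univ_succ, ← ih fun i => hf i.succ,
      Measure.volume_eq_prod, ← lintegral_prod_mul (hf 0).aemeasurable tail.aemeasurable]
    refine lintegral_congr fun p => ?_
    simp [Fin.prod_univ_succ, MeasurableEquiv.piFinSuccAbove, Fin.insertNthEquiv]

theorem lintegral_prod_fourier_sq_mul_rpow_le {V : Type*} [NormedAddCommGroup V]
    [InnerProductSpace ℝ V] [FiniteDimensional ℝ V] [MeasurableSpace V] [BorelSpace V] {n : ℕ}
    {ε : ℝ} (hε : 0 ≤ ε) (g : Fin n → SchwartzMap V ℂ) :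
    ∫⁻ ξ : Fin n → V, ‖∏ i, 𝓕 (g i : V → ℂ) (ξ i)‖ₑ ^ 2 *
        ENNReal.ofReal ((1 + ‖ξ‖) ^ (-(n * ε))) ≤ ∏ i, negSobolevSq ε (g i) := by
  have hg (i : Fin n) := continuous_fourier_schwartz (g i)
  simp only [negSobolevSq]
  rw [← lintegral_fin_prod_eq_prod fun i => by fun_prop]
  refine lintegral_mono fun ξ => ?_
  have weight : (1 + ‖ξ‖) ^ (-(n * ε)) ≤ ∏ i, (1 + ‖ξ i‖) ^ (-ε) := by
    calc (1 + ‖ξ‖) ^ (-(n * ε)) = ∏ _i : Fin n, (1 + ‖ξ‖) ^ (-ε) := by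
          rw [Finset.prod_const, Finset.card_fin, ← Real.rpow_mul_natCast (by positivity)]
          ring_nf
      _ ≤ _ := Finset.prod_le_prod (fun i _ => by positivity) fun i _ =>
          Real.rpow_le_rpow_of_nonpos (by positivity) (by gcongr; exact norm_le_pi_norm ξ i)
            (neg_nonpos.2 hε)
  rw [Finset.prod_mul_distrib, Finset.prod_pow, ← ENNReal.ofReal_prod_of_nonneg
    fun i _ => by positivity, enorm_prod]
  gcongr

variable {m d : ℕ} {σ : Measure (ProdSpace m d)}

theorem fourierMeasure_eq_fourierDensity (σ : Measure (ProdSpace m d)) :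
    fourierMeasure σ = fourierDensity σ fun _ => (1 : ℂ) := by
  ext ξ
  refine integral_congr_ae (.of_forall fun y => ?_)
  simp [Circle.smul_def, Real.fourierChar_apply]

theorem norm_le_norm_toLp (ξ : Fin m → EuclideanSpace ℝ (Fin d)) :
    ‖ξ‖ ≤ ‖(WithLp.toLp 2 ξ : ProdSpace m d)‖ :=
  (pi_norm_le_iff_of_nonneg (norm_nonneg _)).2 fun i =>
    PiLp.norm_apply_le (WithLp.toLp 2 ξ : ProdSpace m d) i

theorem fourierChar_sum_smul_prod {ι : Type*} (s : Finset ι) (a : ι → ℝ) (f : ι → ℂ) :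
    𝐞 (∑ i ∈ s, a i) • ∏ i ∈ s, f i = ∏ i ∈ s, 𝐞 (a i) • f i := by
  rw [Finset.prod_smul]
  exact congrArg (· • _) (map_prod 𝐞.toMonoidHom (fun i => Multiplicative.ofAdd (a i)) s)

theorem multAverage_eq_diagFourierInv (σ : Measure (ProdSpace m d)) [IsFiniteMeasure σ]
    (g : Fin m → SchwartzMap (EuclideanSpace ℝ (Fin d)) ℂ) (x : EuclideanSpace ℝ (Fin d)) (t : ℝ) :
    multAverage σ (fun i => g i) x t = diagFourierInv (fun ξ =>
      (∏ i, 𝓕 (g i : EuclideanSpace ℝ (Fin d) → ℂ) (ξ i)) *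
        fourierMeasure σ (t • WithLp.toLp 2 ξ)) x := by
  let L : ProdSpace m d →ₗ[ℝ] (Fin m → EuclideanSpace ℝ (Fin d)) →ₗ[ℝ] ℝ :=
    (t • innerₗ (ProdSpace m d)).compl₂ (WithLp.linearEquiv 2 ℝ _).symm.toLinearMap
  have L_continuous : Continuous fun p : ProdSpace m d × (Fin m → EuclideanSpace ℝ (Fin d)) =>
      L p.1 p.2 := by
    change Continuous fun p : ProdSpace m d × (Fin m → EuclideanSpace ℝ (Fin d)) =>
      t * ⟪p.1, WithLp.toLp 2 p.2⟫
    fun_prop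
  set G : (Fin m → EuclideanSpace ℝ (Fin d)) → ℂ := fun ξ =>
    ∏ i, 𝐞 ⟪ξ i, x⟫ • 𝓕 (g i : EuclideanSpace ℝ (Fin d) → ℂ) (ξ i)
  have hG : Integrable G := Integrable.fintype_prod fun i => by
    simpa using (Real.fourierIntegral_convergent_iff (-x)).2 (integrable_fourier_schwartz (g i))
  have flip_eq (y : ProdSpace m d) :
      fourierIntegral 𝐞 volume L.flip G y = ∏ i, g i (x - t • y i) := by
    simp_rw [← fourierInv_fourier_schwartz, ← integral_fintype_prod_volume_eq_prod]
    refine integral_congr_ae (.of_forall fun ξ => ?_)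
    have phase : -L y ξ = ∑ i, -(t * ⟪y i, ξ i⟫) := by
      simp [L, PiLp.inner_apply, Finset.mul_sum]
    simp only [LinearMap.flip_apply, phase, G, fourierChar_sum_smul_prod]
    refine Finset.prod_congr rfl fun i _ => ?_
    rw [← mul_smul, ← AddChar.map_add_eq_mul, inner_sub_right, real_inner_smul_right,
      real_inner_comm (y i), sub_eq_neg_add]
  have fubini := integral_fourierIntegral_smul_eq_flip (μ := σ) (ν := volume) (L := L)
    Real.continuous_fourierChar L_continuous (integrable_const (1 : ℂ)) hG
  simp_rw [flip_eq, one_smul] at fubini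
  refine fubini.symm.trans (integral_congr_ae (.of_forall fun ξ => ?_))
  have average : fourierIntegral 𝐞 σ L (fun _ => (1 : ℂ)) ξ =
      fourierMeasure σ (t • WithLp.toLp 2 ξ) := by
    rw [fourierMeasure_eq_fourierDensity]
    simp [fourierDensity, fourierIntegral, L]
  simp only [average, G, smul_eq_mul, sum_inner, ← fourierChar_sum_smul_prod]
  rw [mul_comm, smul_mul_assoc]

/-- The multilinear maximal function over the dilations `t ∈ [1, 2]`. -/
noncomputable def unitMaximal (σ : Measure (ProdSpace m d))
    (f : Fin m → EuclideanSpace ℝ (Fin d) → ℂ) (x : EuclideanSpace ℝ (Fin d)) : ℝ≥0∞ :=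
  ⨆ t ∈ Icc (1 : ℝ) 2, ‖multAverage σ f x t‖ₑ

/-- The single-scale smoothing estimate: the maximal function over `t ∈ [1, 2]` maps products of
Sobolev spaces of negative order `-ε / 2` to `L²`. -/
def HasUnitSmoothing (σ : Measure (ProdSpace m d)) (ε : ℝ) : Prop :=
  ∃ C : ℝ≥0, ∀ g : Fin m → SchwartzMap (EuclideanSpace ℝ (Fin d)) ℂ,
    ∫⁻ x, unitMaximal σ (fun i => g i) x ^ 2 ≤ C * ∏ i, negSobolevSq ε (g i)

theorem exists_hasUnitSmoothing [IsFiniteMeasure σ] (hm : m ≠ 0) {s : ℝ}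
    (hs : ((m : ℝ) - 1) * (d : ℝ) / 2 + 1 / 2 < s) (hR : ∀ᵐ y ∂σ, ‖y‖ ≤ 1)
    (hdecay : HasFourierDecay σ s) : ∃ ε : ℝ, 0 < ε ∧ HasUnitSmoothing σ ε := by
  obtain ⟨n, rfl⟩ := Nat.exists_eq_succ_of_ne_zero hm
  have hs₀ : 0 ≤ s := by
    push_cast at hs
    nlinarith [n.cast_nonneg (α := ℝ), d.cast_nonneg (α := ℝ)]
  let L := (PiLp.continuousLinearEquiv 2 ℝ fun _ : Fin (n + 1) => EuclideanSpace ℝ (Fin d)).symm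
  have hF := contDiff_fourierDensity_one hR
  have decay : HasDecay (fourierDensity σ fun _ => (1 : ℂ)) s :=
    fourierMeasure_eq_fourierDensity σ ▸ hdecay
  have decay_fderiv : HasDecay (fderiv ℝ ((fourierDensity σ fun _ => (1 : ℂ)) ∘ L)) s := by
    obtain ⟨A, hA⟩ := (HasDecay.fderiv_fourierDensity_one hs₀ decay hR).comp_of_norm_le hs₀
      norm_le_norm_toLp
    refine ⟨A * ‖(L : (Fin (n + 1) → EuclideanSpace ℝ (Fin d)) →L[ℝ] ProdSpace (n + 1) d)‖,
      fun ξ => ?_⟩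
    rw [L.comp_right_fderiv, mul_right_comm]
    exact (ContinuousLinearMap.opNorm_comp_le _ _).trans
      (mul_le_mul_of_nonneg_right (hA ξ) (norm_nonneg _))
  set δ : ℝ := s - ((n * d : ℕ) + 1) / 2 with hδ_def
  have hδ : 0 < δ := by
    push_cast at hs hδ_def
    linarith
  obtain ⟨C, hC⟩ := exists_lintegral_biSup_enorm_diagFourierInv_le hs₀ hδ
    (by rw [finrank_euclideanSpace_fin]; linarith) (hF.comp L.contDiff)
    (decay.comp_of_norm_le hs₀ norm_le_norm_toLp) decay_fderiv
  refine ⟨δ / (n + 1), by positivity, C, fun g => ?_⟩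
  simp_rw [unitMaximal, multAverage_eq_diagFourierInv, fourierMeasure_eq_fourierDensity]
  refine (hC _ ?_ (Integrable.fintype_prod fun i => integrable_fourier_schwartz (g i))).trans ?_
  · have hg (i : Fin (n + 1)) := continuous_fourier_schwartz (g i)
    fun_prop
  · have exponent : δ = (n + 1 : ℕ) * (δ / (n + 1)) := by push_cast; field_simp
    nth_rw 1 [exponent]
    exact mul_le_mul' le_rfl (lintegral_prod_fourier_sq_mul_rpow_le (by positivity) g)

end MultilinearSingleScale

section HighWeight

variable {V : Type*} [NormedAddCommGroup V]

/-- The weight on the Fourier side that dominates the negative Sobolev norm of `f - lowPart f`. The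
first factor bounds `‖1 - 𝓕 unitMollifier‖ ^ 2`, which removes the low frequencies. -/
noncomputable def highWeight (ε : ℝ) (ξ : V) : ℝ≥0∞ :=
  ENNReal.ofReal ((min 2 (2 * Real.pi * ‖ξ‖)) ^ 2 * (1 + ‖ξ‖) ^ (-ε))

theorem measurable_highWeight [MeasurableSpace V] [OpensMeasurableSpace V] (ε : ℝ) :
    Measurable (highWeight ε : V → ℝ≥0∞) := by
  unfold highWeight
  fun_prop

theorem min_sq_mul_rpow_le_of_le_one {ε r : ℝ} (hε : 0 ≤ ε) (hr : 0 < r) (hr₁ : r ≤ 1) :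
    (min 2 (2 * Real.pi * r)) ^ 2 * (1 + r) ^ (-ε) ≤ 64 * r ^ min ε 2 := by
  have hpi := Real.pi_pos
  have pi_sq : Real.pi ^ 2 ≤ 16 := by nlinarith [Real.pi_le_four]
  calc _ ≤ (2 * Real.pi * r) ^ 2 * 1 := by
        gcongr
        · exact min_le_right _ _
        · exact Real.rpow_le_one_of_one_le_of_nonpos (by linarith) (neg_nonpos.2 hε)
    _ = 4 * Real.pi ^ 2 * r ^ (2 : ℝ) := by
        rw [Real.rpow_two]
        ring
    _ ≤ 4 * 16 * r ^ min ε 2 := by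
        gcongr 4 * ?_ * ?_
        exact Real.rpow_le_rpow_of_exponent_ge hr hr₁ (min_le_right _ _)
    _ = _ := by ring

theorem min_sq_mul_rpow_le_of_one_le {ε r : ℝ} (hε : 0 ≤ ε) (hr : 1 ≤ r) :
    (min 2 (2 * Real.pi * r)) ^ 2 * (1 + r) ^ (-ε) ≤ 64 * r ^ (-min ε 2) := by
  calc _ ≤ 2 ^ 2 * r ^ (-ε) := by
        gcongr ?_ ^ 2 * ?_
        · exact min_le_left _ _
        · exact Real.rpow_le_rpow_of_nonpos (by linarith) (by linarith) (neg_nonpos.2 hε)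
    _ ≤ 64 * r ^ (-min ε 2) := by
        gcongr
        · norm_num
        · exact min_le_left _ _

theorem two_zpow_rpow (j : ℤ) (a : ℝ) : ((2 : ℝ) ^ j) ^ a = 2 ^ (j * a) := by
  rw [← Real.rpow_intCast, ← Real.rpow_mul zero_le_two]

theorem le_mul_pow_natAbs_of_mem_Ico {w : ℝ → ℝ} {K γ : ℝ} (hK : 0 ≤ K) (hγ : 0 ≤ γ)
    (small : ∀ r, 0 < r → r ≤ 1 → w r ≤ K * r ^ γ) (large : ∀ r, 1 ≤ r → w r ≤ K * r ^ (-γ))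
    (j : ℤ) {r : ℝ} (hr : r ∈ Set.Ico ((2 : ℝ) ^ j) (2 ^ (j + 1))) :
    w r ≤ K * 2 ^ γ * ((2 : ℝ) ^ (-γ)) ^ j.natAbs := by
  rw [← Real.rpow_natCast, ← Real.rpow_mul zero_le_two, mul_assoc, ← Real.rpow_add two_pos,
    Nat.cast_natAbs]
  have hr₀ : 0 < r := (zpow_pos two_pos j).trans_le hr.1
  rcases le_or_gt 0 j with hj | hj
  · refine (large r ((one_le_zpow₀ one_le_two hj).trans hr.1)).trans
      (mul_le_mul_of_nonneg_left ?_ hK)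
    refine (Real.rpow_le_rpow_of_nonpos (zpow_pos two_pos j) hr.1 (neg_nonpos.2 hγ)).trans ?_
    rw [two_zpow_rpow, abs_of_nonneg hj]
    exact Real.rpow_le_rpow_of_exponent_le one_le_two (by linarith)
  · refine (small r hr₀ (hr.2.le.trans (zpow_le_one_of_nonpos₀ one_le_two (by omega)))).trans
      (mul_le_mul_of_nonneg_left ?_ hK)
    refine (Real.rpow_le_rpow hr₀.le hr.2.le hγ).trans_eq ?_
    rw [two_zpow_rpow, abs_of_neg hj]
    push_cast
    ring_nf

theorem exists_tsum_zpow_mul_le {w : ℝ → ℝ} {K γ : ℝ} (hK : 0 ≤ K) (hγ : 0 < γ)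
    (small : ∀ r, 0 < r → r ≤ 1 → w r ≤ K * r ^ γ) (large : ∀ r, 1 ≤ r → w r ≤ K * r ^ (-γ)) :
    ∃ C : ℝ≥0, ∀ r, 0 < r → ∑' k : ℤ, ENNReal.ofReal (w (2 ^ k * r)) ≤ C := by
  have geometric : Summable fun n : ℕ => ((2 : ℝ) ^ (-γ)) ^ n :=
    summable_geometric_of_lt_one (by positivity)
      (Real.rpow_lt_one_of_one_lt_of_neg one_lt_two (neg_lt_zero.2 hγ))
  have summable : Summable fun j : ℤ => K * 2 ^ γ * ((2 : ℝ) ^ (-γ)) ^ j.natAbs :=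
    .mul_left _ (.of_nat_of_neg (by simpa only [Int.natAbs_natCast])
      (by simpa only [Int.natAbs_neg, Int.natAbs_natCast]))
  refine ⟨(∑' j : ℤ, ENNReal.ofReal (K * 2 ^ γ * ((2 : ℝ) ^ (-γ)) ^ j.natAbs)).toNNReal,
    fun r hr => ?_⟩
  rw [ENNReal.coe_toNNReal summable.tsum_ofReal_ne_top]
  obtain ⟨k₀, lower, upper⟩ := exists_mem_Ico_zpow hr one_lt_two
  have shifted (j : ℤ) : (2 : ℝ) ^ (j - k₀) * r ∈ Set.Ico ((2 : ℝ) ^ j) (2 ^ (j + 1)) := by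
    have hj : (2 : ℝ) ^ j = 2 ^ (j - k₀) * 2 ^ k₀ := by
      rw [← zpow_add₀ two_ne_zero, sub_add_cancel]
    rw [zpow_add_one₀ two_ne_zero] at upper ⊢
    rw [hj, mul_assoc]
    exact ⟨by gcongr, by gcongr⟩
  rw [← (Equiv.subRight k₀).tsum_eq fun k : ℤ => ENNReal.ofReal (w (2 ^ k * r))]
  exact ENNReal.tsum_le_tsum fun j => ENNReal.ofReal_le_ofReal
    (le_mul_pow_natAbs_of_mem_Ico hK hγ.le small large j (shifted j))

theorem exists_tsum_highWeight_le [NormedSpace ℝ V] {ε : ℝ} (hε : 0 < ε) :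
    ∃ C : ℝ≥0, ∀ ξ : V, ∑' k : ℤ, highWeight ε ((2 : ℝ) ^ k • ξ) ≤ C := by
  obtain ⟨C, hC⟩ := exists_tsum_zpow_mul_le (by norm_num) (lt_min hε two_pos)
    (fun r => min_sq_mul_rpow_le_of_le_one hε.le) (fun r => min_sq_mul_rpow_le_of_one_le hε.le)
  refine ⟨C, fun ξ => ?_⟩
  rcases eq_or_ne ξ 0 with rfl | hξ
  · simp [highWeight]
  · simpa [highWeight, norm_smul] using hC ‖ξ‖ (norm_pos_iff.2 hξ)

end HighWeight

section LowFrequency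

open FourierTransform ContinuousLinearMap Module
open scoped Convolution

variable {V : Type*} [NormedAddCommGroup V] [InnerProductSpace ℝ V]

/-- Smooth compactly supported functions. -/
def IsTestFunction (f : V → ℂ) : Prop :=
  ContDiff ℝ (⊤ : ℕ∞) f ∧ HasCompactSupport f

namespace IsTestFunction

variable {f g : V → ℂ}

theorem continuous (hf : IsTestFunction f) : Continuous f := hf.1.continuous

/-- A test function, bundled as a Schwartz function. -/
noncomputable def toSchwartz (hf : IsTestFunction f) : SchwartzMap V ℂ :=
  hf.2.toSchwartzMap hf.1

theorem exists_bound (hf : IsTestFunction f) : ∃ K, ∀ x, ‖f x‖ ≤ K :=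
  hf.2.exists_bound_of_continuous hf.continuous

theorem exists_enorm_le (hf : IsTestFunction f) : ∃ K : ℝ≥0, ∀ x, ‖f x‖ₑ ≤ K := by
  obtain ⟨K, hK⟩ := hf.exists_bound
  exact ⟨K.toNNReal, fun x => by
    rw [← ofReal_norm]
    exact ENNReal.ofReal_le_ofReal (hK x)⟩

theorem sub (hf : IsTestFunction f) (hg : IsTestFunction g) :
    IsTestFunction fun x => f x - g x :=
  ⟨hf.1.sub hg.1, hf.2.sub hg.2⟩

theorem mul_left (hf : IsTestFunction f) (hg : ContDiff ℝ (⊤ : ℕ∞) g) :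
    IsTestFunction fun x => g x * f x :=
  ⟨hg.mul hf.1, hf.2.mul_left⟩

theorem comp_smul (hf : IsTestFunction f) {r : ℝ} (hr : r ≠ 0) :
    IsTestFunction fun x => f (r • x) :=
  ⟨hf.1.comp (contDiff_const_smul r), hf.2.comp_homeomorph (Homeomorph.smulOfNeZero r hr)⟩

theorem integrable [FiniteDimensional ℝ V] [MeasurableSpace V] [BorelSpace V]
    (hf : IsTestFunction f) : Integrable f :=
  hf.toSchwartz.integrable

end IsTestFunction

variable [FiniteDimensional ℝ V] [MeasurableSpace V] [BorelSpace V]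

/-- A smooth bump function supported in the unit ball, fixed once and for all to define averages at
unit scale. -/
noncomputable def unitBump (V : Type*) [NormedAddCommGroup V] : ContDiffBump (0 : V) :=
  ⟨1 / 2, 1, by norm_num, by norm_num⟩

/-- The bump function normalized to integral one, as a complex-valued function. -/
noncomputable def unitMollifier (x : V) : ℂ :=
  ((unitBump V).normed volume x : ℝ)

/-- The average of `f` at unit scale, that is, its convolution with the unit mollifier. -/
noncomputable def lowPart (f : V → ℂ) : V → ℂ :=
  (unitBump V).normed volume ⋆[lsmul ℝ ℝ, volume] f

theorem lowPart_apply (f : V → ℂ) (x : V) :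
    lowPart f x = ∫ y, unitMollifier y * f (x - y) := by
  simp [lowPart, convolution, unitMollifier]

theorem IsTestFunction.lowPart {f : V → ℂ} (hf : IsTestFunction f) :
    IsTestFunction (lowPart f) :=
  ⟨(unitBump V).hasCompactSupport_normed.contDiff_convolution_left _ (unitBump V).contDiff_normed
    hf.integrable.locallyIntegrable, (unitBump V).hasCompactSupport_normed.convolution _ hf.2⟩

theorem integrable_unitMollifier : Integrable (unitMollifier : V → ℂ) :=
  (unitBump V).integrable_normed.ofReal

theorem integral_unitMollifier : ∫ y : V, unitMollifier y = 1 := by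
  simp only [unitMollifier]
  rw [integral_complex_ofReal, (unitBump V).integral_normed, Complex.ofReal_one]

theorem norm_unitMollifier (y : V) : ‖unitMollifier y‖ = (unitBump V).normed volume y := by
  rw [unitMollifier, Complex.norm_real, Real.norm_of_nonneg ((unitBump V).nonneg_normed y)]

theorem unitMollifier_eq_zero {y : V} (hy : 1 ≤ ‖y‖) : unitMollifier y = 0 := by
  have : y ∉ Function.support ((unitBump V).normed volume) := by
    rw [(unitBump V).support_normed_eq, mem_ball_zero_iff]
    exact not_lt.2 hy
  rw [unitMollifier, Function.notMem_support.1 this, Complex.ofReal_zero]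

theorem fourier_lowPart {f : V → ℂ} (hf : Integrable f) (ξ : V) :
    𝓕 (lowPart f) ξ = 𝓕 (unitMollifier : V → ℂ) ξ * 𝓕 f ξ :=
  Real.fourier_smul_convolution_eq integrable_unitMollifier hf ξ

theorem norm_one_sub_fourierChar_le (a : ℝ) : ‖(1 : ℂ) - 𝐞 a‖ ≤ 2 * Real.pi * |a| := by
  rw [norm_sub_rev, Real.fourierChar_apply, mul_comm]
  refine Real.norm_exp_I_mul_ofReal_sub_one_le.trans_eq ?_
  rw [Real.norm_eq_abs, abs_mul, abs_of_pos Real.two_pi_pos]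

theorem norm_one_sub_fourier_unitMollifier_le (ξ : V) :
    ‖1 - 𝓕 (unitMollifier : V → ℂ) ξ‖ ≤ min 2 (2 * Real.pi * ‖ξ‖) := by
  have difference : 1 - 𝓕 (unitMollifier : V → ℂ) ξ =
      ∫ y, (1 - (𝐞 (-⟪y, ξ⟫) : ℂ)) * unitMollifier y := by
    conv_lhs => rw [← integral_unitMollifier (V := V), Real.fourier_eq,
      ← integral_sub integrable_unitMollifier
        ((Real.fourierIntegral_convergent_iff ξ).2 integrable_unitMollifier)]
    exact integral_congr_ae (.of_forall fun y => by simp [Circle.smul_def, sub_mul])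
  have bound_of_bound (c : ℝ) (hc : ∀ y : V, ‖y‖ ≤ 1 → ‖1 - (𝐞 (-⟪y, ξ⟫) : ℂ)‖ ≤ c) :
      ‖1 - 𝓕 (unitMollifier : V → ℂ) ξ‖ ≤ c := by
    rw [difference]
    refine (norm_integral_le_of_norm_le ((unitBump V).integrable_normed.const_mul c)
      (.of_forall fun y => ?_)).trans_eq ?_
    · rw [norm_mul]
      rcases le_total ‖y‖ 1 with hy | hy
      · rw [norm_unitMollifier]
        exact mul_le_mul_of_nonneg_right (hc y hy) ((unitBump V).nonneg_normed y)
      · simp [← norm_unitMollifier, unitMollifier_eq_zero hy]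
    · rw [integral_const_mul, (unitBump V).integral_normed, mul_one]
  refine le_min (bound_of_bound 2 fun y _ => ?_) (bound_of_bound _ fun y hy => ?_)
  · refine (norm_sub_le _ _).trans_eq ?_
    rw [norm_one, Circle.norm_coe]
    norm_num
  · refine (norm_one_sub_fourierChar_le _).trans ?_
    rw [abs_neg]
    gcongr
    exact (abs_real_inner_le_norm y ξ).trans (mul_le_of_le_one_left (norm_nonneg _) hy)

/-- The energy of `f` above unit frequency, which dominates the Sobolev norm of `f - lowPart f`. -/
noncomputable def highEnergy (ε : ℝ) (f : V → ℂ) : ℝ≥0∞ :=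
  ∫⁻ ξ, ‖𝓕 f ξ‖ₑ ^ 2 * highWeight ε ξ

theorem negSobolevSq_sub_lowPart_le {f : V → ℂ} (hf : IsTestFunction f) (ε : ℝ) :
    negSobolevSq ε (fun x => f x - lowPart f x) ≤ highEnergy ε f := by
  refine lintegral_mono fun ξ => ?_
  have factor : 𝓕 (fun x => f x - lowPart f x) ξ =
      𝓕 f ξ * (1 - 𝓕 (unitMollifier : V → ℂ) ξ) := by
    rw [mul_sub, mul_one, mul_comm, ← fourier_lowPart hf.integrable]
    simp only [Real.fourier_eq, smul_sub]
    exact integral_sub ((Real.fourierIntegral_convergent_iff ξ).2 hf.integrable)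
      ((Real.fourierIntegral_convergent_iff ξ).2 hf.lowPart.integrable)
  rw [factor, enorm_mul, mul_pow, mul_assoc, highWeight, ENNReal.ofReal_mul (by positivity),
    ENNReal.ofReal_pow (by positivity), ← ofReal_norm (1 - _)]
  gcongr
  exact norm_one_sub_fourier_unitMollifier_le ξ

theorem exists_enorm_lowPart_le (V : Type*) [NormedAddCommGroup V] [InnerProductSpace ℝ V]
    [FiniteDimensional ℝ V] [MeasurableSpace V] [BorelSpace V] (R : ℝ) :
    ∃ K : ℝ≥0, ∀ (f : V → ℂ) (x x' : V),
      dist x' x ≤ R → ‖lowPart f x'‖ₑ ≤ K * hlMaximal (fun y => ‖f y‖ₑ) x := by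
  obtain ⟨M, hM⟩ := (unitBump V).hasCompactSupport_normed.exists_bound_of_continuous
    ((unitBump V).continuous_normed (μ := volume))
  refine ⟨(ENNReal.ofReal M * volume (Metric.ball (0 : V) (R + 1))).toNNReal, fun f x x' hx => ?_⟩
  rw [ENNReal.coe_toNNReal (ENNReal.mul_ne_top ENNReal.ofReal_ne_top measure_ball_lt_top.ne)]
  have localized (y : V) : ‖unitMollifier (x' - y) * f y‖ₑ ≤
      (Metric.ball x (R + 1)).indicator (fun y => ENNReal.ofReal M * ‖f y‖ₑ) y := by
    by_cases hy : y ∈ Metric.ball x (R + 1)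
    · rw [Set.indicator_of_mem hy, enorm_mul, ← ofReal_norm (unitMollifier _), norm_unitMollifier]
      gcongr
      exact (le_abs_self _).trans (hM _)
    · have far : 1 ≤ ‖x' - y‖ := by
        rw [Metric.mem_ball, not_lt] at hy
        rw [← dist_eq_norm]
        linarith [dist_triangle_left y x x']
      simp [unitMollifier_eq_zero far]
  calc ‖lowPart f x'‖ₑ = ‖∫ y, unitMollifier (x' - y) * f y‖ₑ := by
        rw [lowPart_apply, ← integral_sub_left_eq_self _ volume x']
        simp
    _ ≤ ∫⁻ y, ‖unitMollifier (x' - y) * f y‖ₑ := enorm_integral_le_lintegral_enorm _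
    _ ≤ ∫⁻ y, (Metric.ball x (R + 1)).indicator (fun y => ENNReal.ofReal M * ‖f y‖ₑ) y :=
        lintegral_mono localized
    _ = ENNReal.ofReal M * ∫⁻ y in Metric.ball x (R + 1), ‖f y‖ₑ := by
        rw [lintegral_indicator measurableSet_ball, lintegral_const_mul' _ _ ENNReal.ofReal_ne_top]
    _ ≤ ENNReal.ofReal M * (volume (Metric.ball x (R + 1)) * hlMaximal (fun y => ‖f y‖ₑ) x) := by
        gcongr
        exact lintegral_ball_le_hlMaximal _ _ (by linarith [dist_nonneg.trans hx])
    _ = _ := by rw [Measure.addHaar_ball_center, mul_assoc]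

end LowFrequency

section Averaging

theorem lintegral_prod_rpow_inv_card_le {X ι : Type*} [MeasurableSpace X] {μ : Measure X}
    {S : Finset ι} (hS : S.Nonempty) {F : ι → X → ℝ≥0∞} (hF : ∀ i ∈ S, AEMeasurable (F i) μ) :
    ∫⁻ x, (∏ i ∈ S, F i x) ^ (S.card : ℝ)⁻¹ ∂μ ≤ (∏ i ∈ S, ∫⁻ x, F i x ∂μ) ^ (S.card : ℝ)⁻¹ := by
  have hp : (0 : ℝ) ≤ (S.card : ℝ)⁻¹ := by positivity
  simp_rw [← ENNReal.prod_rpow_of_nonneg hp]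
  refine ENNReal.lintegral_prod_norm_pow_le S hF ?_ fun _ _ => hp
  rw [Finset.sum_const, nsmul_eq_mul, mul_inv_cancel₀ (by exact_mod_cast hS.card_ne_zero)]

theorem tsum_prod_rpow_inv_card_le {ι : Type*} {S : Finset ι} (hS : S.Nonempty)
    (R : ι → ℤ → ℝ≥0∞) :
    ∑' k, (∏ i ∈ S, R i k) ^ (S.card : ℝ)⁻¹ ≤ (∏ i ∈ S, ∑' k, R i k) ^ (S.card : ℝ)⁻¹ := by
  simp_rw [← lintegral_count]
  exact lintegral_prod_rpow_inv_card_le hS fun i _ => Measurable.of_discrete.aemeasurable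

theorem laverage_rpow_le {X : Type*} [MeasurableSpace X] {μ : Measure X} {f : X → ℝ≥0∞}
    (hf : AEMeasurable f μ) {p : ℝ} (hp : 0 ≤ p) (hp₁ : p ≤ 1) :
    ⨍⁻ x, f x ^ p ∂μ ≤ (⨍⁻ x, f x ∂μ) ^ p := by
  have hölder := ENNReal.lintegral_mul_norm_pow_le (hf.smul_measure (μ Set.univ)⁻¹)
    (aemeasurable_const (b := (1 : ℝ≥0∞))) hp (sub_nonneg.2 hp₁) (add_sub_cancel _ _)
  simp only [ENNReal.one_rpow, mul_one, lintegral_one] at hölder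
  refine hölder.trans (mul_le_of_le_one_right' (ENNReal.rpow_le_one ?_ (sub_nonneg.2 hp₁)))
  exact ENNReal.inv_mul_le_one _

variable {V : Type*} [NormedAddCommGroup V] [NormedSpace ℝ V] [FiniteDimensional ℝ V]
  [MeasureSpace V] [BorelSpace V] [(volume : Measure V).IsAddHaarMeasure]

theorem lintegral_laverage_ball {f : V → ℝ≥0∞} (hf : Measurable f) {r : ℝ} (hr : 0 < r) :
    ∫⁻ z, ⨍⁻ x in Metric.ball z r, f x ∂volume = ∫⁻ x, f x := by
  set v := volume (Metric.ball (0 : V) r) with hv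
  have hv₀ : v ≠ 0 := (Metric.measure_ball_pos volume _ hr).ne'
  let near : Set (V × V) := {p | dist p.2 p.1 < r}
  have measurable_near : MeasurableSet near := measurableSet_lt (by fun_prop) (by fun_prop)
  have inner (z : V) : ∫⁻ x in Metric.ball z r, f x =
      ∫⁻ x, near.indicator (fun p => f p.2) (z, x) := by
    rw [← lintegral_indicator measurableSet_ball]
    rfl
  have outer (x : V) : ∫⁻ z, near.indicator (fun p => f p.2) (z, x) = f x * v := by
    rw [hv, ← Measure.addHaar_ball_center volume x, ← setLIntegral_const,
      ← lintegral_indicator measurableSet_ball]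
    refine lintegral_congr fun z => ?_
    simp only [near, Set.indicator, Metric.mem_ball, Set.mem_ofPred_eq, dist_comm]
  have measurable_integrand : Measurable (Function.uncurry fun z x =>
      near.indicator (fun p => f p.2) (z, x)) :=
    (hf.comp measurable_snd).indicator measurable_near
  simp_rw [setLAverage_eq, Measure.addHaar_ball_center, ← hv, inner, div_eq_mul_inv]
  rw [lintegral_mul_const' _ _ (ENNReal.inv_ne_top.2 hv₀),
    lintegral_lintegral_swap measurable_integrand.aemeasurable]
  simp_rw [outer]
  rw [lintegral_mul_const' _ _ measure_ball_lt_top.ne, mul_assoc,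
    ENNReal.mul_inv_cancel hv₀ measure_ball_lt_top.ne, mul_one]

theorem lintegral_rpow_inv_card_le_of_laverage_ball_le {ι : Type*} {S : Finset ι}
    (hS : S.Nonempty) {G : V → ℝ≥0∞} (hG : Measurable G) {N : ι → V → ℝ≥0∞}
    (hN : ∀ i ∈ S, Measurable (N i)) {A : ℝ≥0∞} {r : ℝ} (hr : 0 < r)
    (h : ∀ z, ⨍⁻ x in Metric.ball z r, G x ∂volume ≤ A * ∏ i ∈ S, N i z) :
    ∫⁻ x, G x ^ (S.card : ℝ)⁻¹ ≤ (A * ∏ i ∈ S, ∫⁻ z, N i z) ^ (S.card : ℝ)⁻¹ := by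
  have hp : (0 : ℝ) ≤ (S.card : ℝ)⁻¹ := by positivity
  have hp₁ : (S.card : ℝ)⁻¹ ≤ 1 := inv_le_one_of_one_le₀ (by exact_mod_cast hS.card_pos)
  rw [← lintegral_laverage_ball (hG.pow_const _) hr, ENNReal.mul_rpow_of_nonneg _ _ hp]
  calc _ ≤ ∫⁻ z, (A * ∏ i ∈ S, N i z) ^ (S.card : ℝ)⁻¹ := lintegral_mono fun z =>
        (laverage_rpow_le hG.aemeasurable hp hp₁).trans (ENNReal.rpow_le_rpow (h z) hp)
    _ = A ^ (S.card : ℝ)⁻¹ * ∫⁻ z, (∏ i ∈ S, N i z) ^ (S.card : ℝ)⁻¹ := by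
        simp_rw [ENNReal.mul_rpow_of_nonneg _ _ hp]
        exact lintegral_const_mul _ ((Finset.measurable_fun_prod _ hN).pow_const _)
    _ ≤ _ := mul_le_mul' le_rfl
        (lintegral_prod_rpow_inv_card_le hS fun i hi => (hN i hi).aemeasurable)

end Averaging

section Localization

variable {V : Type*} [NormedAddCommGroup V] [InnerProductSpace ℝ V] [FiniteDimensional ℝ V]

/-- A smooth cutoff, equal to `1` on the ball of radius `3` and supported in the ball of radius `4`,
so that an average over a dilation `t ≤ 2` at a point of a unit ball sees no change. -/
noncomputable def cutoffBump (V : Type*) [NormedAddCommGroup V] : ContDiffBump (0 : V) :=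
  ⟨3, 4, by norm_num, by norm_num⟩

/-- The cutoff `cutoffBump V`, bundled as a Schwartz function. -/
noncomputable def cutoff (V : Type*) [NormedAddCommGroup V] [InnerProductSpace ℝ V]
    [FiniteDimensional ℝ V] : SchwartzMap V ℂ :=
  HasCompactSupport.toSchwartzMap (f := fun x => ((cutoffBump V x : ℝ) : ℂ))
    ((cutoffBump V).hasCompactSupport.comp_left (g := fun r : ℝ => (r : ℂ)) Complex.ofReal_zero)
    (Complex.ofRealCLM.contDiff.comp (cutoffBump V).contDiff)

theorem cutoff_apply (x : V) : cutoff V x = ((cutoffBump V x : ℝ) : ℂ) :=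
  rfl

theorem cutoff_eq_one {x : V} (hx : ‖x‖ ≤ 3) : cutoff V x = 1 := by
  rw [cutoff_apply, (cutoffBump V).one_of_mem_closedBall (by simpa [cutoffBump] using hx),
    Complex.ofReal_one]

theorem enorm_cutoff_le (x : V) : ‖cutoff V x‖ₑ ≤ 1 := by
  rw [← ofReal_norm, cutoff_apply, Complex.norm_real, Real.norm_of_nonneg (cutoffBump V).nonneg]
  exact ENNReal.ofReal_le_one.2 (cutoffBump V).le_one

theorem cutoff_eq_zero {x : V} (hx : 4 ≤ ‖x‖) : cutoff V x = 0 := by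
  rw [cutoff_apply, (cutoffBump V).zero_of_le_dist (by simpa [cutoffBump] using hx),
    Complex.ofReal_zero]

/-- The function `f` cut off to the ball of radius `4` around `z`. -/
noncomputable def localize (z : V) (f : V → ℂ) : V → ℂ := fun x => cutoff V (x - z) * f x

theorem IsTestFunction.localize {f : V → ℂ} (hf : IsTestFunction f) (z : V) :
    IsTestFunction (localize z f) :=
  hf.mul_left (((cutoff V).smooth _).comp (contDiff_id.sub contDiff_const))

theorem exists_negSobolevSq_localize_lowPart_le (V : Type*) [NormedAddCommGroup V]
    [InnerProductSpace ℝ V] [FiniteDimensional ℝ V] [MeasurableSpace V] [BorelSpace V] :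
    ∃ K : ℝ≥0, K ≠ 0 ∧ ∀ {ε : ℝ}, 0 ≤ ε → ∀ f : V → ℂ, IsTestFunction f →
      ∀ x z : V, x ∈ Metric.ball z 1 →
        negSobolevSq ε (localize z (lowPart f)) ≤ K * hlMaximal (fun y => ‖f y‖ₑ) x ^ 2 := by
  obtain ⟨K, hK⟩ := exists_enorm_lowPart_le V 5
  set v := volume (Metric.ball (0 : V) 4)
  have hv_top : v ≠ ∞ := measure_ball_lt_top.ne
  refine ⟨K ^ 2 * v.toNNReal + 1, by positivity, fun hε f hf x z hx => ?_⟩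
  refine (negSobolevSq_schwartz_le hε (hf.lowPart.localize z).toSchwartz).trans ?_
  calc ∫⁻ y, ‖localize z (lowPart f) y‖ₑ ^ 2
      ≤ ∫⁻ y, (Metric.ball z 4).indicator
          (fun _ => (K * hlMaximal (fun y => ‖f y‖ₑ) x) ^ 2) y := by
        refine lintegral_mono fun y => ?_
        by_cases hy : y ∈ Metric.ball z 4
        · rw [Set.indicator_of_mem hy, localize, enorm_mul]
          refine pow_le_pow_left' ?_ 2
          refine (mul_le_of_le_one_left' (enorm_cutoff_le _)).trans (hK f x y ?_)
          linarith [dist_triangle_right y x z, Metric.mem_ball.1 hy, Metric.mem_ball.1 hx]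
        · have far : 4 ≤ ‖y - z‖ := by simpa [dist_eq_norm] using hy
          simp [localize, cutoff_eq_zero far]
    _ = K ^ 2 * v * hlMaximal (fun y => ‖f y‖ₑ) x ^ 2 := by
        rw [lintegral_indicator measurableSet_ball, setLIntegral_const,
          Measure.addHaar_ball_center]
        ring
    _ ≤ _ := by
        push_cast
        rw [ENNReal.coe_toNNReal hv_top]
        gcongr
        exact le_self_add

end Localization

section UnitScale

variable {m d : ℕ} {σ : Measure (ProdSpace m d)} {f : Fin m → EuclideanSpace ℝ (Fin d) → ℂ}

theorem continuous_prod_shift (hf : ∀ i, Continuous (f i)) (x : EuclideanSpace ℝ (Fin d)) (t : ℝ) :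
    Continuous fun y : ProdSpace m d => ∏ i, f i (x - t • y i) := by
  fun_prop

theorem exists_norm_prod_le (hf : ∀ i, IsTestFunction (f i)) :
    ∃ K : ℝ, ∀ z : Fin m → EuclideanSpace ℝ (Fin d), ‖∏ i, f i (z i)‖ ≤ K := by
  choose K hK using fun i => (hf i).exists_bound
  refine ⟨∏ i, K i, fun z => ?_⟩
  rw [norm_prod]
  exact Finset.prod_le_prod (fun i _ => norm_nonneg _) fun i _ => hK i _

theorem integrable_prod_shift [IsFiniteMeasure σ] (hf : ∀ i, IsTestFunction (f i))
    (x : EuclideanSpace ℝ (Fin d)) (t : ℝ) :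
    Integrable (fun y : ProdSpace m d => ∏ i, f i (x - t • y i)) σ := by
  obtain ⟨K, hK⟩ := exists_norm_prod_le hf
  exact .of_bound (continuous_prod_shift (fun i => (hf i).continuous) x t).aestronglyMeasurable K
    (.of_forall fun y => hK _)

theorem continuous_multAverage [IsFiniteMeasure σ] (hf : ∀ i, IsTestFunction (f i)) (t : ℝ) :
    Continuous fun x => multAverage σ f x t := by
  obtain ⟨K, hK⟩ := exists_norm_prod_le hf
  have hf' (i : Fin m) := (hf i).continuous
  exact continuous_of_dominated (bound := fun _ => K)
    (fun x => (continuous_prod_shift hf' x t).aestronglyMeasurable)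
    (fun x => .of_forall fun y => hK _) (integrable_const _) (.of_forall fun y => by fun_prop)

theorem measurable_unitMaximal [IsFiniteMeasure σ] (hf : ∀ i, IsTestFunction (f i)) :
    Measurable (unitMaximal σ f) :=
  (lowerSemicontinuous_biSup fun t _ =>
    (continuous_multAverage hf t).enorm.lowerSemicontinuous).measurable

/-- The functions `f i - lowPart (f i)` for `i ∈ S` and `lowPart (f i)` otherwise. -/
noncomputable def bandPiece (f : Fin m → EuclideanSpace ℝ (Fin d) → ℂ) (S : Finset (Fin m))
    (i : Fin m) : EuclideanSpace ℝ (Fin d) → ℂ :=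
  if i ∈ S then fun x => f i x - lowPart (f i) x else lowPart (f i)

theorem bandPiece_of_mem {S : Finset (Fin m)} {i : Fin m} (hi : i ∈ S) :
    bandPiece f S i = fun x => f i x - lowPart (f i) x :=
  if_pos hi

theorem bandPiece_of_notMem {S : Finset (Fin m)} {i : Fin m} (hi : i ∉ S) :
    bandPiece f S i = lowPart (f i) :=
  if_neg hi

theorem isTestFunction_bandPiece (hf : ∀ i, IsTestFunction (f i)) (S : Finset (Fin m))
    (i : Fin m) : IsTestFunction (bandPiece f S i) := by
  by_cases hi : i ∈ S
  · exact bandPiece_of_mem hi ▸ (hf i).sub (hf i).lowPart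
  · exact bandPiece_of_notMem hi ▸ (hf i).lowPart

theorem sum_prod_bandPiece (f : Fin m → EuclideanSpace ℝ (Fin d) → ℂ)
    (z : Fin m → EuclideanSpace ℝ (Fin d)) :
    ∑ S : Finset (Fin m), ∏ i, bandPiece f S i (z i) = ∏ i, f i (z i) := by
  calc _ = ∑ S : Finset (Fin m), (∏ i ∈ S, (f i (z i) - lowPart (f i) (z i))) *
        ∏ i ∈ Sᶜ, lowPart (f i) (z i) := Finset.sum_congr rfl fun S _ => by
        rw [← Finset.prod_mul_prod_compl S]
        congr 1
        · exact Finset.prod_congr rfl fun i hi => by rw [bandPiece_of_mem hi]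
        · exact Finset.prod_congr rfl fun i hi => by
            rw [bandPiece_of_notMem (Finset.mem_compl.1 hi)]
    _ = _ := by simp only [← Fintype.prod_add, sub_add_cancel]

theorem unitMaximal_le_sum_bandPiece [IsFiniteMeasure σ] (hf : ∀ i, IsTestFunction (f i))
    (x : EuclideanSpace ℝ (Fin d)) :
    unitMaximal σ f x ≤ ∑ S : Finset (Fin m), unitMaximal σ (bandPiece f S) x := by
  refine iSup₂_le fun t ht => ?_
  have split : multAverage σ f x t = ∑ S : Finset (Fin m), multAverage σ (bandPiece f S) x t := by
    simp only [multAverage]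
    rw [← integral_finsetSum _ fun S _ =>
      integrable_prod_shift (isTestFunction_bandPiece hf S) x t]
    simp only [sum_prod_bandPiece f fun i => x - t • _]
  rw [split]
  exact (enorm_sum_le _ _).trans (Finset.sum_le_sum fun S _ =>
    le_iSup₂ (f := fun t _ => ‖multAverage σ (bandPiece f S) x t‖ₑ) t ht)

/-- The product over `i ∈ S` of the Hardy–Littlewood maximal functions of the `f i`. -/
noncomputable def hlProd (S : Finset (Fin m)) (f : Fin m → EuclideanSpace ℝ (Fin d) → ℂ)
    (x : EuclideanSpace ℝ (Fin d)) : ℝ≥0∞ :=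
  ∏ i ∈ S, hlMaximal (fun y => ‖f i y‖ₑ) x

theorem measurable_hlProd (S : Finset (Fin m)) (f : Fin m → EuclideanSpace ℝ (Fin d) → ℂ) :
    Measurable (hlProd S f) :=
  Finset.measurable_fun_prod _ fun _ _ => measurable_hlMaximal _

theorem norm_smul_apply_le_two {y : ProdSpace m d} (hy : ‖y‖ ≤ 1) {t : ℝ}
    (ht : t ∈ Set.Icc (1 : ℝ) 2) (i : Fin m) : ‖t • y i‖ ≤ 2 := by
  rw [norm_smul, Real.norm_of_nonneg (zero_le_one.trans ht.1)]
  exact (mul_le_mul ht.2 ((PiLp.norm_apply_le y i).trans hy) (norm_nonneg _) zero_le_two).trans_eq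
    (mul_one 2)

theorem enorm_multAverage_le_lintegral (σ : Measure (ProdSpace m d))
    (f : Fin m → EuclideanSpace ℝ (Fin d) → ℂ) (x : EuclideanSpace ℝ (Fin d)) (t : ℝ) :
    ‖multAverage σ f x t‖ₑ ≤ ∫⁻ y, ∏ i, ‖f i (x - t • y i)‖ₑ ∂σ :=
  (enorm_integral_le_lintegral_enorm _).trans_eq (lintegral_congr fun _ => enorm_prod _ _)

theorem exists_unitMaximal_bandPiece_empty_le [IsFiniteMeasure σ] (hR : ∀ᵐ y ∂σ, ‖y‖ ≤ 1) :
    ∃ C : ℝ≥0, ∀ (f : Fin m → EuclideanSpace ℝ (Fin d) → ℂ) (x : EuclideanSpace ℝ (Fin d)),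
      unitMaximal σ (bandPiece f ∅) x ≤ C * hlProd Finset.univ f x := by
  obtain ⟨K, hK⟩ := exists_enorm_lowPart_le (EuclideanSpace ℝ (Fin d)) 2
  refine ⟨K ^ m * (σ Set.univ).toNNReal, fun f x => iSup₂_le fun t ht => ?_⟩
  calc ‖multAverage σ (bandPiece f ∅) x t‖ₑ
      ≤ ∫⁻ y, ∏ i, ‖bandPiece f ∅ i (x - t • y i)‖ₑ ∂σ := enorm_multAverage_le_lintegral _ _ _ _
    _ ≤ ∫⁻ _, ∏ i, (K * hlMaximal (fun y => ‖f i y‖ₑ) x) ∂σ := by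
        refine lintegral_mono_ae (hR.mono fun _ hy => Finset.prod_le_prod' fun i _ => ?_)
        rw [bandPiece_of_notMem (Finset.notMem_empty i)]
        refine hK _ _ _ ?_
        rw [dist_eq_norm, sub_sub_cancel_left, norm_neg]
        exact norm_smul_apply_le_two hy ht i
    _ = _ := by
        rw [lintegral_const, Finset.prod_mul_distrib, Finset.prod_const, Finset.card_univ,
          Fintype.card_fin, ENNReal.coe_mul, ENNReal.coe_toNNReal (measure_ne_top _ _),
          ENNReal.coe_pow, hlProd]
        ring

theorem unitMaximal_eq_localize (hR : ∀ᵐ y ∂σ, ‖y‖ ≤ 1)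
    (f : Fin m → EuclideanSpace ℝ (Fin d) → ℂ) {x z : EuclideanSpace ℝ (Fin d)}
    (hx : x ∈ Metric.ball z 1) :
    unitMaximal σ f x = unitMaximal σ (fun i => localize z (f i)) x := by
  refine iSup_congr fun t => iSup_congr fun ht => congrArg enorm ?_
  refine integral_congr_ae (hR.mono fun y hy => Finset.prod_congr rfl fun i _ => ?_)
  have near : ‖x - t • y i - z‖ ≤ 3 := by
    rw [sub_right_comm]
    refine (norm_sub_le _ _).trans ?_
    linarith [norm_smul_apply_le_two hy ht i, mem_ball_iff_norm.1 hx]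
  simp only [localize, cutoff_eq_one near, one_mul]

theorem inv_hlProd_sq_le {ε : ℝ} {K : ℝ≥0} (hK₀ : K ≠ 0) {S : Finset (Fin m)}
    {x z : EuclideanSpace ℝ (Fin d)} (hK : ∀ i ∈ S, negSobolevSq ε (localize z (lowPart (f i))) ≤
      K * hlMaximal (fun y => ‖f i y‖ₑ) x ^ 2) :
    (hlProd S f x)⁻¹ ^ 2 ≤
      K ^ S.card * (∏ i ∈ S, negSobolevSq ε (localize z (lowPart (f i))))⁻¹ := by
  have hL₀ : (K : ℝ≥0∞) ^ S.card ≠ 0 := pow_ne_zero _ (by exact_mod_cast hK₀)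
  have hL : (K : ℝ≥0∞) ^ S.card ≠ ∞ := by finiteness
  rw [← ENNReal.inv_pow, ← one_mul (hlProd S f x ^ 2)⁻¹, ← ENNReal.mul_inv_cancel hL₀ hL,
    mul_assoc, ← ENNReal.mul_inv (.inl hL₀) (.inl hL)]
  refine mul_le_mul' le_rfl (ENNReal.inv_le_inv.2 ?_)
  rw [hlProd, ← Finset.prod_const, ← Finset.prod_pow, ← Finset.prod_mul_distrib]
  exact Finset.prod_le_prod' hK

/-- The maximal function of the band piece `S`, squared and divided by the Hardy–Littlewood maximal
functions of its low-frequency factors. -/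
noncomputable def bandRatio (σ : Measure (ProdSpace m d)) (S : Finset (Fin m))
    (f : Fin m → EuclideanSpace ℝ (Fin d) → ℂ) (x : EuclideanSpace ℝ (Fin d)) : ℝ≥0∞ :=
  (unitMaximal σ (bandPiece f S) x / hlProd Sᶜ f x) ^ 2

theorem exists_lintegral_ball_bandRatio_le [IsFiniteMeasure σ] (hR : ∀ᵐ y ∂σ, ‖y‖ ≤ 1)
    {ε : ℝ} (hε : 0 ≤ ε) (hσ : HasUnitSmoothing σ ε) (S : Finset (Fin m)) :
    ∃ C : ℝ≥0, ∀ f : Fin m → EuclideanSpace ℝ (Fin d) → ℂ, (∀ i, IsTestFunction (f i)) → ∀ z,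
      ∫⁻ x in Metric.ball z 1, bandRatio σ S f x ≤
        C * ∏ i ∈ S, negSobolevSq ε (localize z fun x => f i x - lowPart (f i) x) := by
  obtain ⟨C, hC⟩ := hσ
  obtain ⟨K, hK₀, hK⟩ := exists_negSobolevSq_localize_lowPart_le (EuclideanSpace ℝ (Fin d))
  refine ⟨C * K ^ Sᶜ.card, fun f hf z => ?_⟩
  have hloc (i : Fin m) := (isTestFunction_bandPiece hf S i).localize z
  set low := ∏ i ∈ Sᶜ, negSobolevSq ε (localize z (lowPart (f i))) with hlow
  calc ∫⁻ x in Metric.ball z 1, bandRatio σ S f x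
      ≤ ∫⁻ x in Metric.ball z 1, unitMaximal σ (fun i => localize z (bandPiece f S i)) x ^ 2 *
          (K ^ Sᶜ.card * low⁻¹) := setLIntegral_mono' measurableSet_ball fun x hx => by
        rw [bandRatio, div_eq_mul_inv, mul_pow, unitMaximal_eq_localize hR _ hx]
        exact mul_le_mul' le_rfl
          (inv_hlProd_sq_le hK₀ fun i _ => hK hε (f i) (hf i) x z hx)
    _ = (∫⁻ x in Metric.ball z 1, unitMaximal σ (fun i => localize z (bandPiece f S i)) x ^ 2) *
          (K ^ Sᶜ.card * low⁻¹) :=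
        lintegral_mul_const _ ((measurable_unitMaximal hloc).pow_const 2)
    _ ≤ (C * ∏ i, negSobolevSq ε (localize z (bandPiece f S i))) * (K ^ Sᶜ.card * low⁻¹) :=
        mul_le_mul' ((setLIntegral_le_lintegral _ _).trans (hC fun i => (hloc i).toSchwartz)) le_rfl
    _ = C * K ^ Sᶜ.card *
          (∏ i ∈ S, negSobolevSq ε (localize z fun x => f i x - lowPart (f i) x)) *
          (low⁻¹ * low) := by
        rw [← Finset.prod_mul_prod_compl S,
          Finset.prod_congr rfl fun i hi => by rw [bandPiece_of_mem hi],
          Finset.prod_congr (s₁ := Sᶜ) rfl fun i hi => by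
            rw [bandPiece_of_notMem (Finset.mem_compl.1 hi)], ← hlow]
        ring
    _ ≤ _ := by
        push_cast
        exact mul_le_of_le_one_right' (ENNReal.inv_mul_le_one low)

theorem exists_lintegral_bandRatio_le [IsFiniteMeasure σ] (hR : ∀ᵐ y ∂σ, ‖y‖ ≤ 1) {ε : ℝ}
    (hε : 0 ≤ ε) (hσ : HasUnitSmoothing σ ε) {S : Finset (Fin m)} (hS : S.Nonempty) :
    ∃ C : ℝ≥0, ∀ f : Fin m → EuclideanSpace ℝ (Fin d) → ℂ, (∀ i, IsTestFunction (f i)) →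
      ∫⁻ x, bandRatio σ S f x ^ (S.card : ℝ)⁻¹ ≤
        (C * ∏ i ∈ S, highEnergy ε (f i)) ^ (S.card : ℝ)⁻¹ := by
  obtain ⟨C, hC⟩ := exists_lintegral_ball_bandRatio_le hR hε hσ S
  obtain ⟨C', hC'⟩ := exists_lintegral_negSobolevSq_translate_mul_le hε
    (cutoff (EuclideanSpace ℝ (Fin d)))
  set v := volume (Metric.ball (0 : EuclideanSpace ℝ (Fin d)) 1) with hv
  have hv₀ : v ≠ 0 := (Metric.measure_ball_pos volume _ one_pos).ne'
  refine ⟨v.toNNReal⁻¹ * C * C' ^ S.card, fun f hf => ?_⟩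
  have hg (i : Fin m) : IsTestFunction fun x => f i x - lowPart (f i) x :=
    (hf i).sub (hf i).lowPart
  refine (lintegral_rpow_inv_card_le_of_laverage_ball_le hS
    (((measurable_unitMaximal (isTestFunction_bandPiece hf S)).div
      (measurable_hlProd _ f)).pow_const 2) (fun i _ =>
      measurable_negSobolevSq_translate_mul ε (cutoff _).continuous (hg i).continuous)
    (A := v⁻¹ * C) one_pos fun z => ?_).trans (ENNReal.rpow_le_rpow ?_ (by positivity))
  · rw [setLAverage_eq, Measure.addHaar_ball_center, ← hv, ENNReal.div_eq_inv_mul, mul_assoc]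
    exact mul_le_mul' le_rfl (hC f hf z)
  · push_cast
    rw [ENNReal.coe_inv (by simpa [ENNReal.toNNReal_eq_zero_iff] using
        ⟨hv₀, measure_ball_lt_top.ne⟩), ENNReal.coe_toNNReal measure_ball_lt_top.ne,
      mul_assoc _ (_ ^ _), ← Finset.prod_const, ← Finset.prod_mul_distrib]
    exact mul_le_mul' le_rfl (Finset.prod_le_prod' fun i _ => (hC' (hg i).toSchwartz).trans
      (mul_le_mul' le_rfl (negSobolevSq_sub_lowPart_le (hf i) ε)))

end UnitScale

section Scales

open FourierTransform Module

section Dilation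

variable {V : Type*} [NormedAddCommGroup V] [InnerProductSpace ℝ V] [FiniteDimensional ℝ V]
  [MeasurableSpace V] [BorelSpace V] {r : ℝ}

theorem lintegral_comp_inv_smul (hr : 0 < r) (f : V → ℝ≥0∞) :
    ∫⁻ x, f (r⁻¹ • x) = ENNReal.ofReal (r ^ finrank ℝ V) * ∫⁻ x, f x := by
  have hr' : r⁻¹ ≠ 0 := (inv_pos.2 hr).ne'
  calc ∫⁻ x, f (r⁻¹ • x) = ∫⁻ x, f x ∂Measure.map (r⁻¹ • ·) volume :=
        ((Homeomorph.smulOfNeZero r⁻¹ hr').measurableEmbedding.lintegral_map f).symm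
    _ = _ := by
        rw [Measure.map_addHaar_smul volume hr', lintegral_smul_measure, inv_pow, inv_inv,
          abs_of_nonneg (by positivity), smul_eq_mul]

theorem lintegral_ball_comp_smul (hr : 0 < r) (f : V → ℝ≥0∞) (x : V) (ρ : ℝ) :
    ∫⁻ y in Metric.ball (r⁻¹ • x) ρ, f (r • y) =
      ENNReal.ofReal (r⁻¹ ^ finrank ℝ V) * ∫⁻ y in Metric.ball x (r * ρ), f y := by
  have preimage : (r • ·) ⁻¹' Metric.ball x (r * ρ) = Metric.ball (r⁻¹ • x) ρ := by
    rw [Set.preimage_smul₀ hr.ne', smul_ball (inv_pos.2 hr).ne', norm_inv,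
      Real.norm_of_nonneg hr.le, inv_mul_cancel_left₀ hr.ne']
  rw [← lintegral_indicator measurableSet_ball, ← lintegral_indicator measurableSet_ball,
    ← lintegral_comp_inv_smul (inv_pos.2 hr), inv_inv, ← preimage]
  rfl

theorem hlMaximal_comp_smul_le (hr : 0 < r) (f : V → ℝ≥0∞) (x : V) :
    hlMaximal (fun y => f (r • y)) (r⁻¹ • x) ≤ hlMaximal f x := by
  refine iSup₂_le fun ρ hρ => ?_
  set c := ENNReal.ofReal (r⁻¹ ^ finrank ℝ V)
  have hc : c ≠ 0 := (ENNReal.ofReal_pos.2 (by positivity)).ne'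
  have volume_ball : volume (Metric.ball (r⁻¹ • x) ρ) = c * volume (Metric.ball x (r * ρ)) := by
    simpa [c] using lintegral_ball_comp_smul hr 1 x ρ
  rw [lintegral_ball_comp_smul hr, volume_ball, mul_comm, ← div_eq_mul_inv,
    ENNReal.mul_div_mul_left _ _ hc ENNReal.ofReal_ne_top, div_eq_mul_inv, mul_comm]
  exact average_le_hlMaximal f x (mul_pos hr hρ)

theorem enorm_fourier_comp_smul (hr : 0 < r) (f : V → ℂ) (ξ : V) :
    ENNReal.ofReal (r ^ finrank ℝ V) * ‖𝓕 (fun x => f (r • x)) ξ‖ₑ = ‖𝓕 f (r⁻¹ • ξ)‖ₑ := by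
  have change_var : 𝓕 (fun x => f (r • x)) ξ = (r ^ finrank ℝ V)⁻¹ • 𝓕 f (r⁻¹ • ξ) := by
    have h := Measure.integral_comp_smul_of_nonneg volume
      (fun u => Real.fourierChar (-⟪u, r⁻¹ • ξ⟫) • f u) r (hR := hr.le)
    simpa only [Real.fourier_eq, real_inner_smul_left, real_inner_smul_right,
      inv_mul_cancel_left₀ hr.ne'] using h
  rw [change_var, enorm_smul, Real.enorm_eq_ofReal (by positivity), ← mul_assoc,
    ← ENNReal.ofReal_mul (by positivity), mul_inv_cancel₀ (by positivity), ENNReal.ofReal_one,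
    one_mul]

theorem highEnergy_comp_smul (hr : 0 < r) (ε : ℝ) (f : V → ℂ) :
    ENNReal.ofReal (r ^ finrank ℝ V) * highEnergy ε (fun x => f (r • x)) =
      ∫⁻ ξ, ‖𝓕 f ξ‖ₑ ^ 2 * highWeight ε (r • ξ) := by
  have h := lintegral_comp_inv_smul hr fun ξ => ‖𝓕 f ξ‖ₑ ^ 2 * highWeight ε (r • ξ)
  set c := ENNReal.ofReal (r ^ finrank ℝ V)
  have hc : c ≠ 0 := (ENNReal.ofReal_pos.2 (by positivity)).ne'
  simp only [smul_inv_smul₀ hr.ne', ← enorm_fourier_comp_smul hr, mul_pow, mul_assoc] at h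
  rw [lintegral_const_mul' _ _ (by finiteness), sq, mul_assoc] at h
  exact (ENNReal.mul_right_inj hc ENNReal.ofReal_ne_top).1 h

theorem exists_tsum_highEnergy_comp_smul_le (V : Type*) [NormedAddCommGroup V]
    [InnerProductSpace ℝ V] [FiniteDimensional ℝ V] [MeasurableSpace V] [BorelSpace V] {ε : ℝ}
    (hε : 0 < ε) :
    ∃ C : ℝ≥0, ∀ f : V → ℂ, IsTestFunction f →
      ∑' k : ℤ, ENNReal.ofReal (((2 : ℝ) ^ k) ^ finrank ℝ V) *
        highEnergy ε (fun x => f ((2 : ℝ) ^ k • x)) ≤ C * ∫⁻ x, ‖f x‖ₑ ^ 2 := by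
  obtain ⟨C, hC⟩ := exists_tsum_highWeight_le (V := V) hε
  refine ⟨C, fun f hf => ?_⟩
  have hFf : Measurable (𝓕 f) := (continuous_fourier hf.integrable).measurable
  calc _ = ∑' k : ℤ, ∫⁻ ξ, ‖𝓕 f ξ‖ₑ ^ 2 * highWeight ε ((2 : ℝ) ^ k • ξ) :=
        tsum_congr fun k => highEnergy_comp_smul (by positivity) ε f
    _ = ∫⁻ ξ, ∑' k : ℤ, ‖𝓕 f ξ‖ₑ ^ 2 * highWeight ε ((2 : ℝ) ^ k • ξ) :=
        (lintegral_tsum fun k => ((hFf.enorm.pow_const 2).mul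
          ((measurable_highWeight ε).comp (measurable_const_smul _))).aemeasurable).symm
    _ ≤ ∫⁻ ξ, C * ‖𝓕 f ξ‖ₑ ^ 2 := lintegral_mono fun ξ => by
        rw [ENNReal.tsum_mul_left, mul_comm]
        exact mul_le_mul' (hC ξ) le_rfl
    _ = C * ∫⁻ x, ‖f x‖ₑ ^ 2 := by
        rw [lintegral_const_mul _ (hFf.enorm.pow_const 2), lintegral_enorm_fourier_sq hf.integrable
          (hf.continuous.memLp_of_hasCompactSupport hf.2)]

end Dilation

variable {m d : ℕ} {σ : Measure (ProdSpace m d)} {f : Fin m → EuclideanSpace ℝ (Fin d) → ℂ}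

theorem multAverage_comp_smul (σ : Measure (ProdSpace m d))
    (f : Fin m → EuclideanSpace ℝ (Fin d) → ℂ) {r : ℝ} (hr : r ≠ 0) (x : EuclideanSpace ℝ (Fin d))
    (t : ℝ) :
    multAverage σ (fun i x => f i (r • x)) (r⁻¹ • x) t = multAverage σ f x (r * t) := by
  simp only [multAverage, smul_sub, smul_smul, mul_inv_cancel₀ hr, one_smul]

theorem multMaximal_le_iSup_unitMaximal (σ : Measure (ProdSpace m d))
    (f : Fin m → EuclideanSpace ℝ (Fin d) → ℂ) (x : EuclideanSpace ℝ (Fin d)) :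
    multMaximal σ f x ≤ ⨆ k : ℤ,
      unitMaximal σ (fun i x => f i ((2 : ℝ) ^ k • x)) (((2 : ℝ) ^ k)⁻¹ • x) := by
  refine iSup₂_le fun t ht => ?_
  obtain ⟨k, hk, hk'⟩ := exists_mem_Ico_zpow ht one_lt_two
  have h2 : (0 : ℝ) < 2 ^ k := by positivity
  rw [zpow_add_one₀ two_ne_zero] at hk'
  have unit_scale : t / 2 ^ k ∈ Set.Icc (1 : ℝ) 2 :=
    ⟨(one_le_div h2).2 hk, (div_le_iff₀ h2).2 (by linarith)⟩
  rw [← mul_div_cancel₀ t h2.ne', ← multAverage_comp_smul σ f h2.ne']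
  exact (le_iSup₂ (f := fun t _ => ‖multAverage σ (fun i x => f i ((2 : ℝ) ^ k • x))
    (((2 : ℝ) ^ k)⁻¹ • x) t‖ₑ) _ unit_scale).trans (le_iSup (fun k : ℤ =>
      unitMaximal σ (fun i x => f i ((2 : ℝ) ^ k • x)) (((2 : ℝ) ^ k)⁻¹ • x)) k)

/-- The maximal function over `t ∈ [r, 2 * r]` of the piece of `f` whose factors in `S` are
restricted to frequencies above `1 / r`, and whose other factors to those below `1 / r`. -/
noncomputable def scaleMaximal (σ : Measure (ProdSpace m d)) (S : Finset (Fin m)) (r : ℝ)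
    (f : Fin m → EuclideanSpace ℝ (Fin d) → ℂ) (x : EuclideanSpace ℝ (Fin d)) : ℝ≥0∞ :=
  unitMaximal σ (bandPiece (fun i x => f i (r • x)) S) (r⁻¹ • x)

theorem measurable_scaleMaximal [IsFiniteMeasure σ] (hf : ∀ i, IsTestFunction (f i))
    (S : Finset (Fin m)) {r : ℝ} (hr : r ≠ 0) : Measurable (scaleMaximal σ S r f) :=
  (measurable_unitMaximal (isTestFunction_bandPiece (fun i => (hf i).comp_smul hr) S)).comp
    (measurable_const_smul _)

theorem hlProd_comp_smul_le (S : Finset (Fin m)) {r : ℝ} (hr : 0 < r)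
    (f : Fin m → EuclideanSpace ℝ (Fin d) → ℂ) (x : EuclideanSpace ℝ (Fin d)) :
    hlProd S (fun i x => f i (r • x)) (r⁻¹ • x) ≤ hlProd S f x :=
  Finset.prod_le_prod' fun i _ => hlMaximal_comp_smul_le hr (fun y => ‖f i y‖ₑ) x

theorem exists_lintegral_scaleMaximal_le [IsFiniteMeasure σ] (hR : ∀ᵐ y ∂σ, ‖y‖ ≤ 1) {ε : ℝ}
    (hε : 0 ≤ ε) (hσ : HasUnitSmoothing σ ε) {S : Finset (Fin m)} (hS : S.Nonempty) :
    ∃ C : ℝ≥0, ∀ f : Fin m → EuclideanSpace ℝ (Fin d) → ℂ, (∀ i, IsTestFunction (f i)) →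
      ∀ r : ℝ, 0 < r → ∫⁻ x, ((scaleMaximal σ S r f x / hlProd Sᶜ f x) ^ 2) ^ (S.card : ℝ)⁻¹ ≤
        (C * ∏ i ∈ S, ENNReal.ofReal (r ^ d) * highEnergy ε (fun x => f i (r • x))) ^
          (S.card : ℝ)⁻¹ := by
  obtain ⟨C, hC⟩ := exists_lintegral_bandRatio_le hR hε hσ hS
  have hp : (0 : ℝ) ≤ (S.card : ℝ)⁻¹ := by positivity
  refine ⟨C, fun f hf r hr => ?_⟩
  set fr : Fin m → EuclideanSpace ℝ (Fin d) → ℂ := fun i x => f i (r • x)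
  calc ∫⁻ x, ((scaleMaximal σ S r f x / hlProd Sᶜ f x) ^ 2) ^ (S.card : ℝ)⁻¹
      ≤ ∫⁻ x, bandRatio σ S fr (r⁻¹ • x) ^ (S.card : ℝ)⁻¹ :=
        lintegral_mono fun x => ENNReal.rpow_le_rpow (pow_le_pow_left' (ENNReal.div_le_div_left
          (hlProd_comp_smul_le _ hr f x) _) 2) hp
    _ = ENNReal.ofReal (r ^ d) * ∫⁻ x, bandRatio σ S fr x ^ (S.card : ℝ)⁻¹ := by
        rw [lintegral_comp_inv_smul hr fun x => bandRatio σ S fr x ^ (S.card : ℝ)⁻¹,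
          finrank_euclideanSpace_fin]
    _ ≤ (ENNReal.ofReal (r ^ d) ^ S.card) ^ (S.card : ℝ)⁻¹ *
          (C * ∏ i ∈ S, highEnergy ε (fr i)) ^ (S.card : ℝ)⁻¹ := by
        rw [ENNReal.pow_rpow_inv_natCast hS.card_ne_zero]
        exact mul_le_mul' le_rfl (hC fr fun i => (hf i).comp_smul hr.ne')
    _ = _ := by
        rw [← ENNReal.mul_rpow_of_nonneg _ _ hp, Finset.prod_mul_distrib, Finset.prod_const,
          mul_left_comm]

theorem exists_tsum_lintegral_scaleMaximal_le [IsFiniteMeasure σ] (hR : ∀ᵐ y ∂σ, ‖y‖ ≤ 1) {ε : ℝ}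
    (hε : 0 < ε) (hσ : HasUnitSmoothing σ ε) {S : Finset (Fin m)} (hS : S.Nonempty) :
    ∃ C : ℝ≥0, ∀ f : Fin m → EuclideanSpace ℝ (Fin d) → ℂ, (∀ i, IsTestFunction (f i)) →
      ∑' k : ℤ, ∫⁻ x, ((scaleMaximal σ S (2 ^ k) f x / hlProd Sᶜ f x) ^ 2) ^ (S.card : ℝ)⁻¹ ≤
        (C * ∏ i ∈ S, ∫⁻ x, ‖f i x‖ₑ ^ 2) ^ (S.card : ℝ)⁻¹ := by
  obtain ⟨C, hC⟩ := exists_lintegral_scaleMaximal_le hR hε.le hσ hS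
  obtain ⟨K, hK⟩ := exists_tsum_highEnergy_comp_smul_le (EuclideanSpace ℝ (Fin d)) hε
  simp only [finrank_euclideanSpace_fin] at hK
  have hp : (0 : ℝ) ≤ (S.card : ℝ)⁻¹ := by positivity
  refine ⟨C * K ^ S.card, fun f hf => ?_⟩
  set energy : Fin m → ℤ → ℝ≥0∞ := fun i k => ENNReal.ofReal (((2 : ℝ) ^ k) ^ d) *
    highEnergy ε fun x => f i ((2 : ℝ) ^ k • x)
  calc _ ≤ ∑' k : ℤ, (C * ∏ i ∈ S, energy i k) ^ (S.card : ℝ)⁻¹ :=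
        ENNReal.tsum_le_tsum fun k => hC f hf _ (by positivity)
    _ = C ^ (S.card : ℝ)⁻¹ * ∑' k : ℤ, (∏ i ∈ S, energy i k) ^ (S.card : ℝ)⁻¹ := by
        rw [← ENNReal.tsum_mul_left]
        exact tsum_congr fun k => ENNReal.mul_rpow_of_nonneg _ _ hp
    _ ≤ C ^ (S.card : ℝ)⁻¹ * (∏ i ∈ S, ∑' k : ℤ, energy i k) ^ (S.card : ℝ)⁻¹ :=
        mul_le_mul' le_rfl (tsum_prod_rpow_inv_card_le hS energy)
    _ ≤ C ^ (S.card : ℝ)⁻¹ * (∏ i ∈ S, K * ∫⁻ x, ‖f i x‖ₑ ^ 2) ^ (S.card : ℝ)⁻¹ :=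
        mul_le_mul' le_rfl (ENNReal.rpow_le_rpow (Finset.prod_le_prod' fun i _ =>
          hK (f i) (hf i)) hp)
    _ = _ := by
        rw [← ENNReal.mul_rpow_of_nonneg _ _ hp, Finset.prod_mul_distrib, Finset.prod_const]
        push_cast
        ring_nf

end Scales

section TestFunctions

section Hoelder

variable {ι : Type*}

theorem sum_rpow_le_card_rpow_mul_sum_rpow (s : Finset ι) (a : ι → ℝ≥0∞) {p : ℝ} (hp : 0 < p) :
    (∑ i ∈ s, a i) ^ p ≤ (s.card : ℝ≥0∞) ^ p * ∑ i ∈ s, a i ^ p := by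
  rcases s.eq_empty_or_nonempty with rfl | hs
  · simp [hp]
  obtain ⟨j, hj, hmax⟩ := s.exists_max_image a hs
  calc (∑ i ∈ s, a i) ^ p ≤ (s.card * a j) ^ p := by
        rw [← nsmul_eq_mul]
        exact ENNReal.rpow_le_rpow (Finset.sum_le_card_nsmul s a _ hmax) hp.le
    _ ≤ _ := by
        rw [ENNReal.mul_rpow_of_nonneg _ _ hp.le]
        exact mul_le_mul' le_rfl (Finset.single_le_sum (f := fun i => a i ^ p)
          (fun _ _ => zero_le) hj)

theorem lintegral_pow_card_mul_prod_compl_rpow_le [Fintype ι] [DecidableEq ι] {X : Type*}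
    [MeasurableSpace X] {μ : Measure X} {S : Finset ι} (hS : S.Nonempty) {G : X → ℝ≥0∞}
    (hG : AEMeasurable G μ) {F : ι → X → ℝ≥0∞} (hF : ∀ i, AEMeasurable (F i) μ) :
    ∫⁻ x, (G x ^ S.card * ∏ i ∈ Sᶜ, F i x) ^ (Fintype.card ι : ℝ)⁻¹ ∂μ ≤
      ((∫⁻ x, G x ∂μ) ^ S.card * ∏ i ∈ Sᶜ, ∫⁻ x, F i x ∂μ) ^ (Fintype.card ι : ℝ)⁻¹ := by
  have split (g : ℝ≥0∞) (f : ι → ℝ≥0∞) :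
      g ^ S.card * ∏ i ∈ Sᶜ, f i = ∏ i, if i ∈ S then g else f i := by
    rw [← Finset.prod_mul_prod_compl S]
    congr 1
    · rw [Finset.prod_congr rfl fun i hi => if_pos hi, Finset.prod_const]
    · exact Finset.prod_congr rfl fun i hi => (if_neg (Finset.mem_compl.1 hi)).symm
  simp only [split]
  convert! lintegral_prod_rpow_inv_card_le (hS.mono S.subset_univ)
    (F := fun i x => if i ∈ S then G x else F i x) (μ := μ) fun i _ => ?_ using 4 with i
  · split_ifs <;> rfl
  · split_ifs
    exacts [hG, hF i]

end Hoelder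

section HardyLittlewood

variable {V : Type*} [NormedAddCommGroup V] [InnerProductSpace ℝ V] [FiniteDimensional ℝ V]
  [MeasurableSpace V] [BorelSpace V]

theorem hlMaximal_ne_zero {f : V → ℝ≥0∞} (hf : Continuous f) (h₀ : f ≠ 0) (x : V) :
    hlMaximal f x ≠ 0 := by
  obtain ⟨y, hy⟩ := Function.ne_iff.1 h₀
  have hr : 0 < dist y x + 1 := by positivity
  have pos : 0 < ∫⁻ u in Metric.ball x (dist y x + 1), f u :=
    (setLIntegral_pos_iff hf.measurable).2
      ((hf.isOpen_support.inter Metric.isOpen_ball).measure_pos volume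
        ⟨y, hy, lt_add_one (dist y x)⟩)
  intro h
  simpa [h] using pos.trans_le (lintegral_ball_le_hlMaximal f x hr)

namespace IsTestFunction

variable {f : V → ℂ}

theorem hlMaximal_ne_top (hf : IsTestFunction f) (x : V) :
    hlMaximal (fun y => ‖f y‖ₑ) x ≠ ∞ := by
  obtain ⟨K, hK⟩ := hf.exists_enorm_le
  exact ((hlMaximal_le_of_le_const hK x).trans_lt ENNReal.coe_lt_top).ne

theorem lintegral_hlMaximal_sq_le (hf : IsTestFunction f) :
    ∫⁻ x, hlMaximal (fun y => ‖f y‖ₑ) x ^ 2 ≤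
      8 * 4 ^ Module.finrank ℝ V * ∫⁻ x, ‖f x‖ₑ ^ 2 := by
  obtain ⟨K, hK⟩ := hf.exists_enorm_le
  exact _root_.lintegral_hlMaximal_sq_le hf.continuous.enorm.measurable ENNReal.coe_ne_top hK

end IsTestFunction

end HardyLittlewood

variable {m d : ℕ} {σ : Measure (ProdSpace m d)} {f : Fin m → EuclideanSpace ℝ (Fin d) → ℂ}

/-- The part of the maximal function where exactly the variables in `S` carry frequencies above
the reciprocal of the scale of the average. -/
noncomputable def bandMaximal (σ : Measure (ProdSpace m d)) (S : Finset (Fin m))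
    (f : Fin m → EuclideanSpace ℝ (Fin d) → ℂ) (x : EuclideanSpace ℝ (Fin d)) : ℝ≥0∞ :=
  ⨆ k : ℤ, scaleMaximal σ S (2 ^ k) f x

theorem measurable_bandMaximal [IsFiniteMeasure σ] (hf : ∀ i, IsTestFunction (f i))
    (S : Finset (Fin m)) : Measurable (bandMaximal σ S f) :=
  .iSup fun _ => measurable_scaleMaximal hf S (by positivity)

theorem multMaximal_le_sum_bandMaximal [IsFiniteMeasure σ] (hf : ∀ i, IsTestFunction (f i))
    (x : EuclideanSpace ℝ (Fin d)) :
    multMaximal σ f x ≤ ∑ S : Finset (Fin m), bandMaximal σ S f x :=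
  (multMaximal_le_iSup_unitMaximal σ f x).trans <| iSup_le fun k =>
    (unitMaximal_le_sum_bandPiece (fun i => (hf i).comp_smul (by positivity)) _).trans <|
      Finset.sum_le_sum fun S _ => le_iSup (fun k : ℤ => scaleMaximal σ S (2 ^ k) f x) k

theorem prod_lintegral_hlMaximal_sq_le (S : Finset (Fin m)) (hf : ∀ i, IsTestFunction (f i)) :
    ∏ i ∈ S, ∫⁻ x, hlMaximal (fun y => ‖f i y‖ₑ) x ^ 2 ≤
      (8 * 4 ^ d) ^ S.card * ∏ i ∈ S, ∫⁻ x, ‖f i x‖ₑ ^ 2 := by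
  rw [← Finset.prod_const, ← Finset.prod_mul_distrib]
  refine Finset.prod_le_prod' fun i _ => ?_
  simpa only [finrank_euclideanSpace_fin] using (hf i).lintegral_hlMaximal_sq_le

theorem exists_lintegral_bandMaximal_empty_le [IsFiniteMeasure σ] (hm : m ≠ 0)
    (hR : ∀ᵐ y ∂σ, ‖y‖ ≤ 1) :
    ∃ C : ℝ≥0, ∀ f : Fin m → EuclideanSpace ℝ (Fin d) → ℂ, (∀ i, IsTestFunction (f i)) →
      ∫⁻ x, (bandMaximal σ ∅ f x ^ 2) ^ (m : ℝ)⁻¹ ≤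
        (C * ∏ i, ∫⁻ x, ‖f i x‖ₑ ^ 2) ^ (m : ℝ)⁻¹ := by
  obtain ⟨K, hK⟩ := exists_unitMaximal_bandPiece_empty_le hR
  have hp : (0 : ℝ) ≤ (m : ℝ)⁻¹ := by positivity
  have : NeZero m := ⟨hm⟩
  refine ⟨K ^ 2 * (8 * 4 ^ d) ^ m, fun f hf => ?_⟩
  have hM (i : Fin m) : Measurable fun x => hlMaximal (fun y => ‖f i y‖ₑ) x ^ 2 :=
    (measurable_hlMaximal _).pow_const 2
  have band_le (x : EuclideanSpace ℝ (Fin d)) :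
      bandMaximal σ ∅ f x ≤ K * hlProd Finset.univ f x :=
    iSup_le fun k => (hK _ _).trans
      (mul_le_mul' le_rfl (hlProd_comp_smul_le _ (by positivity) f x))
  calc ∫⁻ x, (bandMaximal σ ∅ f x ^ 2) ^ (m : ℝ)⁻¹
      ≤ ∫⁻ x, ((K : ℝ≥0∞) ^ 2) ^ (m : ℝ)⁻¹ *
          (∏ i, hlMaximal (fun y => ‖f i y‖ₑ) x ^ 2) ^ (m : ℝ)⁻¹ := lintegral_mono fun x => by
        rw [← ENNReal.mul_rpow_of_nonneg _ _ hp, Finset.prod_pow, ← mul_pow]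
        exact ENNReal.rpow_le_rpow (pow_le_pow_left' (band_le x) 2) hp
    _ = ((K : ℝ≥0∞) ^ 2) ^ (m : ℝ)⁻¹ *
          ∫⁻ x, (∏ i, hlMaximal (fun y => ‖f i y‖ₑ) x ^ 2) ^ (m : ℝ)⁻¹ :=
        lintegral_const_mul _ ((Finset.measurable_fun_prod _ fun i _ => hM i).pow_const _)
    _ ≤ ((K : ℝ≥0∞) ^ 2) ^ (m : ℝ)⁻¹ *
          (∏ i, ∫⁻ x, hlMaximal (fun y => ‖f i y‖ₑ) x ^ 2) ^ (m : ℝ)⁻¹ := by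
        have h := lintegral_prod_rpow_inv_card_le (Finset.univ_nonempty (α := Fin m))
          fun i _ => (hM i).aemeasurable (μ := volume)
        rw [Finset.card_fin] at h
        exact mul_le_mul' le_rfl h
    _ ≤ _ := by
        rw [← ENNReal.mul_rpow_of_nonneg _ _ hp]
        push_cast
        rw [mul_assoc]
        refine ENNReal.rpow_le_rpow (mul_le_mul' le_rfl ?_) hp
        simpa only [Finset.card_fin] using prod_lintegral_hlMaximal_sq_le Finset.univ hf

theorem lintegral_bandMaximal_div_le_tsum [IsFiniteMeasure σ] (hf : ∀ i, IsTestFunction (f i))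
    {S : Finset (Fin m)} (hS : S.Nonempty) :
    ∫⁻ x, ((bandMaximal σ S f x / hlProd Sᶜ f x) ^ 2) ^ (S.card : ℝ)⁻¹ ≤
      ∑' k : ℤ, ∫⁻ x, ((scaleMaximal σ S (2 ^ k) f x / hlProd Sᶜ f x) ^ 2) ^ (S.card : ℝ)⁻¹ := by
  have hcard : (0 : ℝ) < S.card := by exact_mod_cast hS.card_pos
  have scale_measurable (k : ℤ) : Measurable fun x =>
      ((scaleMaximal σ S (2 ^ k) f x / hlProd Sᶜ f x) ^ 2) ^ (S.card : ℝ)⁻¹ :=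
    (((measurable_scaleMaximal hf S (by positivity)).div
      (measurable_hlProd _ f)).pow_const 2).pow_const _
  rw [← lintegral_tsum fun k => (scale_measurable k).aemeasurable]
  refine lintegral_mono fun x => ?_
  rw [ENNReal.rpow_inv_le_iff hcard, bandMaximal, ENNReal.iSup_div, ENNReal.iSup_pow]
  exact iSup_le fun k => (ENNReal.rpow_inv_le_iff hcard).1 (ENNReal.le_tsum k)

theorem hlProd_ne_zero (hf : ∀ i, IsTestFunction (f i)) (h₀ : ∀ i, f i ≠ 0) (S : Finset (Fin m))
    (x : EuclideanSpace ℝ (Fin d)) : hlProd S f x ≠ 0 :=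
  Finset.prod_ne_zero_iff.2 fun i _ => hlMaximal_ne_zero (hf i).continuous.enorm
    (fun h => h₀ i (funext fun y => enorm_eq_zero.1 (congrFun h y))) x

theorem hlProd_ne_top (hf : ∀ i, IsTestFunction (f i)) (S : Finset (Fin m))
    (x : EuclideanSpace ℝ (Fin d)) : hlProd S f x ≠ ∞ :=
  ENNReal.prod_ne_top fun i _ => (hf i).hlMaximal_ne_top x

theorem exists_lintegral_bandMaximal_le_of_nonempty [IsFiniteMeasure σ]
    (hR : ∀ᵐ y ∂σ, ‖y‖ ≤ 1) {ε : ℝ} (hε : 0 < ε) (hσ : HasUnitSmoothing σ ε)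
    {S : Finset (Fin m)} (hS : S.Nonempty) :
    ∃ C : ℝ≥0, ∀ f : Fin m → EuclideanSpace ℝ (Fin d) → ℂ, (∀ i, IsTestFunction (f i)) →
      (∀ i, f i ≠ 0) →
      ∫⁻ x, (bandMaximal σ S f x ^ 2) ^ (m : ℝ)⁻¹ ≤
        (C * ∏ i, ∫⁻ x, ‖f i x‖ₑ ^ 2) ^ (m : ℝ)⁻¹ := by
  obtain ⟨C, hC⟩ := exists_tsum_lintegral_scaleMaximal_le hR hε hσ hS
  have hp : (0 : ℝ) ≤ (m : ℝ)⁻¹ := by positivity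
  refine ⟨C * (8 * 4 ^ d) ^ Sᶜ.card, fun f hf h₀ => ?_⟩
  set Y : EuclideanSpace ℝ (Fin d) → ℝ≥0∞ :=
    fun x => ((bandMaximal σ S f x / hlProd Sᶜ f x) ^ 2) ^ (S.card : ℝ)⁻¹ with hY
  have hYm : Measurable Y :=
    (((measurable_bandMaximal hf S).div (measurable_hlProd _ f)).pow_const 2).pow_const _
  have factor (x : EuclideanSpace ℝ (Fin d)) : bandMaximal σ S f x ^ 2 =
      Y x ^ S.card * ∏ i ∈ Sᶜ, hlMaximal (fun y => ‖f i y‖ₑ) x ^ 2 := by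
    rw [hY, ENNReal.rpow_inv_natCast_pow hS.card_ne_zero, Finset.prod_pow, ← hlProd, ← mul_pow,
      ENNReal.div_mul_cancel (hlProd_ne_zero hf h₀ _ x) (hlProd_ne_top hf _ x)]
  have lintegral_Y_pow : (∫⁻ x, Y x) ^ S.card ≤ C * ∏ i ∈ S, ∫⁻ x, ‖f i x‖ₑ ^ 2 :=
    (pow_le_pow_left' ((lintegral_bandMaximal_div_le_tsum hf hS).trans (hC f hf)) _).trans_eq
      (ENNReal.rpow_inv_natCast_pow hS.card_ne_zero _)
  have hoelder := lintegral_pow_card_mul_prod_compl_rpow_le hS hYm.aemeasurable (μ := volume)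
    fun i => ((measurable_hlMaximal fun y => ‖f i y‖ₑ).pow_const 2).aemeasurable
  simp only [Fintype.card_fin, ← factor] at hoelder
  refine hoelder.trans (ENNReal.rpow_le_rpow ?_ hp)
  calc _ ≤ (C * ∏ i ∈ S, ∫⁻ x, ‖f i x‖ₑ ^ 2) *
        ((8 * 4 ^ d) ^ Sᶜ.card * ∏ i ∈ Sᶜ, ∫⁻ x, ‖f i x‖ₑ ^ 2) :=
        mul_le_mul' lintegral_Y_pow (prod_lintegral_hlMaximal_sq_le Sᶜ hf)
    _ = _ := by
        rw [← Finset.prod_mul_prod_compl S]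
        push_cast
        ring

theorem exists_lintegral_bandMaximal_le [IsFiniteMeasure σ] (hm : m ≠ 0)
    (hR : ∀ᵐ y ∂σ, ‖y‖ ≤ 1) {ε : ℝ} (hε : 0 < ε) (hσ : HasUnitSmoothing σ ε)
    (S : Finset (Fin m)) :
    ∃ C : ℝ≥0, ∀ f : Fin m → EuclideanSpace ℝ (Fin d) → ℂ, (∀ i, IsTestFunction (f i)) →
      (∀ i, f i ≠ 0) →
      ∫⁻ x, (bandMaximal σ S f x ^ 2) ^ (m : ℝ)⁻¹ ≤
        (C * ∏ i, ∫⁻ x, ‖f i x‖ₑ ^ 2) ^ (m : ℝ)⁻¹ := by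
  rcases S.eq_empty_or_nonempty with rfl | hS
  · exact (exists_lintegral_bandMaximal_empty_le hm hR).imp fun C hC f hf _ => hC f hf
  · exact exists_lintegral_bandMaximal_le_of_nonempty hR hε hσ hS

theorem multMaximal_eq_zero {i : Fin m} (hi : f i = 0) (x : EuclideanSpace ℝ (Fin d)) :
    multMaximal σ f x = 0 := by
  have vanish (y : Fin m → EuclideanSpace ℝ (Fin d)) : ∏ j, f j (y j) = 0 :=
    Finset.prod_eq_zero (Finset.mem_univ i) (by simp [hi])
  simp [multMaximal, multAverage, vanish fun i => x - _ • _]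

/-- The maximal inequality from `L² × ⋯ × L²` to `L^{2/m}` for test functions, with both sides
raised to the power `2 / m`. -/
def HasTestFunctionBound (σ : Measure (ProdSpace m d)) (C : ℝ≥0) : Prop :=
  ∀ f : Fin m → EuclideanSpace ℝ (Fin d) → ℂ, (∀ i, IsTestFunction (f i)) →
    ∫⁻ x, (multMaximal σ f x ^ 2) ^ (m : ℝ)⁻¹ ≤ C * (∏ i, ∫⁻ x, ‖f i x‖ₑ ^ 2) ^ (m : ℝ)⁻¹

theorem exists_hasTestFunctionBound [IsFiniteMeasure σ] (hm : m ≠ 0)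
    (hR : ∀ᵐ y ∂σ, ‖y‖ ≤ 1) {ε : ℝ} (hε : 0 < ε) (hσ : HasUnitSmoothing σ ε) :
    ∃ C : ℝ≥0, HasTestFunctionBound σ C := by
  choose C hC using exists_lintegral_bandMaximal_le hm hR hε hσ
  have hp : (0 : ℝ) < (m : ℝ)⁻¹ := by positivity
  set N : ℕ := (Finset.univ : Finset (Finset (Fin m))).card
  refine ⟨(N ^ 2) ^ (m : ℝ)⁻¹ * ∑ S, C S ^ (m : ℝ)⁻¹, fun f hf => ?_⟩
  by_cases h₀ : ∃ i, f i = 0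
  · obtain ⟨i, hi⟩ := h₀
    simp [multMaximal_eq_zero hi, hp]
  push Not at h₀
  have sq_rpow (a : ℝ≥0∞) : (a ^ 2) ^ (m : ℝ)⁻¹ = a ^ (2 * (m : ℝ)⁻¹) := by
    rw [ENNReal.rpow_mul, ENNReal.rpow_two]
  calc ∫⁻ x, (multMaximal σ f x ^ 2) ^ (m : ℝ)⁻¹
      ≤ ∫⁻ x, ((N : ℝ≥0∞) ^ 2) ^ (m : ℝ)⁻¹ *
          ∑ S : Finset (Fin m), (bandMaximal σ S f x ^ 2) ^ (m : ℝ)⁻¹ := by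
        refine lintegral_mono fun x => ?_
        simp only [sq_rpow]
        exact (ENNReal.rpow_le_rpow (multMaximal_le_sum_bandMaximal hf x) (by positivity)).trans
          (sum_rpow_le_card_rpow_mul_sum_rpow _ _ (by positivity))
    _ = ((N : ℝ≥0∞) ^ 2) ^ (m : ℝ)⁻¹ *
          ∑ S : Finset (Fin m), ∫⁻ x, (bandMaximal σ S f x ^ 2) ^ (m : ℝ)⁻¹ := by
        have hB (S : Finset (Fin m)) :=
          ((measurable_bandMaximal (σ := σ) hf S).pow_const 2).pow_const (m : ℝ)⁻¹
        rw [lintegral_const_mul _ (Finset.measurable_fun_sum _ fun S _ => hB S),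
          lintegral_finsetSum _ fun S _ => hB S]
    _ ≤ ((N : ℝ≥0∞) ^ 2) ^ (m : ℝ)⁻¹ *
          ∑ S, (C S * ∏ i, ∫⁻ x, ‖f i x‖ₑ ^ 2) ^ (m : ℝ)⁻¹ :=
        mul_le_mul' le_rfl (Finset.sum_le_sum fun S _ => hC S f hf h₀)
    _ = _ := by
        simp only [ENNReal.mul_rpow_of_nonneg _ _ hp.le, ← Finset.sum_mul, ENNReal.coe_mul,
          ENNReal.ofNNReal_finsetSum, ENNReal.coe_rpow_of_nonneg _ hp.le, ENNReal.coe_pow,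
          ENNReal.coe_natCast, mul_assoc]

end TestFunctions

section Mollification

open Filter Topology ContinuousLinearMap
open scoped Convolution

variable {V : Type*} [NormedAddCommGroup V]

/-- Truncation of a function at height `n` and to the ball of radius `n`. -/
noncomputable def heightTrunc (n : ℕ) (g : V → ℝ≥0∞) : V → ℝ≥0∞ :=
  (Metric.ball 0 n).indicator fun z => min (g z) n

theorem heightTrunc_le_natCast (n : ℕ) (g : V → ℝ≥0∞) (z : V) : heightTrunc n g z ≤ n :=
  Set.indicator_apply_le' (fun _ => min_le_right _ _) fun _ => zero_le

theorem heightTrunc_ne_top (n : ℕ) (g : V → ℝ≥0∞) (z : V) : heightTrunc n g z ≠ ∞ :=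
  ((heightTrunc_le_natCast n g z).trans_lt (ENNReal.natCast_lt_top n)).ne

theorem heightTrunc_le (n : ℕ) (g : V → ℝ≥0∞) (z : V) : heightTrunc n g z ≤ g z :=
  Set.indicator_apply_le' (fun _ => min_le_left _ _) fun _ => zero_le

variable [MeasurableSpace V] [BorelSpace V]

theorem measurable_heightTrunc {g : V → ℝ≥0∞} (hg : Measurable g) (n : ℕ) :
    Measurable (heightTrunc n g) :=
  (hg.min measurable_const).indicator measurableSet_ball

variable [InnerProductSpace ℝ V] [FiniteDimensional ℝ V]

/-- Smooth bump functions shrinking to the origin as `n → ∞`. -/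
noncomputable def shrinkingBump (V : Type*) [NormedAddCommGroup V] (n : ℕ) :
    ContDiffBump (0 : V) :=
  ⟨1 / (n + 1) / 2, 1 / (n + 1), by positivity, half_lt_self (by positivity)⟩

/-- The probability measure whose density is the normalized shrinking bump; integrating `f (x - y)`
against it in `y` mollifies `f`. -/
noncomputable def mollifierMeasure (V : Type*) [NormedAddCommGroup V] [InnerProductSpace ℝ V]
    [MeasurableSpace V] [BorelSpace V] [FiniteDimensional ℝ V] (n : ℕ) : Measure V :=
  volume.withDensity fun y => ENNReal.ofReal ((shrinkingBump V n).normed volume y)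

theorem measurable_ofReal_shrinkingBump (n : ℕ) :
    Measurable fun y : V => ENNReal.ofReal ((shrinkingBump V n).normed volume y) :=
  (shrinkingBump V n).continuous_normed.measurable.ennreal_ofReal

instance (n : ℕ) : IsProbabilityMeasure (mollifierMeasure V n) where
  measure_univ := by
    rw [mollifierMeasure, withDensity_apply _ .univ, Measure.restrict_univ,
      ← ofReal_integral_eq_lintegral_ofReal (shrinkingBump V n).integrable_normed
        (.of_forall fun y => (shrinkingBump V n).nonneg_normed y),
      (shrinkingBump V n).integral_normed, ENNReal.ofReal_one]

theorem ae_mollifierMeasure_norm_lt (n : ℕ) :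
    ∀ᵐ y ∂mollifierMeasure V n, ‖y‖ < 1 / ((n : ℝ) + 1) := by
  refine (ae_withDensity_iff (measurable_ofReal_shrinkingBump n)).2 (.of_forall fun y hy => ?_)
  have hsupp : y ∈ Function.support ((shrinkingBump V n).normed volume) :=
    fun h => hy (by rw [h, ENNReal.ofReal_zero])
  rw [(shrinkingBump V n).support_normed_eq, mem_ball_zero_iff] at hsupp
  exact hsupp

/-- The mollification at scale `1 / (n + 1)` of the truncation of `g`; the limit inferior of these
test functions dominates `g` when `g` is lower semicontinuous. -/
noncomputable def smoothTrunc (n : ℕ) (g : V → ℝ≥0∞) (x : V) : ℝ≥0∞ :=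
  ∫⁻ y, heightTrunc n g (x - y) ∂mollifierMeasure V n

theorem smoothTrunc_ne_top (n : ℕ) (g : V → ℝ≥0∞) (x : V) : smoothTrunc n g x ≠ ∞ := by
  have bound : smoothTrunc n g x ≤ ∫⁻ _, n ∂mollifierMeasure V n :=
    lintegral_mono fun y => heightTrunc_le_natCast n g (x - y)
  rw [lintegral_const, measure_univ, mul_one] at bound
  exact (bound.trans_lt (ENNReal.natCast_lt_top n)).ne

theorem ofReal_toReal_smoothTrunc_eq_convolution {g : V → ℝ≥0∞} (hg : Measurable g) (n : ℕ)
    (x : V) : ((smoothTrunc n g x).toReal : ℂ) = ((shrinkingBump V n).normed volume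
      ⋆[lsmul ℝ ℝ, volume] fun z => ((heightTrunc n g z).toReal : ℂ)) x := by
  have measurable_shift : Measurable fun y => heightTrunc n g (x - y) :=
    (measurable_heightTrunc hg n).comp (by fun_prop)
  rw [smoothTrunc, ← integral_toReal measurable_shift.aemeasurable
    (.of_forall fun y => (heightTrunc_ne_top n g _).lt_top), ← integral_complex_ofReal,
    mollifierMeasure, integral_withDensity_eq_integral_toReal_smul
      (measurable_ofReal_shrinkingBump n) (.of_forall fun _ => ENNReal.ofReal_lt_top), convolution]
  refine integral_congr_ae (.of_forall fun y => ?_)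
  dsimp only
  rw [ENNReal.toReal_ofReal ((shrinkingBump V n).nonneg_normed y), lsmul_apply]

theorem isTestFunction_smoothTrunc {g : V → ℝ≥0∞} (hg : Measurable g) (n : ℕ) :
    IsTestFunction fun x => ((smoothTrunc n g x).toReal : ℂ) := by
  set τ : V → ℂ := fun z => ((heightTrunc n g z).toReal : ℝ) with hτ
  have measurable_τ : Measurable τ :=
    Complex.measurable_ofReal.comp (measurable_heightTrunc hg n).ennreal_toReal
  have compactSupport_τ : HasCompactSupport τ := by
    refine HasCompactSupport.intro (isCompact_closedBall 0 (n : ℝ)) fun z hz => ?_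
    have : z ∉ Metric.ball 0 (n : ℝ) := fun h => hz (Metric.ball_subset_closedBall h)
    simp [hτ, heightTrunc, this]
  have norm_τ_le (z : V) : ‖τ z‖ ≤ n := by
    rw [hτ, Complex.norm_real, Real.norm_of_nonneg ENNReal.toReal_nonneg]
    simpa using ENNReal.toReal_mono (ENNReal.natCast_ne_top n) (heightTrunc_le_natCast n g z)
  have locallyIntegrable_τ : LocallyIntegrable τ :=
    (locallyIntegrable_const (n : ℝ)).mono measurable_τ.aestronglyMeasurable
      (.of_forall fun z => by simpa using norm_τ_le z)
  rw [funext (ofReal_toReal_smoothTrunc_eq_convolution hg n)]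
  exact ⟨(shrinkingBump V n).hasCompactSupport_normed.contDiff_convolution_left _
    (shrinkingBump V n).contDiff_normed locallyIntegrable_τ,
    (shrinkingBump V n).hasCompactSupport_normed.convolution _ compactSupport_τ⟩

theorem enorm_ofReal_toReal_smoothTrunc (n : ℕ) (g : V → ℝ≥0∞) (x : V) :
    ‖((smoothTrunc n g x).toReal : ℂ)‖ₑ = smoothTrunc n g x := by
  rw [← ofReal_norm, Complex.norm_real, Real.norm_of_nonneg ENNReal.toReal_nonneg,
    ENNReal.ofReal_toReal (smoothTrunc_ne_top n g x)]

theorem measurable_smoothTrunc {g : V → ℝ≥0∞} (hg : Measurable g) (n : ℕ) :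
    Measurable (smoothTrunc n g) := by
  simpa only [enorm_ofReal_toReal_smoothTrunc] using
    (isTestFunction_smoothTrunc hg n).continuous.enorm.measurable

theorem le_liminf_smoothTrunc {g : V → ℝ≥0∞} (hg : LowerSemicontinuous g) (x : V) :
    g x ≤ liminf (fun n => smoothTrunc n g x) atTop := by
  refine le_of_forall_lt_imp_le_of_dense fun c hc => le_liminf_of_le (by isBoundedDefault) ?_
  obtain ⟨δ, hδ, lt_near⟩ := Metric.eventually_nhds_iff.1 (hg x c hc)
  obtain ⟨N₁, hN₁⟩ := ENNReal.exists_nat_gt hc.ne_top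
  obtain ⟨N₂, hN₂⟩ := exists_nat_gt (‖x‖ + 1)
  have radius_lt : ∀ᶠ n : ℕ in atTop, 1 / ((n : ℝ) + 1) < δ :=
    tendsto_one_div_add_atTop_nhds_zero_nat.eventually_lt_const hδ
  filter_upwards [radius_lt, eventually_ge_atTop N₁, eventually_ge_atTop N₂] with n hn hn₁ hn₂
  have le_heightTrunc : ∀ᵐ y ∂mollifierMeasure V n, c ≤ heightTrunc n g (x - y) := by
    filter_upwards [ae_mollifierMeasure_norm_lt n] with y hy
    have radius_le_one : 1 / ((n : ℝ) + 1) ≤ 1 := by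
      simpa using Nat.one_div_le_one_div (α := ℝ) n.zero_le
    have mem_ball : x - y ∈ Metric.ball (0 : V) n := by
      rw [mem_ball_zero_iff]
      have : (N₂ : ℝ) ≤ n := by exact_mod_cast hn₂
      linarith [norm_sub_le x y]
    rw [heightTrunc, Set.indicator_of_mem mem_ball]
    refine le_min (lt_near ?_).le (hN₁.le.trans (by exact_mod_cast hn₁))
    rw [dist_eq_norm, sub_sub_cancel_left, norm_neg]
    exact hy.trans hn
  simpa [smoothTrunc] using lintegral_mono_ae le_heightTrunc

theorem smoothTrunc_sq_le {g : V → ℝ≥0∞} (hg : Measurable g) (n : ℕ) (x : V) :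
    smoothTrunc n g x ^ 2 ≤ ∫⁻ y, g (x - y) ^ 2 ∂mollifierMeasure V n := by
  have cauchySchwarz := lintegral_mul_sq_le (mollifierMeasure V n)
    (f := fun y => heightTrunc n g (x - y)) (g := fun _ => 1)
    ((measurable_heightTrunc hg n).comp (by fun_prop)).aemeasurable aemeasurable_const
  simp only [mul_one, one_pow, lintegral_one, measure_univ] at cauchySchwarz
  exact cauchySchwarz.trans
    (lintegral_mono fun y => pow_le_pow_left' (heightTrunc_le n g (x - y)) 2)

theorem lintegral_smoothTrunc_sq_le {g : V → ℝ≥0∞} (hg : Measurable g) (n : ℕ) :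
    ∫⁻ x, smoothTrunc n g x ^ 2 ≤ ∫⁻ x, g x ^ 2 := by
  have measurable_shift : Measurable (Function.uncurry fun x y : V => g (x - y) ^ 2) :=
    (hg.comp (measurable_fst.sub measurable_snd)).pow_const 2
  calc ∫⁻ x, smoothTrunc n g x ^ 2
      ≤ ∫⁻ x, ∫⁻ y, g (x - y) ^ 2 ∂mollifierMeasure V n := lintegral_mono (smoothTrunc_sq_le hg n)
    _ = ∫⁻ y, (∫⁻ x, g (x - y) ^ 2) ∂mollifierMeasure V n :=
        lintegral_lintegral_swap measurable_shift.aemeasurable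
    _ = ∫⁻ _, (∫⁻ x, g x ^ 2) ∂mollifierMeasure V n :=
        lintegral_congr fun y => lintegral_sub_right_eq_self (fun x => g x ^ 2) y
    _ = ∫⁻ x, g x ^ 2 := by rw [lintegral_const, measure_univ, mul_one]

end Mollification

section GeneralFunctions

open Filter Topology

section Majorant

variable {X : Type*} [TopologicalSpace X]

/-- A positive lower semicontinuous majorant `g` of `|f|` such that `f` agrees with a measurable
function wherever `g` is finite; it controls absolute convergence of integrals of `f` against
measures which do not respect almost everywhere equality. -/
structure IsRegularMajorant [MeasurableSpace X] (f : X → ℂ) (g : X → ℝ≥0∞) : Prop where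
  lowerSemicontinuous : LowerSemicontinuous g
  enorm_le : ∀ x, ‖f x‖ₑ ≤ g x
  ne_zero : ∀ x, g x ≠ 0
  exists_measurable_eq : ∃ f' : X → ℂ, Measurable f' ∧ ∀ x, g x ≠ ∞ → f x = f' x

variable [MeasurableSpace X] [BorelSpace X] (μ : Measure X) [μ.WeaklyRegular]

theorem exists_lowerSemicontinuous_eq_top {N : Set X} (hN : μ N = 0) {ε : ℝ≥0∞} (hε : ε ≠ 0) :
    ∃ g : X → ℝ≥0∞, LowerSemicontinuous g ∧ (∀ x ∈ N, g x = ∞) ∧ ∫⁻ x, g x ∂μ ≤ ε := by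
  have measurableSet_N := measurableSet_toMeasurable μ N
  obtain ⟨g, le_g, lsc_g, lintegral_g⟩ := exists_le_lowerSemicontinuous_lintegral_ge μ
    ((toMeasurable μ N).indicator fun _ => ∞) (measurable_const.indicator measurableSet_N) hε
  refine ⟨g, lsc_g, fun x hx => top_le_iff.1 ?_, ?_⟩
  · simpa [subset_toMeasurable μ N hx] using le_g x
  · simpa [lintegral_indicator_const measurableSet_N, hN] using lintegral_g

theorem exists_isRegularMajorant [SigmaFinite μ] {f : X → ℂ} (hf : AEStronglyMeasurable f μ)
    {ε : ℝ≥0∞} (hε : ε ≠ 0) :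
    ∃ g, IsRegularMajorant f g ∧ ∫⁻ x, g x ^ 2 ∂μ ≤ (∫⁻ x, ‖f x‖ₑ ^ 2 ∂μ) + ε := by
  have hε₂ : ε / 2 ≠ 0 := (ENNReal.half_pos hε).ne'
  obtain ⟨g, lt_g, lsc_g, lintegral_g⟩ :=
    exists_lt_lowerSemicontinuous_lintegral_ge_of_aemeasurable μ (fun x => ‖f x‖₊ ^ 2)
      (hf.nnnorm.aemeasurable.pow_const 2) hε₂
  obtain ⟨u, lsc_u, u_eq_top, lintegral_u⟩ :=
    exists_lowerSemicontinuous_eq_top μ (N := {x | f x ≠ hf.mk f x}) hf.ae_eq_mk hε₂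
  have sq_sqrt (a : ℝ≥0∞) : (a ^ (2⁻¹ : ℝ)) ^ 2 = a :=
    mod_cast ENNReal.rpow_inv_natCast_pow two_ne_zero a
  refine ⟨fun x => (g x + u x) ^ (2⁻¹ : ℝ), ⟨?_, fun x => ?_, fun x => ?_, hf.mk f,
    hf.stronglyMeasurable_mk.measurable, fun x hx => ?_⟩, ?_⟩
  · exact ENNReal.continuous_rpow_const.comp_lowerSemicontinuous (lsc_g.add lsc_u)
      (ENNReal.monotone_rpow_of_nonneg (by norm_num))
  · rw [ENNReal.le_rpow_inv_iff two_pos, ENNReal.rpow_two]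
    exact le_add_right (lt_g x).le
  · have : g x + u x ≠ 0 := (add_pos_of_pos_of_nonneg (zero_le.trans_lt (lt_g x)) zero_le).ne'
    simpa using this
  · by_contra hne
    simp [u_eq_top x hne] at hx
  · simp_rw [sq_sqrt]
    rw [lintegral_add_left lsc_g.measurable]
    refine (add_le_add lintegral_g lintegral_u).trans_eq ?_
    rw [add_assoc, ENNReal.add_halves]
    rfl

end Majorant

theorem prod_liminf_le_liminf_prod {ι α : Type*} {l : Filter α} (s : Finset ι)
    (u : ι → α → ℝ≥0∞) :
    ∏ i ∈ s, liminf (u i) l ≤ liminf (fun a => ∏ i ∈ s, u i a) l := by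
  classical
  induction s using Finset.induction_on with
  | empty => exact le_liminf_of_le (by isBoundedDefault) (.of_forall fun _ => le_rfl)
  | insert i s hi ih =>
    simp_rw [Finset.prod_insert hi]
    exact (mul_le_mul_right ih _).trans ENNReal.le_liminf_mul

variable {m d : ℕ} {σ : Measure (ProdSpace m d)}

theorem IsRegularMajorant.integrable_prod_shift {f : Fin m → EuclideanSpace ℝ (Fin d) → ℂ}
    {g : Fin m → EuclideanSpace ℝ (Fin d) → ℝ≥0∞} (hg : ∀ i, IsRegularMajorant (f i) (g i))
    {x : EuclideanSpace ℝ (Fin d)} {t : ℝ}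
    (hfin : ∫⁻ y, ∏ i, g i (x - t • y i) ∂σ ≠ ∞) :
    Integrable (fun y : ProdSpace m d => ∏ i, f i (x - t • y i)) σ := by
  choose f' measurable_f' f_eq using fun i => (hg i).exists_measurable_eq
  have measurable_prod_g : Measurable fun y : ProdSpace m d => ∏ i, g i (x - t • y i) :=
    Finset.measurable_fun_prod _ fun i _ => (hg i).lowerSemicontinuous.measurable.comp (by fun_prop)
  have measurable_prod_f' : Measurable fun y : ProdSpace m d => ∏ i, f' i (x - t • y i) :=
    Finset.measurable_fun_prod _ fun i _ => (measurable_f' i).comp (by fun_prop)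
  refine ⟨measurable_prod_f'.aestronglyMeasurable.congr ?_, ?_⟩
  · -- No factor of the majorant vanishes, so finiteness of the product makes each factor finite.
    filter_upwards [ae_lt_top measurable_prod_g hfin] with y hy
    refine Finset.prod_congr rfl fun i _ => (f_eq i _ fun h => hy.ne ?_).symm
    rw [← Finset.mul_prod_erase _ _ (Finset.mem_univ i), h]
    exact ENNReal.top_mul (Finset.prod_ne_zero_iff.2 fun j _ => (hg j).ne_zero _)
  · refine (lintegral_mono fun y => ?_).trans_lt hfin.lt_top
    rw [enorm_prod]
    exact Finset.prod_le_prod' fun i _ => (hg i).enorm_le _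

theorem measurable_multMaximal [IsFiniteMeasure σ] {f : Fin m → EuclideanSpace ℝ (Fin d) → ℂ}
    (hf : ∀ i, IsTestFunction (f i)) : Measurable (multMaximal σ f) :=
  (lowerSemicontinuous_biSup fun t _ =>
    (continuous_multAverage hf t).enorm.lowerSemicontinuous).measurable

theorem enorm_multAverage_smoothTrunc [IsFiniteMeasure σ]
    {g : Fin m → EuclideanSpace ℝ (Fin d) → ℝ≥0∞} (hg : ∀ i, Measurable (g i)) (n : ℕ)
    (x : EuclideanSpace ℝ (Fin d)) (t : ℝ) :
    ‖multAverage σ (fun i z => ((smoothTrunc n (g i) z).toReal : ℂ)) x t‖ₑ =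
      ∫⁻ y, ∏ i, smoothTrunc n (g i) (x - t • y i) ∂σ := by
  have measurable_prod : Measurable fun y : ProdSpace m d =>
      ∏ i, smoothTrunc n (g i) (x - t • y i) :=
    Finset.measurable_fun_prod _ fun i _ => (measurable_smoothTrunc (hg i) n).comp (by fun_prop)
  have ne_top (y : ProdSpace m d) : ∏ i, smoothTrunc n (g i) (x - t • y i) ≠ ∞ :=
    ENNReal.prod_ne_top fun i _ => smoothTrunc_ne_top n (g i) _
  have average_eq : multAverage σ (fun i z => ((smoothTrunc n (g i) z).toReal : ℂ)) x t =
      ((∫⁻ y, ∏ i, smoothTrunc n (g i) (x - t • y i) ∂σ).toReal : ℂ) := by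
    rw [multAverage, ← integral_toReal measurable_prod.aemeasurable
      (.of_forall fun y => (ne_top y).lt_top), ← integral_complex_ofReal]
    simp only [ENNReal.toReal_prod, Complex.ofReal_prod]
  have lintegral_ne_top : ∫⁻ y, ∏ i, smoothTrunc n (g i) (x - t • y i) ∂σ ≠ ∞ := by
    have hfin := (integrable_prod_shift (σ := σ)
      (fun i => isTestFunction_smoothTrunc (hg i) n) x t).2.ne
    simpa only [enorm_prod, enorm_ofReal_toReal_smoothTrunc] using hfin
  rw [average_eq, ← ofReal_norm, Complex.norm_real, Real.norm_of_nonneg ENNReal.toReal_nonneg,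
    ENNReal.ofReal_toReal lintegral_ne_top]

theorem lintegral_rpow_liminf_le {X : Type*} [MeasurableSpace X] {μ : Measure X}
    {u : ℕ → X → ℝ≥0∞} (hu : ∀ n, Measurable (u n)) {p : ℝ} (hp : 0 ≤ p) :
    ∫⁻ x, (liminf (fun n => u n x) atTop ^ 2) ^ p ∂μ ≤
      liminf (fun n => ∫⁻ x, (u n x ^ 2) ^ p ∂μ) atTop := by
  have monotone_pow : Monotone fun a : ℝ≥0∞ => (a ^ 2) ^ p := fun a b hab =>
    ENNReal.rpow_le_rpow (pow_le_pow_left' hab 2) hp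
  have continuous_pow : Continuous fun a : ℝ≥0∞ => (a ^ 2) ^ p :=
    ENNReal.continuous_rpow_const.comp (ENNReal.continuous_pow 2)
  calc ∫⁻ x, (liminf (fun n => u n x) atTop ^ 2) ^ p ∂μ
      = ∫⁻ x, liminf (fun n => (u n x ^ 2) ^ p) atTop ∂μ :=
        lintegral_congr fun x => monotone_pow.map_liminf_of_continuousAt (fun n => u n x)
          continuous_pow.continuousAt
    _ ≤ _ := lintegral_liminf_le fun n => ((hu n).pow_const 2).pow_const p

theorem lintegral_prod_le_liminf_multMaximal_smoothTrunc [IsFiniteMeasure σ]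
    {g : Fin m → EuclideanSpace ℝ (Fin d) → ℝ≥0∞} (hg : ∀ i, LowerSemicontinuous (g i))
    (x : EuclideanSpace ℝ (Fin d)) {t : ℝ} (ht : 0 < t) :
    ∫⁻ y, ∏ i, g i (x - t • y i) ∂σ ≤
      liminf (fun n => multMaximal σ (fun i z => ((smoothTrunc n (g i) z).toReal : ℂ)) x) atTop :=
  calc ∫⁻ y, ∏ i, g i (x - t • y i) ∂σ
      ≤ ∫⁻ y, liminf (fun n => ∏ i, smoothTrunc n (g i) (x - t • y i)) atTop ∂σ :=
        lintegral_mono fun y =>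
          (Finset.prod_le_prod' fun i _ => le_liminf_smoothTrunc (hg i) _).trans
            (prod_liminf_le_liminf_prod _ _)
    _ ≤ liminf (fun n => ∫⁻ y, ∏ i, smoothTrunc n (g i) (x - t • y i) ∂σ) atTop :=
        lintegral_liminf_le fun n => Finset.measurable_fun_prod _ fun i _ =>
          (measurable_smoothTrunc (hg i).measurable n).comp (by fun_prop)
    _ ≤ _ := by
        refine liminf_le_liminf (.of_forall fun n => ?_)
        rw [← enorm_multAverage_smoothTrunc fun i => (hg i).measurable]
        exact le_iSup₂ (f := fun t _ => ‖multAverage σ _ x t‖ₑ) t ht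

variable {C : ℝ≥0}

theorem HasTestFunctionBound.lintegral_liminf_multMaximal_smoothTrunc_le [IsFiniteMeasure σ]
    (hC : HasTestFunctionBound σ C) {g : Fin m → EuclideanSpace ℝ (Fin d) → ℝ≥0∞}
    (hg : ∀ i, Measurable (g i)) :
    ∫⁻ x, (liminf (fun n => multMaximal σ (fun i z => ((smoothTrunc n (g i) z).toReal : ℂ)) x)
      atTop ^ 2) ^ (m : ℝ)⁻¹ ≤ C * (∏ i, ∫⁻ x, g i x ^ 2) ^ (m : ℝ)⁻¹ := by
  have hp : (0 : ℝ) ≤ (m : ℝ)⁻¹ := by positivity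
  have test (n : ℕ) (i : Fin m) := isTestFunction_smoothTrunc (hg i) n
  refine (lintegral_rpow_liminf_le (fun n => measurable_multMaximal (test n)) hp).trans
    (liminf_le_of_frequently_le' (Frequently.of_forall fun n => (hC _ (test n)).trans ?_))
  simp only [enorm_ofReal_toReal_smoothTrunc]
  exact mul_le_mul' le_rfl (ENNReal.rpow_le_rpow
    (Finset.prod_le_prod' fun i _ => lintegral_smoothTrunc_sq_le (hg i) n) hp)

theorem HasTestFunctionBound.exists_measurable_majorant [IsFiniteMeasure σ]
    (hC : HasTestFunctionBound σ C) {f : Fin m → EuclideanSpace ℝ (Fin d) → ℂ}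
    (hf : ∀ i, AEStronglyMeasurable (f i) volume) {ε : ℝ≥0∞} (hε : ε ≠ 0) :
    ∃ H : EuclideanSpace ℝ (Fin d) → ℝ≥0∞, Measurable H ∧ (∀ x, multMaximal σ f x ≤ H x) ∧
      (∀ x, H x ≠ ∞ → ∀ t : ℝ, 0 < t →
        Integrable (fun y : ProdSpace m d => ∏ i, f i (x - t • y i)) σ) ∧
      ∫⁻ x, (H x ^ 2) ^ (m : ℝ)⁻¹ ≤ C * (∏ i, ((∫⁻ x, ‖f i x‖ₑ ^ 2) + ε)) ^ (m : ℝ)⁻¹ := by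
  choose g majorant lintegral_g using fun i => exists_isRegularMajorant volume (hf i) hε
  have lsc_g (i : Fin m) := (majorant i).lowerSemicontinuous
  have lintegral_prod_le (x) {t : ℝ} (ht : 0 < t) :=
    lintegral_prod_le_liminf_multMaximal_smoothTrunc (σ := σ) lsc_g x ht
  refine ⟨_, .liminf (f := fun n => multMaximal σ _) fun n => measurable_multMaximal fun i =>
    isTestFunction_smoothTrunc (lsc_g i).measurable n, fun x => iSup₂_le fun t ht => ?_,
    fun x hx t ht => ?_, ?_⟩
  · exact (enorm_multAverage_le_lintegral σ f x t).trans ((lintegral_mono fun y =>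
      Finset.prod_le_prod' fun i _ => (majorant i).enorm_le _).trans (lintegral_prod_le x ht))
  · exact IsRegularMajorant.integrable_prod_shift majorant
      ((lintegral_prod_le x ht).trans_lt hx.lt_top).ne
  · refine (hC.lintegral_liminf_multMaximal_smoothTrunc_le fun i => (lsc_g i).measurable).trans ?_
    exact mul_le_mul' le_rfl (ENNReal.rpow_le_rpow
      (Finset.prod_le_prod' fun i _ => lintegral_g i) (by positivity))

theorem HasTestFunctionBound.ae_forall_integrable_prod_shift [IsFiniteMeasure σ] (hm : m ≠ 0)
    (hC : HasTestFunctionBound σ C) {f : Fin m → EuclideanSpace ℝ (Fin d) → ℂ}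
    (hf : ∀ i, MemLp (f i) 2 volume) :
    ∀ᵐ x : EuclideanSpace ℝ (Fin d), ∀ t : ℝ, 0 < t →
      Integrable (fun y : ProdSpace m d => ∏ i, f i (x - t • y i)) σ := by
  have hp : (0 : ℝ) < (m : ℝ)⁻¹ := by positivity
  obtain ⟨H, measurable_H, -, integrable_of_ne_top, lintegral_H⟩ :=
    hC.exists_measurable_majorant (fun i => (hf i).1) one_ne_zero
  have lintegral_H_ne_top : ∫⁻ x, (H x ^ 2) ^ (m : ℝ)⁻¹ ≠ ∞ := by
    refine (lintegral_H.trans_lt (ENNReal.mul_lt_top ENNReal.coe_lt_top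
      (ENNReal.rpow_lt_top_of_nonneg hp.le (ENNReal.prod_ne_top fun i _ => ?_)))).ne
    rw [← eLpNorm_two_sq]
    exact ENNReal.add_ne_top.2 ⟨ENNReal.pow_ne_top (hf i).2.ne, ENNReal.one_ne_top⟩
  filter_upwards [ae_lt_top ((measurable_H.pow_const 2).pow_const _) lintegral_H_ne_top] with x hx
  refine integrable_of_ne_top x fun h => hx.ne ?_
  rw [h, ENNReal.top_pow two_ne_zero, ENNReal.top_rpow_of_pos hp]

theorem HasTestFunctionBound.lintegral_multMaximal_le [IsFiniteMeasure σ]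
    (hC : HasTestFunctionBound σ C) {f : Fin m → EuclideanSpace ℝ (Fin d) → ℂ}
    (hf : ∀ i, MemLp (f i) 2 volume) :
    ∫⁻ x, (multMaximal σ f x ^ 2) ^ (m : ℝ)⁻¹ ≤
      C * (∏ i, ∫⁻ x, ‖f i x‖ₑ ^ 2) ^ (m : ℝ)⁻¹ := by
  have hp : (0 : ℝ) ≤ (m : ℝ)⁻¹ := by positivity
  have perturbed (n : ℕ) : ∫⁻ x, (multMaximal σ f x ^ 2) ^ (m : ℝ)⁻¹ ≤
      C * (∏ i, ((∫⁻ x, ‖f i x‖ₑ ^ 2) + (n : ℝ≥0∞)⁻¹)) ^ (m : ℝ)⁻¹ := by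
    obtain ⟨H, -, multMaximal_le, -, lintegral_H⟩ := hC.exists_measurable_majorant
      (fun i => (hf i).1) (ENNReal.inv_ne_zero.2 (ENNReal.natCast_ne_top n))
    exact (lintegral_mono fun x =>
      ENNReal.rpow_le_rpow (pow_le_pow_left' (multMaximal_le x) 2) hp).trans lintegral_H
  have factor_tendsto (i : Fin m) : Tendsto
      (fun n : ℕ => (∫⁻ x, ‖f i x‖ₑ ^ 2) + (n : ℝ≥0∞)⁻¹) atTop (𝓝 (∫⁻ x, ‖f i x‖ₑ ^ 2)) := by
    simpa using ENNReal.tendsto_inv_nat_nhds_zero.const_add (∫⁻ x, ‖f i x‖ₑ ^ 2)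
  have factor_ne_top (i : Fin m) : ∫⁻ x, ‖f i x‖ₑ ^ 2 ≠ ∞ := by
    rw [← eLpNorm_two_sq]
    exact ENNReal.pow_ne_top (hf i).2.ne
  exact ge_of_tendsto' (ENNReal.Tendsto.const_mul ((ENNReal.continuous_rpow_const.tendsto _).comp
    (ENNReal.tendsto_finsetProd_of_ne_top _ (fun i _ => factor_tendsto i)
      fun i _ => factor_ne_top i)) (.inr ENNReal.coe_ne_top)) perturbed

theorem eLpNorm_two_div_natCast {X : Type*} [MeasurableSpace X] {μ : Measure X} {n : ℕ} (hn : n ≠ 0)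
    (h : X → ℝ≥0∞) :
    eLpNorm h (2 / (n : ℝ≥0∞)) μ = (∫⁻ x, (h x ^ 2) ^ (n : ℝ)⁻¹ ∂μ) ^ ((n : ℝ) / 2) := by
  rw [eLpNorm_eq_lintegral_rpow_enorm_toReal (by simp) (by simp [ENNReal.div_eq_top, hn])]
  simp [div_eq_mul_inv, ENNReal.rpow_mul]

theorem HasTestFunctionBound.eLpNorm_multMaximal_le [IsFiniteMeasure σ] (hm : m ≠ 0)
    (hC : HasTestFunctionBound σ C) {f : Fin m → EuclideanSpace ℝ (Fin d) → ℂ}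
    (hf : ∀ i, MemLp (f i) 2 volume) :
    eLpNorm (multMaximal σ f) (2 / (m : ℝ≥0∞)) volume ≤
      (C ^ ((m : ℝ) / 2) : ℝ≥0) * ∏ i, eLpNorm (f i) 2 volume := by
  have hp : (0 : ℝ) ≤ (m : ℝ) / 2 := by positivity
  calc eLpNorm (multMaximal σ f) (2 / (m : ℝ≥0∞)) volume
      ≤ (C * (∏ i, ∫⁻ x, ‖f i x‖ₑ ^ 2) ^ (m : ℝ)⁻¹) ^ ((m : ℝ) / 2) := by
        rw [eLpNorm_two_div_natCast hm]
        exact ENNReal.rpow_le_rpow (hC.lintegral_multMaximal_le hf) hp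
    _ = (C ^ ((m : ℝ) / 2) : ℝ≥0) * ((∏ i, eLpNorm (f i) 2 volume) ^ 2) ^ (2⁻¹ : ℝ) := by
        have exponent : (m : ℝ)⁻¹ * ((m : ℝ) / 2) = 2⁻¹ := by field_simp
        rw [ENNReal.mul_rpow_of_nonneg _ _ hp, ENNReal.coe_rpow_of_nonneg _ hp, ← ENNReal.rpow_mul,
          exponent, ← Finset.prod_pow]
        simp only [eLpNorm_two_sq]
    _ = (C ^ ((m : ℝ) / 2) : ℝ≥0) * ∏ i, eLpNorm (f i) 2 volume :=
        congrArg _ (mod_cast ENNReal.pow_rpow_inv_natCast two_ne_zero _)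

end GeneralFunctions

theorem theorem1p3_general {m d : ℕ} (hm : m ≠ 0) {s : ℝ}
    (hs : ((m : ℝ) - 1) * (d : ℝ) / 2 + 1 / 2 < s) {σ : Measure (ProdSpace m d)}
    [IsFiniteMeasure σ] (hsupp : σ (Metric.closedBall (0 : ProdSpace m d) 1)ᶜ = 0)
    (hdecay : HasFourierDecay σ s) :
    ∃ C : ℝ≥0, ∀ f : Fin m → EuclideanSpace ℝ (Fin d) → ℂ,
      (∀ i, MemLp (f i) 2 volume) →
        (∀ᵐ x : EuclideanSpace ℝ (Fin d), ∀ t : ℝ, 0 < t →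
          Integrable (fun y : ProdSpace m d => ∏ i, f i (x - t • y i)) σ) ∧
        eLpNorm (multMaximal σ f) (2 / (m : ℝ≥0∞)) volume
          ≤ (C : ℝ≥0∞) * ∏ i, eLpNorm (f i) 2 volume := by
  have norm_le_one : ∀ᵐ y ∂σ, ‖y‖ ≤ 1 := by simpa [ae_iff, Set.compl_def] using hsupp
  obtain ⟨ε, hε, smoothing⟩ := exists_hasUnitSmoothing hm hs norm_le_one hdecay
  obtain ⟨C, hC⟩ := exists_hasTestFunctionBound hm norm_le_one hε smoothing
  exact ⟨C ^ ((m : ℝ) / 2), fun f hf =>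
    ⟨hC.ae_forall_integrable_prod_shift hm hf, hC.eLpNorm_multMaximal_le hm hf⟩⟩

theorem theorem1p3 (m d : ℕ) (hm : 2 ≤ m) (hd : 1 ≤ d) (s : ℝ)
    (hs : ((m : ℝ) - 1) * (d : ℝ) / 2 + 1 / 2 < s)
    (σ : Measure (ProdSpace m d)) [IsFiniteMeasure σ]
    (hsupp : σ (Metric.closedBall (0 : ProdSpace m d) 1)ᶜ = 0)
    (hdecay : HasFourierDecay σ s) :
    ∃ C : ℝ≥0, ∀ f : Fin m → EuclideanSpace ℝ (Fin d) → ℂ,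
      (∀ i, MemLp (f i) 2 volume) →
        (∀ᵐ x : EuclideanSpace ℝ (Fin d), ∀ t : ℝ, 0 < t →
          Integrable (fun y : ProdSpace m d => ∏ i, f i (x - t • y i)) σ) ∧
        eLpNorm (multMaximal σ f) (2 / (m : ℝ≥0∞)) volume
          ≤ (C : ℝ≥0∞) * ∏ i, eLpNorm (f i) 2 volume :=
  theorem1p3_general (by omega) hs hsupp hdecay
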